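/- Let $M$ be a Riemann surface, i.e. a (Hausdorff, second countable) smooth real surface with a smooth endomorphism field $J_M$ of $TM$, $J_M^2=-1$; for a 1-form $\omega$ put $*\omega=\omega\circ J_M$. If the target bundle of 1-forms has a complex structure $S$, write $\omega'=\frac12(\omega-S*\omega)$ and $\omega''=\frac12(\omega+S*\omega)$ for the $K$- and $\bar K$-parts ($*\omega'=S\omega'$, $*\omega''=-S\omega''$). Let $V$ be a smooth real vector bundle over $M$ with complex structure $J$. A holomorphic structure on $(V,J)$ is a real linear map $D\colon\Gamma(V)\to\Gamma(\bar KV)$ with $D(f\psi)=fD\psi+\frac12(df\,\psi+*df\,J\psi)$ for real functions $f$. It splits as $D=\bar\partial+Q$, $\bar\partial=\frac12(D-JDJ)$, with Hopf field $Q=\frac12(D+JDJ)$. A bundle map $T$ is holomorphic if $TJ=\tilde JT$ and $\tilde DT=TD$. A holomorphic jet complex $\mathcal V$ of $(V,J,D)$ consists of real vector bundles $V_n$, $n\ge 0$, $V_0=V$, $\operatorname{rank}V_n=(n+1)\operatorname{rank}V$, surjective bundle homomorphisms $\pi_n\colon V_n\to V_{n-1}$ and real linear maps $d_n\colon\Gamma(V_n)\to\Omega^1(V_{n-1})$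 ($\pi_0=0$, $d_0=0$) such that $d_n(f\psi)=fd_n\psi+df\,\pi_n\psi$, $\pi_{n-1}d_n=d_{n-1}\pi_n$ and $d_{n-1}d_n=0$, where $(d\omega)(X,Y)=d_X(\omega(Y))-d_Y(\omega(X))-\pi\omega([X,Y])$ on 1-forms; the kernels $N_n=\ker\pi_n$ have complex structures $J_n$, $J_0=J$, for which $\delta_n=d_n|_{N_n}\colon N_n\to KN_{n-1}$, $n\ge1$, are complex linear bundle isomorphisms; and $D\pi_1=d_1''$. A homomorphism of jet complexes is a sequence of real linear bundle homomorphisms $T_n\colon V_n\to\tilde V_n$ commuting with $\pi$ and $d$, with $T_0$ holomorphic. Put $F_k=\ker\pi^{k+1}\subset V_n$. An adapted complex structure $S$ on $\mathcal V$ is a sequence of complex structures $S_n$ on $V_n$ with $\pi S=S\pi$ and $S_n|_{N_n}=J_n$ (so $S_0=J$); then $d'$, $d''$ are taken with respect to $S$. \textbf{Theorem.} (1) Every $(V,J,D)$ has a holomorphic jet complex. If $\mathcal V,\tilde{\mathcal V}$ are holomorphic jet complexes of $(V,J,D)$ and $(\tilde V,\tilde J,\tilde D)$ over $M$, every holomorphic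 bundle map $T_0\colon V\to\tilde V$ extends to a unique homomorphism $\mathcal V\to\tilde{\mathcal V}$. In particular, between two jet complexes of $(V,J,D)$ there is exactly one homomorphism extending $\mathrm{id}_V$, and it is an isomorphism. (2) Let $\mathcal V$ be a holomorphic jet complex of $(V,J,D)$. There is a unique adapted complex structure $S$ with $[d',S]=0$ (i.e. $d_n'S_n=S_{n-1}d_n'$ for all $n\ge1$). For an adapted complex structure $S$, the condition $[d',S]=0$ is equivalent to the vanishing of the bundle maps $[d'',S]$ on $F_{n-1}\subset V_n$ for all $n\ge1$. For every adapted $S$ there is a unique sequence of holomorphic structures $D_n$ on $(V_n,S_n)$ with $D_n\pi_{n+1}=d_{n+1}''$. If $[d',S]=0$, then $D_0=D$, the maps $\pi_n$ are holomorphic, the Hopf field $Q_n$ of $D_n=\bar\partial_n+Q_n$ vanishes on $F_{n-1}$, and, for $k<n$, $D_n$ preserves $F_k\subset V_n$ and restricts to the complex linear $\bar\partial_n$ there. (3) Let in addition $V$ be a quaternionic vector bundle (fibres are right $\mathbb H$-vector spaces) with $J$ and $D$ quaternionic linear. Then on every holomorphic jet complex $\mathcal V$ of $(V,J,D)$ there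 are unique quaternionic structures on the $V_n$, the given one on $V_0=V$, making all $\pi_n$ and $d_n$ quaternionic linear, and the isomorphism of (1) between two jet complexes is quaternionic linear: $V$ has a quaternionic holomorphic jet complex, unique up to unique isomorphism. The complex structures $S_n$ with $[d',S]=0$ and the holomorphic structures $D_n$ of (2) are quaternionic linear, so the $\pi_n$ are quaternionic holomorphic bundle maps. There are unique real linear prolongation maps $P_n\colon\ker D\to\Gamma(V_n)$ with $P_0=\mathrm{id}$, $\pi_{n+1}P_{n+1}=P_n$ and $d_nP_n=0$; they are injective and quaternionic linear. -/

import Mathlib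

open scoped Manifold ContDiff Bundle Quaternion

universe u v w

noncomputable section

/-- A smooth real vector bundle of finite rank over the surface `M`, bundled: a typical fibre `F`
(its dimension is the rank), the fibres, and Mathlib's structure of a smooth vector bundle. -/
structure SmoothVB (M : Type u) [TopologicalSpace M] [ChartedSpace (EuclideanSpace ℝ (Fin 2)) M]
    where
  F : Type
  [instF₁ : NormedAddCommGroup F]
  [instF₂ : NormedSpace ℝ F]
  [instF₃ : FiniteDimensional ℝ F]
  fiber : M → Type v
  [inst₁ : ∀ x, AddCommGroup (fiber x)]
  [inst₂ : ∀ x, Module ℝ (fiber x)]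
  [inst₃ : ∀ x, TopologicalSpace (fiber x)]
  [inst₄ : TopologicalSpace (Bundle.TotalSpace F fiber)]
  [inst₅ : FiberBundle F fiber]
  [inst₆ : VectorBundle ℝ F fiber]
  [inst₇ : ContMDiffVectorBundle ∞ F fiber (𝓡 2)]

attribute [instance] SmoothVB.instF₁ SmoothVB.instF₂ SmoothVB.instF₃ SmoothVB.inst₁ SmoothVB.inst₂
  SmoothVB.inst₃ SmoothVB.inst₄ SmoothVB.inst₅ SmoothVB.inst₆ SmoothVB.inst₇

section Basic

variable {M : Type u} [TopologicalSpace M] [ChartedSpace (EuclideanSpace ℝ (Fin 2)) M]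

/-- The real rank of a vector bundle. -/
def SmoothVB.rank (V : SmoothVB.{u, v} M) : ℕ := Module.finrank ℝ V.F

/-- The space `Γ(V)` of smooth sections. -/
abbrev Sec (V : SmoothVB.{u, v} M) : Type (max u v) :=
  ContMDiffSection (𝓡 2) V.F ∞ V.fiber

/-- Smooth real-linear bundle homomorphisms over the identity of `M`. -/
structure BundleHom (V : SmoothVB.{u, v} M) (W : SmoothVB.{u, w} M) where
  toFun : ∀ x, V.fiber x →ₗ[ℝ] W.fiber x
  smooth : ContMDiff ((𝓡 2).prod 𝓘(ℝ, V.F)) ((𝓡 2).prod 𝓘(ℝ, W.F)) ∞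
    (fun p : Bundle.TotalSpace V.F V.fiber =>
      (⟨p.1, toFun p.1 p.2⟩ : Bundle.TotalSpace W.F W.fiber))

instance (V : SmoothVB.{u, v} M) (W : SmoothVB.{u, w} M) :
    CoeFun (BundleHom V W) (fun _ => ∀ x, V.fiber x →ₗ[ℝ] W.fiber x) := ⟨BundleHom.toFun⟩

/-- The identity bundle homomorphism. -/
def BundleHom.id (V : SmoothVB.{u, v} M) : BundleHom V V where
  toFun _ := LinearMap.id
  smooth := contMDiff_id

/-- A bundle homomorphism acts on sections. -/
def BundleHom.app {V : SmoothVB.{u, v} M} {W : SmoothVB.{u, w} M} (T : BundleHom V W)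
    (ψ : Sec V) : Sec W where
  toFun x := T x (ψ x)
  contMDiff_toFun := T.smooth.comp ψ.contMDiff

/-- The product `f ψ` of a smooth real function and a section. -/
def Sec.fsmul {V : SmoothVB.{u, v} M} (f : C^∞⟮𝓡 2, M; ℝ⟯) (ψ : Sec V) : Sec V where
  toFun x := f x • ψ x
  contMDiff_toFun := f.contMDiff.smul_section ψ.contMDiff

/-- A complex structure on a vector bundle: a smooth endomorphism field with square `-1`. -/
structure ComplexStr (V : SmoothVB.{u, v} M) extends BundleHom V V where
  sq : ∀ x w, toFun x (toFun x w) = -w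

instance (V : SmoothVB.{u, v} M) :
    CoeFun (ComplexStr V) (fun _ => ∀ x, V.fiber x →ₗ[ℝ] V.fiber x) := ⟨fun J => J.toFun⟩

/-- A quaternionic structure on a vector bundle: a smooth fibrewise structure of a right vector
space over `ℍ` that extends the real one; `rmul q` is the right multiplication `ψ ↦ ψ q`. -/
structure QuatStr (V : SmoothVB.{u, v} M) where
  rmul : ℍ[ℝ] → BundleHom V V
  rmul_add : ∀ p q x w, rmul (p + q) x w = rmul p x w + rmul q x w
  rmul_mul : ∀ p q x w, rmul (p * q) x w = rmul q x (rmul p x w)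
  rmul_real : ∀ (c : ℝ) x w, rmul (c : ℍ[ℝ]) x w = c • w

/-- Quaternionic linear bundle homomorphisms. -/
def QuatStr.IsLinear {V : SmoothVB.{u, v} M} {W : SmoothVB.{u, w} M} (q : QuatStr V)
    (q' : QuatStr W) (T : BundleHom V W) : Prop :=
  ∀ a x w, T x (q.rmul a x w) = q'.rmul a x (T x w)

variable [IsManifold (𝓡 2) ∞ M]

variable (M) in
/-- The tangent bundle of `M`. -/
abbrev TM : SmoothVB.{u, 0} M where
  F := EuclideanSpace ℝ (Fin 2)
  fiber := fun x : M => TangentSpace (𝓡 2) x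

/-- `V`-valued 1-forms, as smooth bundle homomorphisms `TM → V`. -/
abbrev OneForm (V : SmoothVB.{u, v} M) := BundleHom (TM M) V

/-- The differential of a real function, evaluated on a tangent vector. -/
def dfun (f : C^∞⟮𝓡 2, M; ℝ⟯) (x : M) (X : (TM M).fiber x) : ℝ :=
  mfderiv (𝓡 2) 𝓘(ℝ, ℝ) f x X

/-- Real-linear maps `Γ(V) → Ω¹(W)`; `L ψ x X` is the value of the 1-form `L ψ` on `X ∈ T_x M`. -/
structure RealOp (V : SmoothVB.{u, v} M) (W : SmoothVB.{u, w} M) where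
  toFun : Sec V → OneForm W
  map_add : ∀ ψ φ x X, toFun (ψ + φ) x X = toFun ψ x X + toFun φ x X
  map_smul : ∀ (c : ℝ) ψ x X, toFun (c • ψ) x X = c • toFun ψ x X

instance (V : SmoothVB.{u, v} M) (W : SmoothVB.{u, w} M) :
    CoeFun (RealOp V W) (fun _ => Sec V → OneForm W) := ⟨RealOp.toFun⟩

/-- The `K`-part `L' = ½ (L - S * L)` with respect to the complex structure `S` on the target,
where `* ω = ω ∘ J_M`. -/
def RealOp.kPart (JM : ComplexStr (TM M)) {V : SmoothVB.{u, v} M} {W : SmoothVB.{u, w} M}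
    (S : ComplexStr W) (L : RealOp V W) (ψ : Sec V) (x : M) (X : (TM M).fiber x) : W.fiber x :=
  (1 / 2 : ℝ) • (L ψ x X - S x (L ψ x (JM x X)))

/-- The `K̄`-part `L'' = ½ (L + S * L)`. -/
def RealOp.kbarPart (JM : ComplexStr (TM M)) {V : SmoothVB.{u, v} M} {W : SmoothVB.{u, w} M}
    (S : ComplexStr W) (L : RealOp V W) (ψ : Sec V) (x : M) (X : (TM M).fiber x) : W.fiber x :=
  (1 / 2 : ℝ) • (L ψ x X + S x (L ψ x (JM x X)))

/-- A holomorphic structure on `(V, J)`: a real-linear map `D : Γ(V) → Γ(K̄ V)` with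
`D (f ψ) = f D ψ + ½ (df ψ + * df J ψ)` for real functions `f`. -/
structure HolStr (JM : ComplexStr (TM M)) {V : SmoothVB.{u, v} M} (J : ComplexStr V)
    extends RealOp V V where
  type_kbar : ∀ ψ x X, toFun ψ x (JM x X) = -(J x (toFun ψ x X))
  leibniz : ∀ (f : C^∞⟮𝓡 2, M; ℝ⟯) ψ x X, toFun (ψ.fsmul f) x X =
    f x • toFun ψ x X + (1 / 2 : ℝ) • (dfun f x X • ψ x + dfun f x (JM x X) • J x (ψ x))

instance (JM : ComplexStr (TM M)) {V : SmoothVB.{u, v} M} (J : ComplexStr V) :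
    CoeFun (HolStr JM J) (fun _ => Sec V → OneForm V) := ⟨fun D => D.toFun⟩

section Hol

variable {JM : ComplexStr (TM M)} {V : SmoothVB.{u, v} M} {J : ComplexStr V}

/-- The `J`-commuting part `∂̄ = ½ (D - J D J)`. -/
def HolStr.delbar (D : HolStr JM J) (ψ : Sec V) (x : M) (X : (TM M).fiber x) : V.fiber x :=
  (1 / 2 : ℝ) • (D ψ x X - J x (D (J.toBundleHom.app ψ) x X))

/-- The Hopf field, i.e. the `J`-anticommuting part `Q = ½ (D + J D J)`. -/
def HolStr.hopf (D : HolStr JM J) (ψ : Sec V) (x : M) (X : (TM M).fiber x) : V.fiber x :=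
  (1 / 2 : ℝ) • (D ψ x X + J x (D (J.toBundleHom.app ψ) x X))

/-- The space `H⁰(V) = ker D` of holomorphic sections. -/
def HolStr.H0 (D : HolStr JM J) : Submodule ℝ (Sec V) where
  carrier := {ψ | ∀ x X, D ψ x X = 0}
  add_mem' {a b} ha hb x X := by rw [D.map_add, ha, hb, add_zero]
  zero_mem' x X := by
    have h := D.map_smul 0 0 x X
    rwa [zero_smul, zero_smul] at h
  smul_mem' c a ha x X := by rw [D.map_smul, ha, smul_zero]

/-- A bundle homomorphism is holomorphic if it is complex linear and intertwines the holomorphic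
structures. -/
def IsHolomorphicHom {V' : SmoothVB.{u, w} M} {J' : ComplexStr V'}
    (D : HolStr JM J) (D' : HolStr JM J') (T : BundleHom V V') : Prop :=
  (∀ x w, T x (J x w) = J' x (T x w)) ∧ ∀ ψ x X, T x (D ψ x X) = D' (T.app ψ) x X

end Hol

/-- A real-linear map `Γ(V) → Ω¹(W)` is quaternionic linear. -/
def RealOp.IsQuatLinear {V : SmoothVB.{u, v} M} {W : SmoothVB.{u, w} M} (q : QuatStr V)
    (q' : QuatStr W) (L : RealOp V W) : Prop :=
  ∀ a ψ x X, L ((q.rmul a).app ψ) x X = q'.rmul a x (L ψ x X)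

/-- The sequence of bundles `V, tail 0, tail 1, …`. -/
@[reducible] def jetSeq (V : SmoothVB.{u, v} M) (tail : ℕ → SmoothVB.{u, v} M) :
    ℕ → SmoothVB.{u, v} M
  | 0 => V
  | n + 1 => tail n

/-- A sequence of real vector bundles `V_0 = V, V_1 = tail 0, V_2 = tail 1, …` with
`rank V_n = (n + 1) rank V` and fibrewise surjective homomorphisms `π = pr n : V_{n+1} → V_n`. -/
structure JetTower (V : SmoothVB.{u, v} M) where
  tail : ℕ → SmoothVB.{u, v} M
  rank_eq : ∀ n, (jetSeq V tail n).rank = (n + 1) * V.rank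
  pr : ∀ n, BundleHom (jetSeq V tail (n + 1)) (jetSeq V tail n)
  pr_surjective : ∀ n x, Function.Surjective (pr n x)

/-- The bundles `V_n` of the tower. -/
@[reducible] def JetTower.E {V : SmoothVB.{u, v} M} (𝒯 : JetTower V) (n : ℕ) : SmoothVB.{u, v} M :=
  jetSeq V 𝒯.tail n

/-- The flag `F_k = ker π^{k+1} ⊆ V_n` (fibrewise). The projection on `V_0` is `0`, hence
`F_k = V_n` for `k ≥ n`. -/
def JetTower.flag {V : SmoothVB.{u, v} M} (𝒯 : JetTower V) :
    (n k : ℕ) → (x : M) → Submodule ℝ ((𝒯.E n).fiber x)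
  | 0, _, _ => ⊤
  | n + 1, 0, x => LinearMap.ker (𝒯.pr n x)
  | n + 1, k + 1, x => (JetTower.flag 𝒯 n k x).comap (𝒯.pr n x)

/-- `N_n = ker π ⊆ V_n` (fibrewise), with `N_0 = V_0`. -/
@[reducible] def JetTower.N {V : SmoothVB.{u, v} M} (𝒯 : JetTower V) (n : ℕ) (x : M) :
    Submodule ℝ ((𝒯.E n).fiber x) :=
  𝒯.flag n 0 x

/-- `K W` on one fibre: the real-linear maps `η : T → W` with `η ∘ j = J ∘ η`. -/
def KForms {T : Type*} {W : Type*} [AddCommGroup T] [Module ℝ T] [AddCommGroup W] [Module ℝ W]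
    (j : T →ₗ[ℝ] T) (J : W →ₗ[ℝ] W) : Submodule ℝ (T →ₗ[ℝ] W) where
  carrier := {η | ∀ X, η (j X) = J (η X)}
  add_mem' {a b} ha hb X := by
    rw [LinearMap.add_apply, LinearMap.add_apply, ha, hb, map_add]
  zero_mem' X := by rw [LinearMap.zero_apply, LinearMap.zero_apply, map_zero]
  smul_mem' c a ha X := by
    rw [LinearMap.smul_apply, LinearMap.smul_apply, ha, map_smul]

/-- A holomorphic jet complex of the bundle `V` with complex structure `J` and holomorphic
structure `D`. Here `d n : Γ(V_{n+1}) → Ω¹(V_n)`; the zero maps on `V_0` are omitted. -/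
structure JetComplex {JM : ComplexStr (TM M)} {V : SmoothVB.{u, v} M} {J : ComplexStr V}
    (D : HolStr JM J) extends JetTower V where
  d : ∀ n, RealOp (toJetTower.E (n + 1)) (toJetTower.E n)
  d_leibniz : ∀ n (f : C^∞⟮𝓡 2, M; ℝ⟯) ψ x X,
    d n (ψ.fsmul f) x X = f x • d n ψ x X + dfun f x X • pr n x (ψ x)
  pr_d : ∀ n ψ x X, pr n x (d (n + 1) ψ x X) = d n ((pr (n + 1)).app ψ) x X
  /-- `d ∘ d = 0`, where `(d ω)(X, Y) = d_X (ω(Y)) - d_Y (ω(X)) - π ω([X, Y])` on 1-forms. -/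
  d_d : ∀ n ψ (X Y : Sec (TM M)) x,
    d n ((d (n + 1) ψ).app Y) x (X x) - d n ((d (n + 1) ψ).app X) x (Y x)
      - pr n x (d (n + 1) ψ x (VectorField.mlieBracket (𝓡 2) (fun y => X y) (fun y => Y y) x)) = 0
  /-- The complex structures `J_n` on the bundles `N_n`, with `J_0 = J`. -/
  JN : ∀ n x, toJetTower.N n x →ₗ[ℝ] toJetTower.N n x
  JN_sq : ∀ n x w, JN n x (JN n x w) = -w
  JN_smooth : ∀ n (ψ : Sec (toJetTower.E n)) (h : ∀ x, ψ x ∈ toJetTower.N n x),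
    ContMDiff (𝓡 2) ((𝓡 2).prod 𝓘(ℝ, (toJetTower.E n).F)) ∞
      (fun x => (⟨x, (JN n x ⟨ψ x, h x⟩ : (toJetTower.E n).fiber x)⟩ :
        Bundle.TotalSpace (toJetTower.E n).F (toJetTower.E n).fiber))
  JN_zero : ∀ x (w : toJetTower.N 0 x), (JN 0 x w : V.fiber x) = J x w
  /-- On sections of `N_{n+1}` the map `d` is given by a complex linear bundle isomorphism
  `δ : N_{n+1} → K N_n`. -/
  exists_delta : ∀ n x,
    ∃ δ : toJetTower.N (n + 1) x →ₗ[ℝ] (TM M).fiber x →ₗ[ℝ] toJetTower.N n x,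
      Function.Injective δ ∧ LinearMap.range δ = KForms (JM x) (JN n x) ∧
      (∀ w X, δ (JN (n + 1) x w) X = JN n x (δ w X)) ∧
      ∀ (ψ : Sec (toJetTower.E (n + 1))) (h : ∀ y, ψ y ∈ toJetTower.N (n + 1) y)
        (X : (TM M).fiber x),
        d n ψ x X = (δ ⟨ψ x, h x⟩ X : (toJetTower.E n).fiber x)
  /-- `D π_1 = d_1''`. -/
  D_pr : ∀ (ψ : Sec (toJetTower.E 1)) x X, D ((pr 0).app ψ) x X = (d 0).kbarPart JM J ψ x X

section Jet

variable {JM : ComplexStr (TM M)} {V : SmoothVB.{u, v} M} {J : ComplexStr V} {D : HolStr JM J}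
  {V' : SmoothVB.{u, w} M} {J' : ComplexStr V'} {D' : HolStr JM J'}

/-- A homomorphism of jet complexes: real-linear bundle homomorphisms that commute with `π` and
`d`, the lowest one being holomorphic. -/
structure JetHom (𝒱 : JetComplex D) (𝒱' : JetComplex D') where
  map : ∀ n, BundleHom (𝒱.E n) (𝒱'.E n)
  map_pr : ∀ n x w, map n x (𝒱.pr n x w) = 𝒱'.pr n x (map (n + 1) x w)
  map_d : ∀ n ψ x X, map n x (𝒱.d n ψ x X) = 𝒱'.d n ((map (n + 1)).app ψ) x X
  holomorphic : IsHolomorphicHom D D' (map 0)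

/-- Isomorphisms of jet complexes. -/
def JetHom.IsIso {𝒱 : JetComplex D} {𝒱' : JetComplex D'} (T : JetHom 𝒱 𝒱') : Prop :=
  ∃ T' : JetHom 𝒱' 𝒱, (∀ n x w, T'.map n x (T.map n x w) = w) ∧
    ∀ n x w, T.map n x (T'.map n x w) = w

/-- An adapted complex structure on a jet complex: complex structures `S_n` on `V_n`, `S_0 = J`,
such that the `π`'s are complex linear and `S` restricts to `J_n` on `N_n = ker π`. -/
structure AdaptedCS (𝒱 : JetComplex D) where
  S : ∀ n, ComplexStr (𝒱.E n)
  pr_S : ∀ n x w, 𝒱.pr n x (S (n + 1) x w) = S n x (𝒱.pr n x w)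
  S_ker : ∀ n x (w : 𝒱.N n x), S n x w = (𝒱.JN n x w : (𝒱.E n).fiber x)

variable {𝒱 : JetComplex D}

/-- `[d', S] = 0`. -/
def AdaptedCS.CommutesWithKPart (A : AdaptedCS 𝒱) : Prop :=
  ∀ n ψ x X, (𝒱.d n).kPart JM (A.S n) ((A.S (n + 1)).toBundleHom.app ψ) x X =
    A.S n x ((𝒱.d n).kPart JM (A.S n) ψ x X)

/-- The bundle map `[d'', S]` on `V_{n+1}` vanishes on `F_n = ker π^{n+1} ⊆ V_{n+1}`, for all
`n`. -/
def AdaptedCS.KbarCommutatorVanishesOnFlag (A : AdaptedCS 𝒱) : Prop :=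
  ∀ n (ψ : Sec (𝒱.E (n + 1))) x X, ψ x ∈ 𝒱.flag (n + 1) n x →
    (𝒱.d n).kbarPart JM (A.S n) ((A.S (n + 1)).toBundleHom.app ψ) x X -
      A.S n x ((𝒱.d n).kbarPart JM (A.S n) ψ x X) = 0

/-- The holomorphic structures `D_n` on `(V_n, S_n)` are those induced by `d''`, i.e.
`D_n π_{n+1} = d''_{n+1}`. -/
def AdaptedCS.Induces (A : AdaptedCS 𝒱) (Dn : ∀ n, HolStr JM (A.S n)) : Prop :=
  ∀ n ψ x X, Dn n ((𝒱.pr n).app ψ) x X = (𝒱.d n).kbarPart JM (A.S n) ψ x X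

/-- The prolongation maps `P_n : H⁰(V) → Γ(V_n)`: `P_0 = id`, `π P_{n+1} = P_n`, `d P_n = 0`. -/
def IsProlongation (𝒱 : JetComplex D) (P : ∀ n, D.H0 →ₗ[ℝ] Sec (𝒱.E n)) : Prop :=
  (∀ ψ, P 0 ψ = (ψ : Sec V)) ∧ (∀ n ψ, (𝒱.pr n).app (P (n + 1) ψ) = P n ψ) ∧
    ∀ n ψ x X, 𝒱.d n (P (n + 1) ψ) x X = 0

/-- A quaternionic structure on a jet complex of a quaternionic bundle `(V, q)`: quaternionic
structures on all `V_n`, the given one on `V_0 = V`, for which `π` and `d` are quaternionic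
linear. -/
structure QuatJetStr (𝒱 : JetComplex D) (q : QuatStr V) where
  str : ∀ n, QuatStr (𝒱.E n)
  str_zero : str 0 = q
  pr_linear : ∀ n, QuatStr.IsLinear (str (n + 1)) (str n) (𝒱.pr n)
  d_linear : ∀ n, RealOp.IsQuatLinear (str (n + 1)) (str n) (𝒱.d n)

end Jet

end Basic

end

/-! On `N_{n+1} = ker π` the operator `d` is the isomorphism `δ` onto `K N_n`. Hence a section `ψ`
of `V_{n+1}` is determined by the pair `(π ψ, d ψ)` (`JetComplex.eq_of_pr_of_d`). The pairs `(φ, ξ)`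
that occur are cut out by `D φ = ξ''` at the bottom and by `π ξ = d φ`, `d ξ = 0` above it
(`JetComplex.exists_of_isOneJet`): lift `φ` arbitrarily; the error in `d` is an `N_n`-valued form of
type `K`, which `δ` absorbs. So `V_{n+1}` is, at the level of sections, described by `V_n` and `d`.

Every extension problem is solved with this description. A homomorphism `T_n` is continued by the
section with data `(T π ψ, T d ψ)`, a prolongation by the data `(P_n ψ, 0)`. The solution is unique,
so it depends on its input function linearly (or real linearly), and function linear maps of
sections are bundle homomorphisms (`IsFunLinear.exists_bundleHom`). By the same uniqueness two jet
maps agree as soon as they agree on `V_0` (`IsJetMap.eq`). Quaternionic multiplications are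
holomorphic endomorphisms of `V`, so they extend, and their algebraic identities persist on every
`V_n`.

On `N_{n+1}` the operator `d` equals `d'`, so `(π ψ, d' ψ)` also determines `ψ`, now without an
integrability condition. Prescribing `(S π ψ, S d' ψ)` builds the canonical complex structure. The
criterion in terms of `[d'', S]` rests on the tensoriality of `[d, S]` and on a formula for the
exterior derivative of `[d, S] ψ`, obtained by comparing `d d = 0` for `S ψ` and for `ψ`
(`AdaptedCS.extDeriv_comm`). Since `d''` vanishes on `ker π`, it descends to `V_n` and gives `D_n`.

For existence one takes `V_{n+1} = V_n ⊕ K N_n` with `d (ψ, s) = ∇ ψ + s`, where `∇` is a connection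
on `V_n` lifting the previous `d` and satisfying `d ∇ = 0`. For any connection that lifts `d` the
obstruction is an `N_{n-1}`-valued 2-form, and on a complex line a 2-form can be cancelled by a `K
N_{n-1}`-valued correction of the connection (`JetStage.exists_nextConn`). At the bottom `∇'' = D`.
-/

set_option linter.unusedSectionVars false

noncomputable section

open Bundle Filter Topology

/-! ### Sections, local frames and tensoriality. -/

section Toolkit

variable {M : Type u} [TopologicalSpace M] [ChartedSpace (EuclideanSpace ℝ (Fin 2)) M]

/-- Smoothness at a point of a (not necessarily smooth) section. -/
abbrev SmoothVB.SmoothAt (V : SmoothVB.{u, v} M) (s : ∀ x, V.fiber x) (x : M) : Prop :=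
  ContMDiffAt (𝓡 2) ((𝓡 2).prod 𝓘(ℝ, V.F)) ∞ (fun y => (⟨y, s y⟩ : TotalSpace V.F V.fiber)) x

@[ext]
theorem BundleHom.ext {V : SmoothVB.{u, v} M} {W : SmoothVB.{u, w} M} {S T : BundleHom V W}
    (h : ∀ x z, S x z = T x z) : S = T := by
  obtain ⟨S, hS⟩ := S
  obtain ⟨T, hT⟩ := T
  congr
  funext x
  exact LinearMap.ext (h x)

@[simp] theorem BundleHom.app_apply {V : SmoothVB.{u, v} M} {W : SmoothVB.{u, w} M}
    (T : BundleHom V W) (ψ : Sec V) (x : M) : T.app ψ x = T x (ψ x) := rfl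

@[simp] theorem Sec.fsmul_apply {V : SmoothVB.{u, v} M} (f : C^∞⟮𝓡 2, M; ℝ⟯) (ψ : Sec V) (x : M) :
    ψ.fsmul f x = f x • ψ x := rfl

@[simp] theorem Sec.add_apply {V : SmoothVB.{u, v} M} (ψ φ : Sec V) (x : M) :
    (ψ + φ) x = ψ x + φ x := rfl

@[simp] theorem Sec.sub_apply {V : SmoothVB.{u, v} M} (ψ φ : Sec V) (x : M) :
    (ψ - φ) x = ψ x - φ x := rfl

@[simp] theorem Sec.neg_apply {V : SmoothVB.{u, v} M} (ψ : Sec V) (x : M) :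
    (-ψ) x = -ψ x := rfl

@[simp] theorem Sec.zero_apply {V : SmoothVB.{u, v} M} (x : M) : (0 : Sec V) x = 0 := rfl

@[simp] theorem Sec.smul_apply {V : SmoothVB.{u, v} M} (c : ℝ) (ψ : Sec V) (x : M) :
    (c • ψ) x = c • ψ x := rfl

@[simp] theorem Sec.sum_apply {V : SmoothVB.{u, v} M} {ι : Type*} (s : Finset ι) (ψ : ι → Sec V)
    (x : M) : (∑ i ∈ s, ψ i) x = ∑ i ∈ s, ψ i x := by
  classical
  induction s using Finset.induction_on with
  | empty => rfl
  | insert a s ha h => rw [Finset.sum_insert ha, Finset.sum_insert ha, Sec.add_apply, h]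

/-- Additive maps of sections that commute with the multiplication by smooth functions. -/
structure IsFunLinear {V : SmoothVB.{u, v} M} {W : SmoothVB.{u, w} M} (L : Sec V → Sec W) :
    Prop where
  map_add : ∀ ψ φ, L (ψ + φ) = L ψ + L φ
  map_fsmul : ∀ f ψ, L (Sec.fsmul f ψ) = Sec.fsmul f (L ψ)

section

variable {V : SmoothVB.{u, v} M} {W : SmoothVB.{u, w} M} {L : Sec V → Sec W}

theorem IsFunLinear.map_smul (hL : IsFunLinear L) (c : ℝ) (ψ : Sec V) : L (c • ψ) = c • L ψ :=
  hL.map_fsmul ⟨fun _ => c, contMDiff_const⟩ ψ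

/-- Function linear maps of sections as linear maps. -/
def IsFunLinear.toLinearMap (hL : IsFunLinear L) : Sec V →ₗ[ℝ] Sec W where
  toFun := L
  map_add' := hL.map_add
  map_smul' := hL.map_smul

end

variable [IsManifold (𝓡 2) ∞ M]

section Extension

variable [T2Space M] [SigmaCompactSpace M]

theorem exists_bump {x : M} {U : Set M} (hU : U ∈ 𝓝 x) :
    ∃ χ : C^∞⟮𝓡 2, M; ℝ⟯, (∀ᶠ y in 𝓝 x, χ y = 1) ∧ tsupport χ ⊆ interior U := by
  have : LocallyCompactSpace M := Manifold.locallyCompact_of_finiteDimensional (𝓡 2)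
  obtain ⟨K, hK, hKU, hKc⟩ := exists_mem_nhds_isClosed_subset (interior_mem_nhds.mpr hU)
  obtain ⟨f, hf, hf0, -⟩ := exists_contMDiffMap_one_nhds_of_subset_interior (n := (⊤ : ℕ∞)) (𝓡 2)
    (s := {x}) (t := K) isClosed_singleton
    (by rw [Set.singleton_subset_iff]; exact mem_interior_iff_mem_nhds.mpr hK)
  refine ⟨f, by simpa using hf, ?_⟩
  refine (closure_minimal ?_ hKU).trans hKc
  intro y hy
  by_contra hyK
  exact hy (hf0 y hyK)

theorem exists_fun_eq_near {x : M} {g : M → ℝ}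
    (hg : ∀ᶠ y in 𝓝 x, ContMDiffAt (𝓡 2) 𝓘(ℝ, ℝ) ∞ g y) :
    ∃ f : C^∞⟮𝓡 2, M; ℝ⟯, ∀ᶠ y in 𝓝 x, f y = g y := by
  obtain ⟨χ, hχ, hsupp⟩ := exists_bump hg
  refine ⟨⟨fun y => χ y * g y, ?_⟩, hχ.mono fun y hy => ?_⟩
  · refine contMDiff_of_tsupport fun y hy => ?_
    have hy' : y ∈ tsupport χ := by
      refine closure_mono ?_ hy
      intro z hz hz'
      exact hz (by simp [hz'])
    exact χ.contMDiff.contMDiffAt.mul (interior_subset (hsupp hy'))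
  · change χ y * g y = g y
    rw [hy, one_mul]

theorem Sec.exists_eq_near {V : SmoothVB.{u, v} M} {x : M} {s : ∀ x, V.fiber x}
    (hs : ∀ᶠ y in 𝓝 x, V.SmoothAt s y) : ∃ ψ : Sec V, ∀ᶠ y in 𝓝 x, ψ y = s y := by
  obtain ⟨χ, hχ, hsupp⟩ := exists_bump hs
  refine ⟨⟨(χ : M → ℝ) • s, ?_⟩, hχ.mono fun y hy => ?_⟩
  · exact ContMDiffOn.smul_section_of_tsupport χ.contMDiff.contMDiffOn isOpen_interior hsupp
      fun y hy => ContMDiffAt.contMDiffWithinAt (interior_subset hy : V.SmoothAt s y)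
  · change χ y • s y = s y
    rw [hy, one_smul]

/-- Near every point there is a frame of globally defined smooth sections, with smooth coefficient
functions. -/
theorem SmoothVB.exists_frame (V : SmoothVB.{u, v} M) (x₀ : M) :
    ∃ (ψ : Fin (Module.finrank ℝ V.F) → Sec V)
      (c : Fin (Module.finrank ℝ V.F) → ∀ x, V.fiber x →ₗ[ℝ] ℝ), ∀ᶠ x in 𝓝 x₀,
      (∀ w : V.fiber x, ∑ i, c i x w • ψ i x = w) ∧ ∀ i (w : V.fiber x),
        ContMDiffAt ((𝓡 2).prod 𝓘(ℝ, V.F)) 𝓘(ℝ, ℝ) ∞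
          (fun p : TotalSpace V.F V.fiber => c i p.1 p.2) ⟨x, w⟩ := by
  set e := trivializationAt V.F V.fiber x₀ with he
  set b := Module.finBasis ℝ V.F with hb
  have hx₀ : x₀ ∈ e.baseSet := FiberBundle.mem_baseSet_trivializationAt' x₀
  have hU := e.open_baseSet.mem_nhds hx₀
  have h1 : ∀ i, ∃ ψ : Sec V, ∀ᶠ y in 𝓝 x₀, ψ y = e.localFrame b i y := fun i =>
    Sec.exists_eq_near (by
      filter_upwards [hU] with y hy
      exact contMDiffAt_localFrame_of_mem ∞ e b i hy)
  choose ψ hψ using h1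
  refine ⟨ψ, fun i x => b.coord i ∘ₗ e.linearMapAt ℝ x, ?_⟩
  filter_upwards [hU, eventually_all.mpr hψ] with x hx hψx
  refine ⟨fun w => ?_, fun i w => ?_⟩
  · apply (e.linearEquivAt ℝ x hx).injective
    rw [map_sum]
    simp only [map_smul]
    conv_rhs => rw [← b.sum_repr ((e.linearEquivAt ℝ x hx) w)]
    refine Finset.sum_congr rfl fun i _ => ?_
    rw [hψx i, e.localFrame_apply_of_mem_baseSet b hx, LinearMap.comp_apply,
      Trivialization.linearMapAt_apply, if_pos hx]
    simp [Trivialization.basisAt, e.apply_mk_symm hx]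
  · have hsrc : (⟨x, w⟩ : TotalSpace V.F V.fiber) ∈ e.source := by rwa [e.mem_source]
    have h2 : ContMDiffAt ((𝓡 2).prod 𝓘(ℝ, V.F)) ((𝓡 2).prod 𝓘(ℝ, V.F)) ∞ e ⟨x, w⟩ :=
      (e.contMDiffOn (n := ∞) (IB := 𝓡 2)).contMDiffAt (e.open_source.mem_nhds hsrc)
    have h3 : ContMDiffAt ((𝓡 2).prod 𝓘(ℝ, V.F)) 𝓘(ℝ, ℝ) ∞
        (fun p : TotalSpace V.F V.fiber => (b.coord i).toContinuousLinearMap (e p).2) ⟨x, w⟩ :=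
      ((b.coord i).toContinuousLinearMap.contMDiff.contMDiffAt).comp _
        (contMDiffAt_snd.comp _ h2)
    refine h3.congr_of_eventuallyEq ?_
    filter_upwards [e.open_source.mem_nhds hsrc] with p hp
    rw [e.mem_source] at hp
    simp [hp]

theorem Sec.exists_apply_eq (V : SmoothVB.{u, v} M) (x : M) (w : V.fiber x) :
    ∃ ψ : Sec V, ψ x = w := by
  obtain ⟨ψ, c, h⟩ := V.exists_frame x
  refine ⟨∑ i, c i x w • ψ i, ?_⟩
  rw [Sec.sum_apply]
  simpa using h.self_of_nhds.1 w

/-- A fibrewise linear map is a smooth bundle homomorphism if it maps smooth sections to smooth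
sections. -/
def BundleHom.ofSec {V : SmoothVB.{u, v} M} {W : SmoothVB.{u, w} M}
    (T : ∀ x, V.fiber x →ₗ[ℝ] W.fiber x)
    (hT : ∀ (ψ : Sec V) x, W.SmoothAt (fun x => T x (ψ x)) x) : BundleHom V W where
  toFun := T
  smooth := by
    rintro ⟨x₀, w₀⟩
    obtain ⟨ψ, c, h⟩ := V.exists_frame x₀
    refine contMDiffAt_totalSpace.mpr ⟨contMDiffAt_proj _, ?_⟩
    set e := trivializationAt W.F W.fiber x₀
    have hx₀ : x₀ ∈ e.baseSet := FiberBundle.mem_baseSet_trivializationAt' x₀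
    have hpr : Tendsto (fun p : TotalSpace V.F V.fiber => p.1) (𝓝 ⟨x₀, w₀⟩) (𝓝 x₀) :=
      (FiberBundle.continuous_proj V.F V.fiber).continuousAt
    -- In the trivialization, `T` is the sum of the frame coefficients of the argument times the
    -- coordinates of `T ψ_i`; both factors are smooth on the total space.
    have h1 : ContMDiffAt ((𝓡 2).prod 𝓘(ℝ, V.F)) 𝓘(ℝ, W.F) ∞
        (fun p : TotalSpace V.F V.fiber => ∑ i, c i p.1 p.2 • (e ⟨p.1, T p.1 (ψ i p.1)⟩).2)
        ⟨x₀, w₀⟩ := by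
      refine contMDiffAt_finsetSum fun i _ => (h.self_of_nhds.2 i w₀).smul ?_
      have h2 := (e.contMDiffAt_section_iff hx₀).mp (hT (ψ i) x₀)
      have h3 : ContMDiffAt ((𝓡 2).prod 𝓘(ℝ, V.F)) (𝓡 2) ∞
          (fun p : TotalSpace V.F V.fiber => p.1) ⟨x₀, w₀⟩ := contMDiffAt_proj V.fiber
      exact ContMDiffAt.comp (g := fun y => (e ⟨y, T y (ψ i y)⟩).2) _ h2 h3
    refine h1.congr_of_eventuallyEq ?_
    filter_upwards [hpr.eventually h, hpr.eventually (e.open_baseSet.eventually_mem hx₀)] with p hp hpe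
    have h3 : ∀ z, (e ⟨p.1, z⟩).2 = e.linearMapAt ℝ p.1 z := fun z => by
      rw [Trivialization.linearMapAt_apply, if_pos hpe]
    simp only [h3]
    conv_lhs => rw [← hp.1 p.2]
    simp only [map_sum, map_smul]

section

variable {V : SmoothVB.{u, v} M} {W : SmoothVB.{u, w} M} {L : Sec V → Sec W}

/-- Subtracting the frame expansion leaves a section `θ` that vanishes near the point. A bump
function `χ` supported where `θ = 0` gives `χ θ = 0`, hence `χ L θ = 0`, while `χ = 1` at the point.
In the frame expansion the coefficients themselves vanish at the point. -/
theorem IsFunLinear.apply_eq_zero (hL : IsFunLinear L) {ψ : Sec V} {x₀ : M} (h0 : ψ x₀ = 0) :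
    L ψ x₀ = 0 := by
  obtain ⟨φ, c, h⟩ := V.exists_frame x₀
  have h1 : ∀ i, ∃ f : C^∞⟮𝓡 2, M; ℝ⟯, ∀ᶠ y in 𝓝 x₀, f y = c i y (ψ y) := fun i =>
    exists_fun_eq_near (by
      filter_upwards [h] with y hy
      exact (hy.2 i (ψ y)).comp y ψ.contMDiff.contMDiffAt)
  choose f hf using h1
  set θ : Sec V := ψ - ∑ i, (φ i).fsmul (f i) with hθ
  have hθ0 : ∀ᶠ y in 𝓝 x₀, θ y = 0 := by
    filter_upwards [h, eventually_all.mpr hf] with y hy hfy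
    rw [hθ, Sec.sub_apply, Sec.sum_apply, sub_eq_zero]
    conv_lhs => rw [← hy.1 (ψ y)]
    exact Finset.sum_congr rfl fun i _ => by rw [Sec.fsmul_apply, hfy]
  obtain ⟨χ, hχ, hsupp⟩ := exists_bump hθ0
  have h2 : θ.fsmul χ = 0 := by
    ext y
    rw [Sec.fsmul_apply, Sec.zero_apply]
    by_cases hy : y ∈ tsupport χ
    · have hy' : y ∈ {y | θ y = 0} := interior_subset (hsupp hy)
      rw [Set.mem_ofPred_eq] at hy'
      rw [hy', smul_zero]
    · rw [image_eq_zero_of_notMem_tsupport hy, zero_smul]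
  have h3 : L θ x₀ = 0 := by
    have h4 := congrArg (fun s : Sec W => s x₀) (hL.map_fsmul χ θ)
    simp only [h2, Sec.fsmul_apply, hχ.self_of_nhds, one_smul] at h4
    rw [← h4, show L 0 = 0 from hL.toLinearMap.map_zero, Sec.zero_apply]
  have h5 : ψ = θ + ∑ i, (φ i).fsmul (f i) := (sub_add_cancel _ _).symm
  have h6 : L (∑ i, (φ i).fsmul (f i)) = ∑ i, (L (φ i)).fsmul (f i) :=
    (map_sum hL.toLinearMap _ _).trans (Finset.sum_congr rfl fun i _ => hL.map_fsmul _ _)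
  rw [h5, hL.map_add, Sec.add_apply, h3, h6, Sec.sum_apply, zero_add]
  refine Finset.sum_eq_zero fun i _ => ?_
  rw [Sec.fsmul_apply, (hf i).self_of_nhds, h0, _root_.map_zero, zero_smul]

theorem IsFunLinear.congr_apply (hL : IsFunLinear L) {ψ φ : Sec V} {x : M} (h : ψ x = φ x) :
    L ψ x = L φ x := by
  have h1 : L (ψ - φ) x = 0 := hL.apply_eq_zero (by rw [Sec.sub_apply, h, sub_self])
  have h2 : L (ψ - φ) = L ψ - L φ := hL.toLinearMap.map_sub ψ φ
  rwa [h2, Sec.sub_apply, sub_eq_zero] at h1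

/-- A function linear map of sections is given by a bundle homomorphism. -/
theorem IsFunLinear.exists_bundleHom (hL : IsFunLinear L) :
    ∃ T : BundleHom V W, ∀ ψ, T.app ψ = L ψ := by
  -- The sections `s x z` through `z` are chosen arbitrarily; tensoriality makes the value of `L` at
  -- `x` independent of the choice.
  choose s hs using Sec.exists_apply_eq V
  have key : ∀ (ψ : Sec V) x, L (s x (ψ x)) x = L ψ x := fun ψ x => hL.congr_apply (hs _ _)
  refine ⟨BundleHom.ofSec (fun x =>
    { toFun := fun z => L (s x z) x
      map_add' := fun z z' => ?_
      map_smul' := fun c z => ?_ }) fun ψ x => ?_, fun ψ => ?_⟩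
  · rw [← Sec.add_apply, ← hL.map_add]
    exact hL.congr_apply (by rw [hs, Sec.add_apply, hs, hs])
  · rw [RingHom.id_apply, ← Sec.smul_apply, ← hL.map_smul]
    exact hL.congr_apply (by rw [hs, Sec.smul_apply, hs])
  · simp only [LinearMap.coe_mk, AddHom.coe_mk, key]
    exact (L ψ).contMDiff.contMDiffAt
  · ext x
    exact key ψ x

theorem BundleHom.ext_app {S T : BundleHom V W} (h : ∀ (ψ : Sec V) x, S x (ψ x) = T x (ψ x)) : S = T := by
  ext x z
  obtain ⟨ψ, rfl⟩ := Sec.exists_apply_eq V x z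
  exact h ψ x

end

end Extension
end Toolkit

/-! ### Smooth one-sided inverses of bundle homomorphisms. -/

section Inverses

variable {M : Type u} [TopologicalSpace M] [ChartedSpace (EuclideanSpace ℝ (Fin 2)) M]
  {V : SmoothVB.{u, v} M} {W : SmoothVB.{u, w} M}

theorem contMDiffAt_clm_of_apply {F F' : Type*} [NormedAddCommGroup F] [NormedSpace ℝ F]
    [FiniteDimensional ℝ F] [NormedAddCommGroup F'] [NormedSpace ℝ F'] {m : M → F →L[ℝ] F'} {x : M}
    (h : ∀ v, ContMDiffAt (𝓡 2) 𝓘(ℝ, F') ∞ (fun y => m y v) x) :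
    ContMDiffAt (𝓡 2) 𝓘(ℝ, F →L[ℝ] F') ∞ m x := by
  set b := Module.finBasis ℝ F
  have h1 : m = fun y => ∑ i, ContinuousLinearMap.smulRightL ℝ F F'
      (b.coord i).toContinuousLinearMap (m y (b i)) := by
    funext y
    ext v
    conv_lhs => rw [← b.sum_repr v, map_sum]
    simp
  rw [h1]
  refine contMDiffAt_finsetSum fun i _ => ?_
  exact (ContinuousLinearMap.contMDiff _).contMDiffAt.comp x (h (b i))

theorem SmoothVB.smoothAt_symm (V : SmoothVB.{u, v} M) (x₀ : M) {x : M}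
    (hx : x ∈ (trivializationAt V.F V.fiber x₀).baseSet) (z : V.F) :
    V.SmoothAt (fun y => (trivializationAt V.F V.fiber x₀).symm y z) x := by
  set e := trivializationAt V.F V.fiber x₀
  refine (e.contMDiffAt_section_iff hx).mpr ?_
  refine (contMDiffAt_const (c := z)).congr_of_eventuallyEq ?_
  filter_upwards [e.open_baseSet.eventually_mem hx] with y hy
  simp [e.apply_mk_symm hy]

/-- The matrix of a fibrewise linear map in the preferred trivializations at `x₀`. -/
def localMatrix (T : ∀ x, V.fiber x →ₗ[ℝ] W.fiber x) (x₀ x : M) : V.F →L[ℝ] W.F :=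
  LinearMap.toContinuousLinearMap ((trivializationAt W.F W.fiber x₀).linearMapAt ℝ x ∘ₗ T x ∘ₗ
    (trivializationAt V.F V.fiber x₀).symmₗ ℝ x)

theorem localMatrix_apply (T : ∀ x, V.fiber x →ₗ[ℝ] W.fiber x) (x₀ : M) {x : M}
    (hxV : x ∈ (trivializationAt V.F V.fiber x₀).baseSet)
    (hxW : x ∈ (trivializationAt W.F W.fiber x₀).baseSet) (z : V.F) : localMatrix T x₀ x z =
    (trivializationAt W.F W.fiber x₀
      ⟨x, T x ((trivializationAt V.F V.fiber x₀).symm x z)⟩).2 := by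
  simp [localMatrix, hxW, Trivialization.coe_symmₗ _ hxV]

theorem localMatrix_apply_coord (T : ∀ x, V.fiber x →ₗ[ℝ] W.fiber x) (x₀ : M) {x : M}
    (hxV : x ∈ (trivializationAt V.F V.fiber x₀).baseSet)
    (hxW : x ∈ (trivializationAt W.F W.fiber x₀).baseSet) (z : V.fiber x) :
    localMatrix T x₀ x (trivializationAt V.F V.fiber x₀ ⟨x, z⟩).2 =
    (trivializationAt W.F W.fiber x₀ ⟨x, T x z⟩).2 := by
  rw [localMatrix_apply T x₀ hxV hxW, Trivialization.symm_apply_apply_mk _ hxV]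

theorem contMDiffAt_localMatrix (T : BundleHom V W) (x₀ : M) {x : M}
    (hxV : x ∈ (trivializationAt V.F V.fiber x₀).baseSet)
    (hxW : x ∈ (trivializationAt W.F W.fiber x₀).baseSet) :
    ContMDiffAt (𝓡 2) 𝓘(ℝ, V.F →L[ℝ] W.F) ∞ (localMatrix T.toFun x₀) x := by
  refine contMDiffAt_clm_of_apply fun z => ?_
  have h1 := V.smoothAt_symm x₀ hxV z
  have h2 : W.SmoothAt (fun y => T y ((trivializationAt V.F V.fiber x₀).symm y z)) x :=
    T.smooth.contMDiffAt.comp x h1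
  refine ((Trivialization.contMDiffAt_section_iff _ hxW).mp h2).congr_of_eventuallyEq ?_
  filter_upwards [(trivializationAt V.F V.fiber x₀).open_baseSet.eventually_mem hxV,
    (trivializationAt W.F W.fiber x₀).open_baseSet.eventually_mem hxW] with y hy hy'
  exact localMatrix_apply _ _ hy hy' z

theorem contMDiffAt_ringInverse {F : Type*} [NormedAddCommGroup F] [NormedSpace ℝ F]
    [CompleteSpace F] {m : M → F →L[ℝ] F} {x : M} (hm : ContMDiffAt (𝓡 2) 𝓘(ℝ, F →L[ℝ] F) ∞ m x)
    (hu : IsUnit (m x)) :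
    ContMDiffAt (𝓡 2) 𝓘(ℝ, F →L[ℝ] F) ∞ (fun y => Ring.inverse (m y)) x := by
  obtain ⟨a, ha⟩ := hu
  have h1 : ContDiffAt ℝ ∞ (Ring.inverse : (F →L[ℝ] F) → (F →L[ℝ] F)) (m x) :=
    ha ▸ contDiffAt_ringInverse ℝ a
  exact h1.contMDiffAt.comp x hm

theorem ContMDiffAt.clm_const_comp {F F' F'' : Type*} [NormedAddCommGroup F] [NormedSpace ℝ F]
    [NormedAddCommGroup F'] [NormedSpace ℝ F'] [NormedAddCommGroup F''] [NormedSpace ℝ F'']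
    (B : F' →L[ℝ] F'') {m : M → F →L[ℝ] F'} {x : M}
    (hm : ContMDiffAt (𝓡 2) 𝓘(ℝ, F →L[ℝ] F') ∞ m x) :
    ContMDiffAt (𝓡 2) 𝓘(ℝ, F →L[ℝ] F'') ∞ (fun y => B ∘L m y) x :=
  (ContMDiffAt.clm_comp contMDiffAt_const hm)

/-- A section is smooth if its images under two jointly injective smooth bundle homomorphisms
are. -/
theorem SmoothVB.smoothAt_of_injective {W' : SmoothVB.{u, w} M} (A : BundleHom V W)
    (B : BundleHom V W') {x₀ : M} (h0 : ∀ z, A x₀ z = 0 → B x₀ z = 0 → z = 0)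
    {s : ∀ x, V.fiber x} (hA : W.SmoothAt (fun x => A x (s x)) x₀)
    (hB : W'.SmoothAt (fun x => B x (s x)) x₀) : V.SmoothAt s x₀ := by
  have : CompleteSpace V.F := FiniteDimensional.complete ℝ V.F
  have hV := FiberBundle.mem_baseSet_trivializationAt' (F := V.F) (E := V.fiber) x₀
  have hW := FiberBundle.mem_baseSet_trivializationAt' (F := W.F) (E := W.fiber) x₀
  have hW' := FiberBundle.mem_baseSet_trivializationAt' (F := W'.F) (E := W'.fiber) x₀
  set e := trivializationAt V.F V.fiber x₀
  set C : M → V.F →L[ℝ] W.F × W'.F := fun x =>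
    (localMatrix A.toFun x₀ x).prod (localMatrix B.toFun x₀ x) with hC
  have hCs : ContMDiffAt (𝓡 2) 𝓘(ℝ, V.F →L[ℝ] W.F × W'.F) ∞ C x₀ := by
    refine contMDiffAt_clm_of_apply fun z => ?_
    exact (ContMDiffAt.clm_apply (contMDiffAt_localMatrix A x₀ hV hW) contMDiffAt_const).prodMk_space
      (ContMDiffAt.clm_apply (contMDiffAt_localMatrix B x₀ hV hW') contMDiffAt_const)
  have hinj : LinearMap.ker (C x₀ : V.F →ₗ[ℝ] W.F × W'.F) = ⊥ := by
    rw [LinearMap.ker_eq_bot']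
    intro z hz
    obtain ⟨y, rfl⟩ : ∃ y, (e ⟨x₀, y⟩).2 = z := ⟨e.symm x₀ z, by rw [e.apply_mk_symm hV]⟩
    have h1 : localMatrix A.toFun x₀ x₀ (e ⟨x₀, y⟩).2 = 0 := congrArg Prod.fst hz
    have h2 : localMatrix B.toFun x₀ x₀ (e ⟨x₀, y⟩).2 = 0 := congrArg Prod.snd hz
    rw [localMatrix_apply_coord _ _ hV hW] at h1
    rw [localMatrix_apply_coord _ _ hV hW'] at h2
    have h3 : y = 0 := by
      refine h0 y ?_ ?_
      · apply ((trivializationAt W.F W.fiber x₀).linearEquivAt ℝ x₀ hW).injective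
        rw [map_zero]
        exact h1
      · apply ((trivializationAt W'.F W'.fiber x₀).linearEquivAt ℝ x₀ hW').injective
        rw [map_zero]
        exact h2
    have h4 := (e.linearEquivAt ℝ x₀ hV).map_zero
    rw [h3]
    simpa using h4
  -- A constant left inverse `B₀` of the matrix `C x₀` suffices: `D = B₀ C` is the identity at `x₀`,
  -- hence invertible nearby, and `D⁻¹ B₀` is a smooth left inverse of `C`.
  obtain ⟨B₀, hB₀⟩ := LinearMap.exists_leftInverse_of_injective _ hinj
  set D : M → V.F →L[ℝ] V.F := fun x => B₀.toContinuousLinearMap ∘L C x with hD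
  have hDs : ContMDiffAt (𝓡 2) 𝓘(ℝ, V.F →L[ℝ] V.F) ∞ D x₀ := hCs.clm_const_comp _
  have hD1 : D x₀ = 1 := by
    ext z
    exact LinearMap.congr_fun hB₀ z
  have hDu : IsUnit (D x₀) := hD1 ▸ isUnit_one
  have hinv := contMDiffAt_ringInverse hDs hDu
  have hev : ∀ᶠ x in 𝓝 x₀, IsUnit (D x) :=
    hDs.continuousAt.eventually (Units.isOpen.eventually_mem hDu)
  refine (e.contMDiffAt_section_iff hV).mpr ?_
  have hpair : ContMDiffAt (𝓡 2) 𝓘(ℝ, W.F × W'.F) ∞ (fun x =>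
      ((trivializationAt W.F W.fiber x₀ ⟨x, A x (s x)⟩).2,
        (trivializationAt W'.F W'.fiber x₀ ⟨x, B x (s x)⟩).2)) x₀ :=
    ((Trivialization.contMDiffAt_section_iff _ hW).mp hA).prodMk_space
      ((Trivialization.contMDiffAt_section_iff _ hW').mp hB)
  have hfin := hinv.clm_apply
    ((ContinuousLinearMap.contMDiff B₀.toContinuousLinearMap).contMDiffAt.comp x₀ hpair)
  refine hfin.congr_of_eventuallyEq ?_
  filter_upwards [hev, e.open_baseSet.eventually_mem hV,
    (trivializationAt W.F W.fiber x₀).open_baseSet.eventually_mem hW,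
    (trivializationAt W'.F W'.fiber x₀).open_baseSet.eventually_mem hW'] with x hx h1 h2 h3
  have h4 : D x (e ⟨x, s x⟩).2 = B₀ ((trivializationAt W.F W.fiber x₀ ⟨x, A x (s x)⟩).2,
        (trivializationAt W'.F W'.fiber x₀ ⟨x, B x (s x)⟩).2) := by
    rw [← localMatrix_apply_coord A.toFun x₀ h1 h2, ← localMatrix_apply_coord B.toFun x₀ h1 h3]
    rfl
  have h5 : (Ring.inverse (D x)) ((D x) (e ⟨x, s x⟩).2) = (e ⟨x, s x⟩).2 := by
    rw [← mul_apply_eq_comp, Ring.inverse_mul_cancel _ hx]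
    rfl
  rw [h4] at h5
  exact h5.symm

/-- A bundle homomorphism which is surjective at `x₀` has a smooth right inverse near `x₀`. -/
theorem BundleHom.exists_local_rightInverse (A : BundleHom V W) (x₀ : M)
    (h0 : Function.Surjective (A x₀)) :
    ∃ U : Set M, IsOpen U ∧ x₀ ∈ U ∧ ∃ R : ∀ x, W.fiber x →ₗ[ℝ] V.fiber x, ∀ x ∈ U,
      (∀ z, A x (R x z) = z) ∧ ∀ φ : Sec W, V.SmoothAt (fun y => R y (φ y)) x := by
  have : CompleteSpace W.F := FiniteDimensional.complete ℝ W.F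
  have hV := FiberBundle.mem_baseSet_trivializationAt' (F := V.F) (E := V.fiber) x₀
  have hW := FiberBundle.mem_baseSet_trivializationAt' (F := W.F) (E := W.fiber) x₀
  set e := trivializationAt V.F V.fiber x₀
  set e' := trivializationAt W.F W.fiber x₀
  have hsurj : LinearMap.range (localMatrix A.toFun x₀ x₀ : V.F →ₗ[ℝ] W.F) = ⊤ := by
    rw [LinearMap.range_eq_top]
    intro z
    obtain ⟨y, hy⟩ := h0 (e'.symm x₀ z)
    refine ⟨(e ⟨x₀, y⟩).2, ?_⟩
    rw [ContinuousLinearMap.coe_coe, localMatrix_apply_coord _ _ hV hW]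
    change (e' ⟨x₀, A x₀ y⟩).2 = z
    rw [hy, e'.apply_mk_symm hW]
  -- With a constant right inverse `B₀` at `x₀`, the matrix `D = A B₀` is invertible near `x₀`, and
  -- `B₀ D⁻¹` is a smooth right inverse.
  obtain ⟨B₀, hB₀⟩ := LinearMap.exists_rightInverse_of_surjective _ hsurj
  set D : M → W.F →L[ℝ] W.F := fun x => localMatrix A.toFun x₀ x ∘L B₀.toContinuousLinearMap
    with hD
  have hDs : ∀ x, x ∈ e.baseSet → x ∈ e'.baseSet →
      ContMDiffAt (𝓡 2) 𝓘(ℝ, W.F →L[ℝ] W.F) ∞ D x := fun x hx hx' =>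
    (contMDiffAt_localMatrix A x₀ hx hx').clm_comp contMDiffAt_const
  have hD1 : D x₀ = 1 := by
    ext z
    exact LinearMap.congr_fun hB₀ z
  have hDu : IsUnit (D x₀) := hD1 ▸ isUnit_one
  have hev : ∀ᶠ x in 𝓝 x₀, (IsUnit (D x) ∧ x ∈ e.baseSet) ∧ x ∈ e'.baseSet :=
    (((hDs x₀ hV hW).continuousAt.eventually (Units.isOpen.eventually_mem hDu)).and
      (e.open_baseSet.eventually_mem hV)).and (e'.open_baseSet.eventually_mem hW)
  obtain ⟨U, hU, hUo, hxU⟩ := eventually_nhds_iff.mp hev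
  refine ⟨U, hUo, hxU, fun x => e.symmₗ ℝ x ∘ₗ B₀ ∘ₗ
    ((Ring.inverse (D x) : W.F →L[ℝ] W.F) : W.F →ₗ[ℝ] W.F) ∘ₗ e'.linearMapAt ℝ x, fun x hx => ⟨fun z => ?_,
      fun φ => ?_⟩⟩
  · obtain ⟨⟨h1, h2⟩, h3⟩ := hU x hx
    have h4 : (D x) (Ring.inverse (D x) (e' ⟨x, z⟩).2) = (e' ⟨x, z⟩).2 := by
      rw [← mul_apply_eq_comp, Ring.mul_inverse_cancel _ h1]
      rfl
    apply (e'.linearEquivAt ℝ x h3).injective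
    have h5 := localMatrix_apply A.toFun x₀ h2 h3 (B₀ (Ring.inverse (D x) (e' ⟨x, z⟩).2))
    simp only [LinearMap.comp_apply, Trivialization.linearMapAt_apply, if_pos h3, e.symmₗ_apply h2,
      Trivialization.linearEquivAt_apply, ContinuousLinearMap.coe_coe]
    exact h5.symm.trans h4
  · obtain ⟨⟨h1, h2⟩, h3⟩ := hU x hx
    refine (e.contMDiffAt_section_iff h2).mpr ?_
    have h4 := (e'.contMDiffAt_section_iff h3).mp (φ.contMDiff.contMDiffAt (x := x))
    have h5 := (ContinuousLinearMap.contMDiff B₀.toContinuousLinearMap).contMDiffAt.comp x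
      ((contMDiffAt_ringInverse (hDs x h2 h3) h1).clm_apply h4)
    refine h5.congr_of_eventuallyEq ?_
    filter_upwards [e.open_baseSet.eventually_mem h2, e'.open_baseSet.eventually_mem h3]
      with y hy hy'
    simp [hy', e.symmₗ_apply hy, e.apply_mk_symm hy]

variable [IsManifold (𝓡 2) ∞ M] [T2Space M] [SigmaCompactSpace M]

/-- A fibrewise surjective bundle homomorphism has a smooth right inverse. -/
theorem BundleHom.exists_rightInverse (A : BundleHom V W) (h : ∀ x, Function.Surjective (A x)) :
    ∃ R : BundleHom W V, ∀ x z, A x (R x z) = z := by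
  choose U hUo hxU R hR using fun x₀ => A.exists_local_rightInverse x₀ (h x₀)
  -- Right inverses form an affine space, so local ones may be averaged by a partition of unity.
  obtain ⟨ρ, hρ⟩ := SmoothPartitionOfUnity.exists_isSubordinate (𝓡 2) isClosed_univ U hUo
    (fun x _ => Set.mem_iUnion.mpr ⟨x, hxU x⟩)
  have hfin : ∀ (x : M) (z : W.fiber x),
      (Function.support fun i => ρ i x • R i x z).Finite := fun x z =>
    (ρ.locallyFinite.point_finite x).subset fun i hi => left_ne_zero_of_smul hi
  refine ⟨BundleHom.ofSec (fun x =>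
    { toFun := fun z => ∑ᶠ i, ρ i x • R i x z
      map_add' := fun z z' => ?_
      map_smul' := fun c z => ?_ }) fun φ x => ?_, fun x z => ?_⟩
  · rw [← finsum_add_distrib (hfin x z) (hfin x z')]
    simp only [map_add, smul_add]
  · rw [RingHom.id_apply, smul_finsum' _ (hfin x z)]
    simp only [map_smul, smul_comm c]
  · refine ContMDiff.contMDiffAt ?_
    refine ContMDiff.finsum_section_of_locallyFinite (t := fun i x => ρ i x • R i x (φ x)) ?_
      fun i => ?_
    · exact ρ.locallyFinite.subset fun i x hx => left_ne_zero_of_smul hx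
    · exact ContMDiffOn.smul_section_of_tsupport (ρ i).contMDiff.contMDiffOn (hUo i) (hρ i)
        fun y hy => ContMDiffAt.contMDiffWithinAt (((hR i y hy).2 φ))
  · change A x (∑ᶠ i, ρ i x • R i x z) = z
    rw [map_finsum _ (hfin x z)]
    have h1 : ∀ i, A x (ρ i x • R i x z) = ρ i x • z := fun i => by
      rw [map_smul]
      by_cases hi : ρ i x = 0
      · rw [hi, zero_smul, zero_smul]
      · rw [(hR i x (hρ i (subset_tsupport _ hi))).1]
    simp only [h1]
    rw [← finsum_smul, ρ.sum_eq_one (Set.mem_univ x), one_smul]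

end Inverses

/-! ### Linear algebra of `K`-forms on a complex line. -/

section PlaneAlgebra

variable {T W : Type*} [AddCommGroup T] [Module ℝ T] [AddCommGroup W] [Module ℝ W]
  {j : T →ₗ[ℝ] T} {J : W →ₗ[ℝ] W}

/-- Applying `j` to `a X + b j X = 0` gives a second relation, and eliminating `j X` leaves `(a² +
b²) X = 0`. -/
theorem linearIndependent_complex_pair (hj : ∀ X, j (j X) = -X) {X : T} (hX : X ≠ 0) :
    LinearIndependent ℝ ![X, j X] := by
  rw [LinearIndependent.pair_iff]
  intro a b h
  have h1 : a • j X - b • X = 0 := by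
    have := congrArg j h
    rwa [map_add, map_smul, map_smul, hj, map_zero, smul_neg, ← sub_eq_add_neg] at this
  have h2 : (a * a + b * b) • X = 0 := by
    have h3 : a • (a • X + b • j X) - b • (a • j X - b • X) = (a * a + b * b) • X := by module
    rw [← h3, h, h1, smul_zero, smul_zero, sub_zero]
  have h4 : a * a + b * b = 0 := (smul_eq_zero.mp h2).resolve_right hX
  constructor <;> nlinarith [mul_self_nonneg a, mul_self_nonneg b]

/-- The basis `X, j X` of a complex line. -/
def complexPairBasis (hT : Module.finrank ℝ T = 2) (hj : ∀ X, j (j X) = -X) {X : T} (hX : X ≠ 0) :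
    Module.Basis (Fin 2) ℝ T :=
  have : FiniteDimensional ℝ T := .of_finrank_pos (by omega)
  basisOfLinearIndependentOfCardEqFinrank (linearIndependent_complex_pair hj hX) (by simp [hT])

theorem exists_complex_coord (hT : Module.finrank ℝ T = 2) (hj : ∀ X, j (j X) = -X) {X : T}
    (hX : X ≠ 0) (Y : T) : ∃ a b : ℝ, Y = a • X + b • j X := by
  refine ⟨(complexPairBasis hT hj hX).repr Y 0, (complexPairBasis hT hj hX).repr Y 1, ?_⟩
  conv_lhs => rw [← (complexPairBasis hT hj hX).sum_repr Y]
  rw [Fin.sum_univ_two]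
  simp [complexPairBasis]

/-- The value at `X` fixes the value at `j X`, and these two vectors span. With
`KForms.exists_apply_eq`, evaluation at a nonzero vector identifies `K W` with `W`. -/
theorem KForms.eq_zero_of_apply_eq_zero (hT : Module.finrank ℝ T = 2) (hj : ∀ X, j (j X) = -X)
    {η : T →ₗ[ℝ] W} (hη : η ∈ KForms j J) {X : T} (hX : X ≠ 0) (h : η X = 0) : η = 0 := by
  ext Y
  obtain ⟨a, b, rfl⟩ := exists_complex_coord hT hj hX Y
  have h1 : η (j X) = J (η X) := hη X
  simp [h1, h]

theorem KForms.exists_apply_eq (hT : Module.finrank ℝ T = 2) (hj : ∀ X, j (j X) = -X)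
    (hJ : ∀ w, J (J w) = -w) {X : T} (hX : X ≠ 0) (w : W) : ∃ η ∈ KForms j J, η X = w := by
  set b := complexPairBasis hT hj hX with hb
  set η := b.constr ℝ ![w, J w]
  have hb0 : b 0 = X := by simp [hb, complexPairBasis]
  have hb1 : b 1 = j X := by simp [hb, complexPairBasis]
  have h0 : η X = w := by rw [← hb0, Module.Basis.constr_basis]; rfl
  have h1 : η (j X) = J w := by rw [← hb1, Module.Basis.constr_basis]; rfl
  refine ⟨η, fun Y => ?_, h0⟩
  obtain ⟨c, d, rfl⟩ := exists_complex_coord hT hj hX Y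
  simp [h0, h1, hj, hJ]

end PlaneAlgebra

/-! ### Operators on sections and the algebra of bundle homomorphisms. -/

section Operators

variable {M : Type u} [TopologicalSpace M] [ChartedSpace (EuclideanSpace ℝ (Fin 2)) M]
  [IsManifold (𝓡 2) ∞ M]
  {V : SmoothVB.{u, v} M} {W : SmoothVB.{u, w} M}

theorem finrank_tangent (x : M) : Module.finrank ℝ ((TM M).fiber x) = 2 :=
  finrank_euclideanSpace_fin (𝕜 := ℝ) (n := 2)

theorem exists_tangent_ne_zero (x : M) : ∃ X : (TM M).fiber x, X ≠ 0 := by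
  have : Nontrivial ((TM M).fiber x) :=
    Module.nontrivial_of_finrank_pos (R := ℝ) (by rw [finrank_tangent]; norm_num)
  exact exists_ne 0

/-- A complex structure acting on sections. -/
abbrev ComplexStr.app (S : ComplexStr V) (ψ : Sec V) : Sec V := S.toBundleHom.app ψ

theorem ComplexStr.ext {S S' : ComplexStr V} (h : ∀ x z, S x z = S' x z) : S = S' := by
  obtain ⟨S, hS⟩ := S
  obtain ⟨S', hS'⟩ := S'
  have : S = S' := BundleHom.ext h
  subst this
  rfl

theorem ComplexStr.app_app (S : ComplexStr V) (ψ : Sec V) : S.app (S.app ψ) = -ψ := by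
  ext x
  exact S.sq x (ψ x)

namespace RealOp

variable (L : RealOp V W)

theorem map_zero (x : M) (X : (TM M).fiber x) : L 0 x X = 0 := by
  have := L.map_smul 0 0 x X
  rwa [zero_smul, zero_smul] at this

theorem map_neg (ψ : Sec V) (x : M) (X : (TM M).fiber x) : L (-ψ) x X = -L ψ x X := by
  rw [← neg_one_smul ℝ ψ, L.map_smul, neg_one_smul]

theorem map_sub (ψ φ : Sec V) (x : M) (X : (TM M).fiber x) :
    L (ψ - φ) x X = L ψ x X - L φ x X := by
  rw [sub_eq_add_neg, L.map_add, L.map_neg, sub_eq_add_neg]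

/-- The exterior derivative `(d ξ)(X, Y) = d_X (ξ(Y)) - d_Y (ξ(X)) - π ξ([X, Y])`. -/
def extDeriv (p : BundleHom V W) (ξ : OneForm V) (X Y : Sec (TM M)) (x : M) : W.fiber x :=
  L (ξ.app Y) x (X x) - L (ξ.app X) x (Y x)
    - p x (ξ x (VectorField.mlieBracket (𝓡 2) (fun y => X y) (fun y => Y y) x))

end RealOp

section

variable [T2Space M] [SigmaCompactSpace M]

/-- A bundle homomorphism from its action on fibres and its action on sections. -/
def BundleHom.ofApp (T : ∀ x, V.fiber x →ₗ[ℝ] W.fiber x) (L : Sec V → Sec W)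
    (h : ∀ ψ x, L ψ x = T x (ψ x)) : BundleHom V W :=
  BundleHom.ofSec T fun ψ x => by
    simp only [← h]
    exact (L ψ).contMDiff.contMDiffAt

instance : Add (BundleHom V W) := ⟨fun A B =>
  BundleHom.ofApp (fun x => A x + B x) (fun ψ => A.app ψ + B.app ψ) fun _ _ => rfl⟩

instance : Sub (BundleHom V W) := ⟨fun A B =>
  BundleHom.ofApp (fun x => A x - B x) (fun ψ => A.app ψ - B.app ψ) fun _ _ => rfl⟩

instance : SMul ℝ (BundleHom V W) := ⟨fun c A =>
  BundleHom.ofApp (fun x => c • A x) (fun ψ => c • A.app ψ) fun _ _ => rfl⟩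

instance : Zero (BundleHom V W) := ⟨BundleHom.ofApp (fun _ => 0) (fun _ => 0) fun _ _ => rfl⟩

@[simp] theorem BundleHom.add_apply (A B : BundleHom V W) (x : M) (z : V.fiber x) :
    (A + B) x z = A x z + B x z := rfl

@[simp] theorem BundleHom.sub_apply (A B : BundleHom V W) (x : M) (z : V.fiber x) :
    (A - B) x z = A x z - B x z := rfl

@[simp] theorem BundleHom.smul_apply (c : ℝ) (A : BundleHom V W) (x : M) (z : V.fiber x) :
    (c • A) x z = c • A x z := rfl

@[simp] theorem BundleHom.zero_apply (x : M) (z : V.fiber x) :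
    (0 : BundleHom V W) x z = 0 := rfl

end

/-- Composition of bundle homomorphisms. -/
def BundleHom.comp
    {Z : SmoothVB M} (A : BundleHom W Z) (B : BundleHom V W) : BundleHom V Z where
  toFun x := A x ∘ₗ B x
  smooth := A.smooth.comp B.smooth

end Operators

/-! ### The isomorphisms `δ` and the sections with prescribed `π` and `d`. -/

section JetBasics

variable {M : Type u} [TopologicalSpace M] [ChartedSpace (EuclideanSpace ℝ (Fin 2)) M]
  [IsManifold (𝓡 2) ∞ M] {JM : ComplexStr (TM M)} {V : SmoothVB.{u, v} M} {J : ComplexStr V}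
  {D : HolStr JM J} (𝒱 : JetComplex D)

namespace JetComplex

/-- The isomorphism `δ : N_{n+1} → K N_n` on one fibre. -/
def delta (n : ℕ) (x : M) : 𝒱.N (n + 1) x →ₗ[ℝ] (TM M).fiber x →ₗ[ℝ] 𝒱.N n x :=
  (𝒱.exists_delta n x).choose

variable {n : ℕ} {x : M}

theorem delta_mem (z : 𝒱.N (n + 1) x) : 𝒱.delta n x z ∈ KForms (JM x) (𝒱.JN n x) := by
  rw [← (𝒱.exists_delta n x).choose_spec.2.1]
  exact ⟨z, rfl⟩

theorem delta_J (z : 𝒱.N (n + 1) x) (X : (TM M).fiber x) :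
    𝒱.delta n x (𝒱.JN (n + 1) x z) X = 𝒱.JN n x (𝒱.delta n x z X) :=
  (𝒱.exists_delta n x).choose_spec.2.2.1 z X

theorem delta_eq_zero {z : 𝒱.N (n + 1) x} {X : (TM M).fiber x} (hX : X ≠ 0)
    (h : 𝒱.delta n x z X = 0) : z = 0 := by
  have h1 := KForms.eq_zero_of_apply_eq_zero (finrank_tangent x) (JM.sq x) (𝒱.delta_mem z) hX h
  exact (𝒱.exists_delta n x).choose_spec.1 (h1.trans (map_zero _).symm)

theorem exists_delta_eq {η : (TM M).fiber x →ₗ[ℝ] 𝒱.N n x}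
    (h : η ∈ KForms (JM x) (𝒱.JN n x)) : ∃ z, 𝒱.delta n x z = η := by
  rw [← (𝒱.exists_delta n x).choose_spec.2.1] at h
  exact h

theorem exists_delta_apply_eq {X : (TM M).fiber x} (hX : X ≠ 0) (y : 𝒱.N n x) :
    ∃ z, 𝒱.delta n x z X = y := by
  obtain ⟨η, hη, rfl⟩ := KForms.exists_apply_eq (finrank_tangent x) (JM.sq x) (𝒱.JN_sq n x) hX y
  obtain ⟨z, rfl⟩ := 𝒱.exists_delta_eq hη
  exact ⟨z, rfl⟩

theorem d_eq_delta {ψ : Sec (𝒱.E (n + 1))} (h : ∀ y, ψ y ∈ 𝒱.N (n + 1) y) (x : M)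
    (X : (TM M).fiber x) : 𝒱.d n ψ x X = 𝒱.delta n x ⟨ψ x, h x⟩ X :=
  (𝒱.exists_delta n x).choose_spec.2.2.2 ψ h X

theorem d_mem {ψ : Sec (𝒱.E (n + 1))} (h : ∀ y, ψ y ∈ 𝒱.N (n + 1) y) (x : M)
    (X : (TM M).fiber x) : 𝒱.d n ψ x X ∈ 𝒱.N n x := by
  rw [𝒱.d_eq_delta h]
  exact Subtype.coe_prop _

theorem d_JM {ψ : Sec (𝒱.E (n + 1))} (h : ∀ y, ψ y ∈ 𝒱.N (n + 1) y) (x : M)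
    (X : (TM M).fiber x) :
    𝒱.d n ψ x (JM x X) = 𝒱.JN n x ⟨𝒱.d n ψ x X, 𝒱.d_mem h x X⟩ := by
  rw [𝒱.d_eq_delta h, 𝒱.delta_mem ⟨ψ x, h x⟩ X]
  congr 2
  exact Subtype.ext (𝒱.d_eq_delta h x X).symm

theorem eq_zero_of_d_eq_zero {ψ : Sec (𝒱.E (n + 1))} (h : ∀ y, ψ y ∈ 𝒱.N (n + 1) y) {x : M}
    {X : (TM M).fiber x} (hX : X ≠ 0) (h0 : 𝒱.d n ψ x X = 0) : ψ x = 0 := by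
  rw [𝒱.d_eq_delta h] at h0
  exact congrArg Subtype.val (𝒱.delta_eq_zero hX (Subtype.ext h0))

/-- Sections of `V_{n+1}` are determined by their images under `π` and `d`. -/
theorem eq_of_pr_of_d {ψ φ : Sec (𝒱.E (n + 1))} (h1 : ∀ x, 𝒱.pr n x (ψ x) = 𝒱.pr n x (φ x))
    (h2 : ∀ x X, 𝒱.d n ψ x X = 𝒱.d n φ x X) : ψ = φ := by
  ext x
  obtain ⟨X, hX⟩ := exists_tangent_ne_zero x
  rw [← sub_eq_zero, ← Sec.sub_apply]
  refine 𝒱.eq_zero_of_d_eq_zero (fun y => ?_) hX ?_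
  · change 𝒱.pr n y (ψ y - φ y) = 0
    rw [map_sub, h1, sub_self]
  · rw [RealOp.map_sub, h2, sub_self]

section

variable [T2Space M] [SigmaCompactSpace M]

/-- A smooth right inverse of the projection `π : V_{n+1} → V_n`. -/
def lift (n : ℕ) : BundleHom (𝒱.E n) (𝒱.E (n + 1)) :=
  ((𝒱.pr n).exists_rightInverse (𝒱.pr_surjective n)).choose

@[simp] theorem pr_lift (x : M) (z : (𝒱.E n).fiber x) : 𝒱.pr n x (𝒱.lift n x z) = z :=
  ((𝒱.pr n).exists_rightInverse (𝒱.pr_surjective n)).choose_spec x z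

theorem pr_app_lift (φ : Sec (𝒱.E n)) : (𝒱.pr n).app ((𝒱.lift n).app φ) = φ := by
  ext x
  exact 𝒱.pr_lift x (φ x)

theorem exists_section_N (z : (𝒱.E n).fiber x) (hz : z ∈ 𝒱.N n x) :
    ∃ ψ : Sec (𝒱.E n), ψ x = z ∧ ∀ y, ψ y ∈ 𝒱.N n y := by
  obtain ⟨ψ, rfl⟩ := Sec.exists_apply_eq _ x z
  cases n with
  | zero => exact ⟨ψ, rfl, fun y => Submodule.mem_top⟩
  | succ n =>
    refine ⟨ψ - (𝒱.lift n).app ((𝒱.pr n).app ψ), ?_, fun y => ?_⟩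
    · have h1 : 𝒱.pr n x (ψ x) = 0 := hz
      simp [h1]
    · change 𝒱.pr n y (ψ y - 𝒱.lift n y (𝒱.pr n y (ψ y))) = 0
      rw [map_sub, pr_lift, sub_self]

/-- The part of `d_X` vertical with respect to the chosen lift. -/
theorem isFunLinear_vertical (n : ℕ) (X : Sec (TM M)) : IsFunLinear fun ψ : Sec (𝒱.E (n + 1)) =>
    (𝒱.d n (ψ - (𝒱.lift n).app ((𝒱.pr n).app ψ))).app X where
  map_add ψ φ := by
    ext x
    rw [Sec.add_apply, BundleHom.app_apply, BundleHom.app_apply, BundleHom.app_apply, ← RealOp.map_add]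
    congr 3
    ext y
    simp
    abel
  map_fsmul f ψ := by
    ext x
    rw [Sec.fsmul_apply, BundleHom.app_apply, BundleHom.app_apply]
    have h1 : ψ.fsmul f - (𝒱.lift n).app ((𝒱.pr n).app (ψ.fsmul f)) =
        (ψ - (𝒱.lift n).app ((𝒱.pr n).app ψ)).fsmul f := by
      ext y
      simp [smul_sub]
    rw [h1, 𝒱.d_leibniz, Sec.sub_apply, map_sub, BundleHom.app_apply, BundleHom.app_apply, pr_lift,
      sub_self, smul_zero, add_zero]

/-- `K`-valued 1-forms with values in `N_n` are in the image of `δ`. -/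
theorem exists_d_eq_of_kType (ξ : OneForm (𝒱.E n)) (hN : ∀ x X, ξ x X ∈ 𝒱.N n x)
    (hK : ∀ x X, ξ x (JM x X) = 𝒱.JN n x ⟨ξ x X, hN x X⟩) :
    ∃ χ : Sec (𝒱.E (n + 1)), (∀ x, χ x ∈ 𝒱.N (n + 1) x) ∧ ∀ x X, 𝒱.d n χ x X = ξ x X := by
  have h1 : ∀ x, ∃ z : 𝒱.N (n + 1) x, ∀ X, (𝒱.delta n x z X : (𝒱.E n).fiber x) = ξ x X := by
    intro x
    have hη : (ξ x).codRestrict (𝒱.N n x) (hN x) ∈ KForms (JM x) (𝒱.JN n x) :=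
      fun X => Subtype.ext (hK x X)
    obtain ⟨z, hz⟩ := 𝒱.exists_delta_eq hη
    exact ⟨z, fun X => by rw [hz]; rfl⟩
  choose c hc using h1
  have hs : ∀ x, (𝒱.E (n + 1)).SmoothAt (fun y => (c y : (𝒱.E (n + 1)).fiber y)) x := by
    intro x₀
    obtain ⟨X₀, hX₀⟩ := exists_tangent_ne_zero x₀
    obtain ⟨X, rfl⟩ := Sec.exists_apply_eq (TM M) x₀ X₀
    -- `Δ` extends `z ↦ δ(z) X` from `N_{n+1}` to a smooth homomorphism on all of `V_{n+1}`. At `x₀`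
    -- it is injective on `ker π`, so `π` and `Δ` together detect smoothness of the pointwise
    -- solution `c`.
    obtain ⟨Δ, hΔ⟩ := (𝒱.isFunLinear_vertical n X).exists_bundleHom
    have key : ∀ y (z : 𝒱.N (n + 1) y), Δ y z = 𝒱.delta n y z (X y) := by
      rintro y ⟨z, hz⟩
      obtain ⟨ψ, rfl, hψ⟩ := 𝒱.exists_section_N z hz
      have h2 : Δ y (ψ y) = 𝒱.d n (ψ - (𝒱.lift n).app ((𝒱.pr n).app ψ)) y (X y) :=
        congrArg (fun s : Sec (𝒱.E n) => s y) (hΔ ψ)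
      have h3 : (𝒱.lift n).app ((𝒱.pr n).app ψ) = 0 := by
        ext y'
        have h4 : 𝒱.pr n y' (ψ y') = 0 := hψ y'
        simp [h4]
      rw [h2, h3, sub_zero, 𝒱.d_eq_delta hψ]
    refine SmoothVB.smoothAt_of_injective (𝒱.pr n) Δ (fun z h2 h3 => ?_) ?_ ?_
    · have h4 := key x₀ ⟨z, h2⟩
      rw [h3] at h4
      exact congrArg Subtype.val (𝒱.delta_eq_zero hX₀ (Subtype.ext h4.symm))
    · have h4 : ∀ y, 𝒱.pr n y (c y : (𝒱.E (n + 1)).fiber y) = 0 := fun y => (c y).2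
      simp only [h4]
      exact (0 : Sec (𝒱.E n)).contMDiff.contMDiffAt
    · simp only [key, hc]
      exact (ξ.app X).contMDiff.contMDiffAt
  refine ⟨⟨fun x => c x, hs⟩, fun x => (c x).2, fun x X => ?_⟩
  rw [𝒱.d_eq_delta (fun x => (c x).2)]
  exact hc x X

/-- For a 1-form with values in `N_{n+1}`, `d ξ (X, J X)` is computed by `δ`. -/
theorem extDeriv_of_mem (ξ : OneForm (𝒱.E (n + 1))) (hN : ∀ x X, ξ x X ∈ 𝒱.N (n + 1) x)
    (X Y : Sec (TM M)) (x : M) : (𝒱.d n).extDeriv (𝒱.pr n) ξ X Y x =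
      𝒱.delta n x ⟨ξ x (Y x), hN _ _⟩ (X x) - 𝒱.delta n x ⟨ξ x (X x), hN _ _⟩ (Y x) := by
  have h1 : ∀ Z, 𝒱.pr n x (ξ x Z) = 0 := fun Z => hN x Z
  rw [RealOp.extDeriv, h1, sub_zero, 𝒱.d_eq_delta (ψ := ξ.app Y) (fun y => hN y _),
    𝒱.d_eq_delta (ψ := ξ.app X) (fun y => hN y _)]
  rfl

/-- Since `δ` takes values in `K N_n` and is complex linear, `d ξ (X, J X)` is the value at `X` of
`δ (ξ(J X) - J ξ(X))`. For `X ≠ 0` a `K`-form vanishing at `X` is zero, and `δ` is injective. Thus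
closed `N_{n+1}`-valued forms have type `K`. -/
theorem kType_of_extDeriv_eq_zero (ξ : OneForm (𝒱.E (n + 1)))
    (hN : ∀ x X, ξ x X ∈ 𝒱.N (n + 1) x)
    (h : ∀ (X : Sec (TM M)) x, (𝒱.d n).extDeriv (𝒱.pr n) ξ X (JM.app X) x = 0) (x : M)
    (X : (TM M).fiber x) : ξ x (JM x X) = 𝒱.JN (n + 1) x ⟨ξ x X, hN x X⟩ := by
  by_cases hX : X = 0
  · subst hX
    have h0 : (⟨ξ x 0, hN x 0⟩ : 𝒱.N (n + 1) x) = 0 := Subtype.ext (map_zero _)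
    rw [h0, map_zero, map_zero, map_zero]
    rfl
  obtain ⟨X, rfl⟩ := Sec.exists_apply_eq (TM M) x X
  have h1 := h X x
  rw [𝒱.extDeriv_of_mem ξ hN] at h1
  have h2 : 𝒱.delta n x ⟨ξ x (X x), hN _ _⟩ ((JM.app X) x) =
      𝒱.delta n x (𝒱.JN (n + 1) x ⟨ξ x (X x), hN _ _⟩) (X x) :=
    (𝒱.delta_mem _ _).trans (𝒱.delta_J _ _).symm
  rw [h2, ← Submodule.coe_sub, ← LinearMap.sub_apply, ← map_sub] at h1
  have h3 := 𝒱.delta_eq_zero hX (Subtype.ext h1)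
  exact congrArg Subtype.val (sub_eq_zero.mp h3)

theorem extDeriv_eq_zero_of_kType (ξ : OneForm (𝒱.E (n + 1)))
    (hN : ∀ x X, ξ x X ∈ 𝒱.N (n + 1) x)
    (hK : ∀ x X, ξ x (JM x X) = 𝒱.JN (n + 1) x ⟨ξ x X, hN x X⟩) (X : Sec (TM M)) (x : M) :
    (𝒱.d n).extDeriv (𝒱.pr n) ξ X (JM.app X) x = 0 := by
  rw [𝒱.extDeriv_of_mem ξ hN]
  have h1 : (⟨ξ x ((JM.app X) x), hN _ _⟩ : 𝒱.N (n + 1) x) =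
      𝒱.JN (n + 1) x ⟨ξ x (X x), hN _ _⟩ := Subtype.ext (hK x (X x))
  have h2 : 𝒱.delta n x ⟨ξ x (X x), hN _ _⟩ ((JM.app X) x) =
      𝒱.delta n x (𝒱.JN (n + 1) x ⟨ξ x (X x), hN _ _⟩) (X x) :=
    (𝒱.delta_mem _ _).trans (𝒱.delta_J _ _).symm
  rw [h1, h2, sub_self]

/-- The pairs `(φ, ξ)` that are of the form `(π ψ, d ψ)`. -/
def IsOneJet : ∀ n, Sec (𝒱.E n) → OneForm (𝒱.E n) → Prop
  | 0, φ, ξ => ∀ x X, D φ x X = (1 / 2 : ℝ) • (ξ x X + J x (ξ x (JM x X)))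
  | n + 1, φ, ξ => (∀ x X, 𝒱.pr n x (ξ x X) = 𝒱.d n φ x X) ∧
      ∀ X Y x, (𝒱.d n).extDeriv (𝒱.pr n) ξ X Y x = 0

/-- Lift `φ` to some `ψ₀`. The conditions on `(φ, ξ)` say precisely that `ξ - d ψ₀` is a form of
type `K` with values in `N_n`, hence equal to `d χ` for a section `χ` of `N_{n+1}`; then `ψ₀ + χ` is
the solution. This carries the extension of homomorphisms and of holomorphic sections. -/
theorem exists_of_isOneJet {φ : Sec (𝒱.E n)} {ξ : OneForm (𝒱.E n)} (h : 𝒱.IsOneJet n φ ξ) :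
    ∃ ψ : Sec (𝒱.E (n + 1)), (𝒱.pr n).app ψ = φ ∧ ∀ x X, 𝒱.d n ψ x X = ξ x X := by
  set ψ₀ := (𝒱.lift n).app φ with hψ₀
  have hprψ₀ : (𝒱.pr n).app ψ₀ = φ := 𝒱.pr_app_lift φ
  set B : OneForm (𝒱.E n) := ξ - 𝒱.d n ψ₀ with hB
  have key : ∃ hN : ∀ x X, B x X ∈ 𝒱.N n x,
      ∀ x X, B x (JM x X) = 𝒱.JN n x ⟨B x X, hN x X⟩ := by
    cases n with
    | zero =>
      refine ⟨fun x X => Submodule.mem_top, fun x X => ?_⟩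
      rw [𝒱.JN_zero]
      -- Both `ξ` and `d ψ₀` have `K̄`-part `D φ`, so the difference `B` has type `K`.
      have h1 := 𝒱.D_pr ψ₀ x X
      rw [hprψ₀, h x X, RealOp.kbarPart] at h1
      have h2 := smul_right_injective _ (by norm_num : (1 / 2 : ℝ) ≠ 0) h1
      have h3 : B x X + J x (B x (JM x X)) = 0 := by
        rw [hB, BundleHom.sub_apply, BundleHom.sub_apply, map_sub]
        linear_combination (norm := module) h2
      have h4 := congrArg (J x) h3
      rw [map_add, J.sq, map_zero] at h4
      exact (sub_eq_zero.mp ((sub_eq_add_neg _ _).trans h4)).symm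
    | succ n =>
      obtain ⟨h1, h2⟩ := h
      have hN : ∀ x X, B x X ∈ 𝒱.N (n + 1) x := fun x X => by
        change 𝒱.pr n x (ξ x X - 𝒱.d (n + 1) ψ₀ x X) = 0
        rw [map_sub, h1, 𝒱.pr_d, hprψ₀, sub_self]
      refine ⟨hN, 𝒱.kType_of_extDeriv_eq_zero B hN fun X x => ?_⟩
      -- Here `B` is closed, since `d ξ = 0` and `d d ψ₀ = 0`, and closedness forces type `K`.
      have h3 := h2 X (JM.app X) x
      have h4 := 𝒱.d_d n ψ₀ X (JM.app X) x
      have h5 : ∀ Z : Sec (TM M), B.app Z = ξ.app Z - (𝒱.d (n + 1) ψ₀).app Z := fun Z => rfl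
      rw [RealOp.extDeriv] at h3 ⊢
      rw [h5, h5, RealOp.map_sub, RealOp.map_sub, hB, BundleHom.sub_apply, map_sub]
      linear_combination (norm := module) h3 - h4
  obtain ⟨hN, hK⟩ := key
  obtain ⟨χ, hχN, hχ⟩ := 𝒱.exists_d_eq_of_kType B hN hK
  have hprχ : ∀ x, 𝒱.pr n x (χ x) = 0 := hχN
  refine ⟨ψ₀ + χ, ?_, fun x X => ?_⟩
  · ext x
    rw [BundleHom.app_apply, Sec.add_apply, map_add, hprχ, add_zero]
    exact 𝒱.pr_lift x (φ x)
  · rw [RealOp.map_add, hχ, hB, BundleHom.sub_apply, add_sub_cancel]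

end

end JetComplex

end JetBasics

/-- Dependent choice: the recursion runs on pairs of an object and a proof of the invariant `P`,
which is what makes the next step possible; `Q` records how consecutive objects are related. -/
theorem exists_seq_of_step {α : ℕ → Type*} {P : ∀ n, α n → Prop} {Q : ∀ n, α n → α (n + 1) → Prop}
    {a₀ : α 0} (h₀ : P 0 a₀) (step : ∀ n a, P n a → ∃ b, P (n + 1) b ∧ Q n a b) :
    ∃ f : ∀ n, α n, f 0 = a₀ ∧ (∀ n, P n (f n)) ∧ ∀ n, Q n (f n) (f (n + 1)) := by
  choose g hg using step
  let F : ∀ n, {a : α n // P n a} := fun n =>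
    Nat.rec ⟨a₀, h₀⟩ (fun n a => ⟨g n a.1 a.2, (hg n a.1 a.2).1⟩) n
  exact ⟨fun n => (F n).1, rfl, fun n => (F n).2, fun n => (hg n (F n).1 (F n).2).2⟩

/-! ### Homomorphisms of jet complexes: uniqueness and extension. -/

section JetMaps

variable {M : Type u} [TopologicalSpace M] [ChartedSpace (EuclideanSpace ℝ (Fin 2)) M]
  [IsManifold (𝓡 2) ∞ M] {JM : ComplexStr (TM M)}
  {V : SmoothVB.{u, v} M} {J : ComplexStr V} {D : HolStr JM J}
  {V' : SmoothVB.{u, w} M} {J' : ComplexStr V'} {D' : HolStr JM J'}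
  {𝒱 : JetComplex D} {𝒱' : JetComplex D'}

/-- Sequences of bundle homomorphisms between jet complexes commuting with `π` and `d`. -/
structure IsJetMap (T : ∀ n, BundleHom (𝒱.E n) (𝒱'.E n)) : Prop where
  map_pr : ∀ n x w, T n x (𝒱.pr n x w) = 𝒱'.pr n x (T (n + 1) x w)
  map_d : ∀ n ψ x X, T n x (𝒱.d n ψ x X) = 𝒱'.d n ((T (n + 1)).app ψ) x X

theorem JetHom.isJetMap (T : JetHom 𝒱 𝒱') : IsJetMap T.map := ⟨T.map_pr, T.map_d⟩

theorem JetHom.ext {T T' : JetHom 𝒱 𝒱'} (h : ∀ n, T.map n = T'.map n) : T = T' := by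
  obtain ⟨T, _⟩ := T
  obtain ⟨T', _⟩ := T'
  obtain rfl : T = T' := funext h
  rfl

theorem IsJetMap.comp {V'' : SmoothVB M} {J'' : ComplexStr V''} {D'' : HolStr JM J''}
    {𝒱'' : JetComplex D''} {T' : ∀ n, BundleHom (𝒱'.E n) (𝒱''.E n)}
    {T : ∀ n, BundleHom (𝒱.E n) (𝒱'.E n)} (hT' : IsJetMap T') (hT : IsJetMap T) :
    IsJetMap (𝒱 := 𝒱) (𝒱' := 𝒱'') fun n => (T' n).comp (T n) where
  map_pr n x z := (congrArg (T' n x) (hT.map_pr n x z)).trans (hT'.map_pr n x _)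
  map_d n ψ x X := (congrArg (T' n x) (hT.map_d n ψ x X)).trans (hT'.map_d n _ x X)

theorem IsJetMap.id : IsJetMap (𝒱 := 𝒱) (𝒱' := 𝒱) fun n => BundleHom.id (𝒱.E n) where
  map_pr _ _ _ := rfl
  map_d _ _ _ _ := rfl

section

variable [T2Space M] [SigmaCompactSpace M]

theorem IsJetMap.add {T T' : ∀ n, BundleHom (𝒱.E n) (𝒱'.E n)} (hT : IsJetMap T)
    (hT' : IsJetMap T') : IsJetMap (𝒱 := 𝒱) (𝒱' := 𝒱') fun n => T n + T' n where
  map_pr n x z := by simp only [BundleHom.add_apply, map_add, hT.map_pr, hT'.map_pr]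
  map_d n ψ x X := by
    rw [BundleHom.add_apply, hT.map_d, hT'.map_d, ← RealOp.map_add]
    rfl

theorem IsJetMap.smul {T : ∀ n, BundleHom (𝒱.E n) (𝒱'.E n)} (hT : IsJetMap T) (c : ℝ) :
    IsJetMap (𝒱 := 𝒱) (𝒱' := 𝒱') fun n => c • T n where
  map_pr n x z := by simp only [BundleHom.smul_apply, map_smul, hT.map_pr]
  map_d n ψ x X := by
    rw [BundleHom.smul_apply, hT.map_d, ← RealOp.map_smul]
    rfl

/-- If `T_n = T'_n`, then `T_{n+1} ψ` and `T'_{n+1} ψ` have the same images under `π` and `d`, hence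
coincide. Besides uniqueness of extensions, this transports identities between jet maps from `V_0`
to all levels. -/
theorem IsJetMap.eq {T T' : ∀ n, BundleHom (𝒱.E n) (𝒱'.E n)} (hT : IsJetMap T)
    (hT' : IsJetMap T') (h0 : T 0 = T' 0) (n : ℕ) : T n = T' n := by
  induction n with
  | zero => exact h0
  | succ n ih =>
    refine BundleHom.ext_app fun ψ x => ?_
    have h1 : (T (n + 1)).app ψ = (T' (n + 1)).app ψ := by
      refine 𝒱'.eq_of_pr_of_d (fun y => ?_) fun y X => ?_
      · rw [BundleHom.app_apply, BundleHom.app_apply, ← hT.map_pr, ← hT'.map_pr, ih]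
      · rw [← hT.map_d, ← hT'.map_d, ih]
    exact congrArg (fun s : Sec (𝒱'.E (n + 1)) => s x) h1

/-- The extension of a bundle homomorphism by one step. -/
theorem JetComplex.exists_extension {n : ℕ} (T : BundleHom (𝒱.E n) (𝒱'.E n))
    (hT : ∀ ψ : Sec (𝒱.E (n + 1)),
      𝒱'.IsOneJet n (T.app ((𝒱.pr n).app ψ)) (T.comp (𝒱.d n ψ))) :
    ∃ T' : BundleHom (𝒱.E (n + 1)) (𝒱'.E (n + 1)),
      (∀ x z, T x (𝒱.pr n x z) = 𝒱'.pr n x (T' x z)) ∧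
      ∀ ψ x X, T x (𝒱.d n ψ x X) = 𝒱'.d n (T'.app ψ) x X := by
  -- `L ψ` is the only section with projection `T π ψ` and derivative `T d ψ`. These data are
  -- additive in `ψ` and obey the Leibniz rule, so uniqueness makes `L` function linear.
  choose L hL1 hL2 using fun ψ => 𝒱'.exists_of_isOneJet (hT ψ)
  have hL1' : ∀ ψ x, 𝒱'.pr n x (L ψ x) = T x (𝒱.pr n x (ψ x)) := fun ψ x =>
    congrArg (fun s : Sec (𝒱'.E n) => s x) (hL1 ψ)
  have hL2' : ∀ ψ x X, 𝒱'.d n (L ψ) x X = T x (𝒱.d n ψ x X) := hL2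
  have hlin : IsFunLinear L := by
    refine ⟨fun ψ φ => 𝒱'.eq_of_pr_of_d (fun x => ?_) fun x X => ?_,
      fun f ψ => 𝒱'.eq_of_pr_of_d (fun x => ?_) fun x X => ?_⟩
    · simp only [Sec.add_apply, map_add, hL1']
    · rw [RealOp.map_add, hL2', hL2', hL2', RealOp.map_add, map_add]
    · simp only [Sec.fsmul_apply, map_smul, hL1']
    · simp only [𝒱.d_leibniz, 𝒱'.d_leibniz, map_add, map_smul, hL1', hL2']
  obtain ⟨T', hT'⟩ := hlin.exists_bundleHom
  refine ⟨T', fun x z => ?_, fun ψ x X => ?_⟩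
  · obtain ⟨ψ, rfl⟩ := Sec.exists_apply_eq _ x z
    rw [← hL1', ← hT', BundleHom.app_apply]
  · rw [hT', hL2']

/-- A complex linear map preserves `K̄`-parts, so applying `T` to `D π ψ = d'' ψ` gives the bottom
compatibility condition. This is the only place where holomorphicity enters the extension. -/
theorem IsHolomorphicHom.isOneJet {T : BundleHom V V'} (hT : IsHolomorphicHom D D' T)
    (ψ : Sec (𝒱.E 1)) :
    𝒱'.IsOneJet 0 (BundleHom.app (V := 𝒱.E 0) (W := 𝒱'.E 0) T ((𝒱.pr 0).app ψ))
      (BundleHom.comp (V := TM M) (W := 𝒱.E 0) (Z := 𝒱'.E 0) T (𝒱.d 0 ψ)) := by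
  intro x X
  have h1 := congrArg (T x) (𝒱.D_pr ψ x X)
  rw [hT.2, RealOp.kbarPart, map_smul, map_add, hT.1] at h1
  exact h1

/-- The invariant of the recursion is that `(T π ψ, T d ψ)` is admissible data in the target. It
passes to the next level because the new map intertwines `π` and `d`: the first condition then
follows from `π d = d π`, the second by applying `T` to `d d ψ = 0`. -/
theorem exists_isJetMap {T₀ : BundleHom V V'} (hT₀ : IsHolomorphicHom D D' T₀) :
    ∃ T : ∀ n, BundleHom (𝒱.E n) (𝒱'.E n), T 0 = T₀ ∧ IsJetMap T := by
  obtain ⟨T, hT0, -, hT⟩ := exists_seq_of_step (α := fun n => BundleHom (𝒱.E n) (𝒱'.E n))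
    (P := fun n T => ∀ ψ : Sec (𝒱.E (n + 1)),
      𝒱'.IsOneJet n (T.app ((𝒱.pr n).app ψ)) (T.comp (𝒱.d n ψ)))
    (Q := fun n T T' => (∀ x z, T x (𝒱.pr n x z) = 𝒱'.pr n x (T' x z)) ∧
      ∀ ψ x X, T x (𝒱.d n ψ x X) = 𝒱'.d n (T'.app ψ) x X)
    (a₀ := T₀) (fun ψ => hT₀.isOneJet ψ) (by
      intro n T hT
      obtain ⟨T', h1, h2⟩ := JetComplex.exists_extension T hT
      refine ⟨T', fun ψ => ⟨fun x X => ?_, fun X Y x => ?_⟩, h1, h2⟩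
      · have h3 := h1 x (𝒱.d (n + 1) ψ x X)
        rw [𝒱.pr_d, h2] at h3
        exact h3.symm
      · have h3 := congrArg (T x) (𝒱.d_d n ψ X Y x)
        rw [map_sub, map_sub, h1, h2, h2, map_zero] at h3
        exact h3)
  exact ⟨T, hT0, fun n => (hT n).1, fun n => (hT n).2⟩

variable (𝒱 𝒱')

theorem JetHom.existsUnique {T₀ : BundleHom V V'} (hT₀ : IsHolomorphicHom D D' T₀) :
    ∃! T : JetHom 𝒱 𝒱', T.map 0 = T₀ := by
  obtain ⟨T, hT0, hT⟩ := exists_isJetMap (𝒱 := 𝒱) (𝒱' := 𝒱') hT₀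
  refine ⟨⟨T, hT.map_pr, hT.map_d, hT0 ▸ hT₀⟩, hT0, fun T' hT' => ?_⟩
  exact JetHom.ext fun n => T'.isJetMap.eq hT (hT'.trans hT0.symm) n

theorem isHolomorphicHom_id (D : HolStr JM J) : IsHolomorphicHom D D (BundleHom.id V) :=
  ⟨fun _ _ => rfl, fun _ _ _ => rfl⟩

theorem JetHom.exists_iso (𝒱 𝒱' : JetComplex D) :
    ∃ T : JetHom 𝒱 𝒱', T.map 0 = BundleHom.id V ∧ T.IsIso ∧
      ∀ T' : JetHom 𝒱 𝒱', T'.map 0 = BundleHom.id V → T' = T := by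
  obtain ⟨T, hT, huniq⟩ := JetHom.existsUnique 𝒱 𝒱' (isHolomorphicHom_id D)
  obtain ⟨T', hT', -⟩ := JetHom.existsUnique 𝒱' 𝒱 (isHolomorphicHom_id D)
  refine ⟨T, hT, ⟨T', fun n x z => ?_, fun n x z => ?_⟩, huniq⟩
  · have h1 := (T'.isJetMap.comp T.isJetMap).eq IsJetMap.id (by rw [hT, hT']; rfl) n
    exact congrArg (fun A : BundleHom (𝒱.E n) (𝒱.E n) => A x z) h1
  · have h1 := (T.isJetMap.comp T'.isJetMap).eq IsJetMap.id (by rw [hT, hT']; rfl) n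
    exact congrArg (fun A : BundleHom (𝒱'.E n) (𝒱'.E n) => A x z) h1

end

end JetMaps

/-! ### Quaternionic structures on jet complexes. -/

section Quaternionic

variable {M : Type u} [TopologicalSpace M] [ChartedSpace (EuclideanSpace ℝ (Fin 2)) M]
  [IsManifold (𝓡 2) ∞ M] {JM : ComplexStr (TM M)}
  {V : SmoothVB.{u, v} M} {J : ComplexStr V} {D : HolStr JM J} {q : QuatStr V}

theorem QuatStr.ext {q q' : QuatStr V} (h : ∀ a, q.rmul a = q'.rmul a) : q = q' := by
  obtain ⟨q, _⟩ := q
  obtain ⟨q', _⟩ := q'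
  obtain rfl : q = q' := funext h
  rfl

theorem QuatJetStr.ext {𝒱 : JetComplex D} {R R' : QuatJetStr 𝒱 q} (h : ∀ n, R.str n = R'.str n) :
    R = R' := by
  obtain ⟨R, _⟩ := R
  obtain ⟨R', _⟩ := R'
  obtain rfl : R = R' := funext h
  rfl

theorem QuatJetStr.isJetMap {𝒱 : JetComplex D} (R : QuatJetStr 𝒱 q) (a : ℍ[ℝ]) :
    IsJetMap (𝒱 := 𝒱) (𝒱' := 𝒱) fun n => (R.str n).rmul a where
  map_pr n x z := (R.pr_linear n a x z).symm
  map_d n ψ x X := (R.d_linear n a ψ x X).symm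

variable [T2Space M] [SigmaCompactSpace M]

/-- Linearity of `J` and `D` says that right multiplication by each quaternion is a holomorphic
endomorphism of `V`, so it extends uniquely to a jet map. Both sides of every axiom of a right
`ℍ`-structure are jet maps that agree on `V_0`, hence agree on all `V_n`. -/
theorem QuatJetStr.nonempty_unique (𝒱 : JetComplex D) (hJ : QuatStr.IsLinear q q J.toBundleHom)
    (hD : RealOp.IsQuatLinear q q D.toRealOp) : Nonempty (Unique (QuatJetStr 𝒱 q)) := by
  have hol : ∀ a, IsHolomorphicHom D D (q.rmul a) := fun a =>
    ⟨fun x z => (hJ a x z).symm, fun ψ x X => (hD a ψ x X).symm⟩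
  choose T hT0 hT using fun a => exists_isJetMap (𝒱 := 𝒱) (𝒱' := 𝒱) (hol a)
  have h0 : ∀ a x z, T a 0 x z = q.rmul a x z := fun a x z => by rw [hT0]
  let str : ∀ n, QuatStr (𝒱.E n) := fun n =>
    { rmul := fun a => T a n
      rmul_add := fun a b x z => by
        have h1 := (hT (a + b)).eq ((hT a).add (hT b))
          (BundleHom.ext fun x z => by
            rw [BundleHom.add_apply, h0, h0, h0]; exact q.rmul_add a b x z) n
        rw [h1, BundleHom.add_apply]
      rmul_mul := fun a b x z => by
        have h1 := (hT (a * b)).eq ((hT b).comp (hT a))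
          (BundleHom.ext fun x z => by
            rw [h0]
            refine (q.rmul_mul a b x z).trans ?_
            rw [← h0, ← h0]
            rfl) n
        rw [h1]
        rfl
      rmul_real := fun c x z => by
        have h1 := (hT (c : ℍ[ℝ])).eq ((IsJetMap.id (𝒱 := 𝒱)).smul c)
          (BundleHom.ext fun x z => by rw [h0]; exact q.rmul_real c x z) n
        rw [h1]
        rfl }
  refine ⟨⟨⟨⟨str, QuatStr.ext hT0, fun n a x z => ((hT a).map_pr n x z).symm,
    fun n a ψ x X => ((hT a).map_d n ψ x X).symm⟩⟩, fun R => ?_⟩⟩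
  refine QuatJetStr.ext fun n => QuatStr.ext fun a => ?_
  refine (R.isJetMap a).eq (hT a) ?_ n
  rw [hT0, R.str_zero]

/-- `T ∘ a` and `a ∘ T` are jet maps with the same restriction to `V_0`. -/
theorem QuatJetStr.isLinear_jetHom {𝒱 𝒱' : JetComplex D} (R : QuatJetStr 𝒱 q)
    (R' : QuatJetStr 𝒱' q) (T : JetHom 𝒱 𝒱') (hT : T.map 0 = BundleHom.id V) (n : ℕ) :
    QuatStr.IsLinear (R.str n) (R'.str n) (T.map n) := by
  intro a x z
  have h1 := (T.isJetMap.comp (R.isJetMap a)).eq ((R'.isJetMap a).comp T.isJetMap) (by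
    rw [hT, R.str_zero, R'.str_zero]; rfl) n
  exact congrArg (fun A : BundleHom (𝒱.E n) (𝒱'.E n) => A x z) h1

end Quaternionic

/-! ### Prolongation of holomorphic sections. -/

section Prolongation

variable {M : Type u} [TopologicalSpace M] [ChartedSpace (EuclideanSpace ℝ (Fin 2)) M]
  [IsManifold (𝓡 2) ∞ M] {JM : ComplexStr (TM M)}
  {V : SmoothVB.{u, v} M} {J : ComplexStr V} {D : HolStr JM J}

theorem IsProlongation.injective {𝒱 : JetComplex D} {P : ∀ n, D.H0 →ₗ[ℝ] Sec (𝒱.E n)}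
    (hP : IsProlongation 𝒱 P) (n : ℕ) : Function.Injective (P n) := by
  induction n with
  | zero => exact fun ψ φ h => Subtype.ext (by rw [← hP.1, ← hP.1, h])
  | succ n ih => exact fun ψ φ h => ih (by rw [← hP.2.1 n ψ, ← hP.2.1 n φ, h])

/-- Both sides are annihilated by `d` and, inductively, have the same projection. The hypothesis
takes `φ = ψ a` as an equation between sections, so no quaternionic structure on `ker D` is needed.
-/
theorem IsProlongation.quatLinear {𝒱 : JetComplex D} {P : ∀ n, D.H0 →ₗ[ℝ] Sec (𝒱.E n)}
    (hP : IsProlongation 𝒱 P) {q : QuatStr V} (R : QuatJetStr 𝒱 q) {a : ℍ[ℝ]} {ψ φ : D.H0}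
    (h : (φ : Sec V) = (q.rmul a).app (ψ : Sec V)) (n : ℕ) :
    P n φ = ((R.str n).rmul a).app (P n ψ) := by
  induction n with
  | zero => rw [hP.1, h, hP.1, R.str_zero]
  | succ n ih =>
    have h1 : ∀ φ x, 𝒱.pr n x (P (n + 1) φ x) = P n φ x := fun φ x =>
      congrArg (fun s : Sec (𝒱.E n) => s x) (hP.2.1 n φ)
    refine 𝒱.eq_of_pr_of_d (fun x => ?_) fun x X => ?_
    · rw [BundleHom.app_apply, R.pr_linear, h1, h1, ih, BundleHom.app_apply]
    · rw [R.d_linear, hP.2.2, hP.2.2, map_zero]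

variable [T2Space M] [SigmaCompactSpace M]

theorem JetComplex.isOneJet_zero_right (𝒱 : JetComplex D) {n : ℕ} {φ : Sec (𝒱.E (n + 1))}
    (h : ∀ x X, 𝒱.d n φ x X = 0) : 𝒱.IsOneJet (n + 1) φ 0 := by
  refine ⟨fun x X => by rw [h, BundleHom.zero_apply, map_zero], fun X Y x => ?_⟩
  have h1 : ∀ Z : Sec (TM M), (0 : OneForm (𝒱.E (n + 1))).app Z = 0 := fun _ => rfl
  rw [RealOp.extDeriv, h1, h1, RealOp.map_zero, RealOp.map_zero, BundleHom.zero_apply, map_zero,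
    sub_zero, sub_zero]

/-- For holomorphic `ψ` the pair `(ψ, 0)` is admissible at the bottom, since `D ψ = 0`. The
resulting section is annihilated by `d`, so paired with `0` it is admissible again. Uniqueness of
each solution gives linearity. -/
theorem IsProlongation.existsUnique (𝒱 : JetComplex D) :
    ∃! P : ∀ n, D.H0 →ₗ[ℝ] Sec (𝒱.E n), IsProlongation 𝒱 P := by
  obtain ⟨P, hP0, -, hP⟩ := exists_seq_of_step (α := fun n => D.H0 →ₗ[ℝ] Sec (𝒱.E n))
    (P := fun n P => ∀ ψ, 𝒱.IsOneJet n (P ψ) 0)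
    (Q := fun n P P' => (∀ ψ, (𝒱.pr n).app (P' ψ) = P ψ) ∧ ∀ ψ x X, 𝒱.d n (P' ψ) x X = 0)
    (a₀ := D.H0.subtype) (fun ψ x X => by
      rw [BundleHom.zero_apply, BundleHom.zero_apply, map_zero, add_zero, smul_zero]
      exact ψ.2 x X) (by
      intro n P hP
      choose L hL1 hL2 using fun ψ => 𝒱.exists_of_isOneJet (hP ψ)
      have hL1' : ∀ ψ x, 𝒱.pr n x (L ψ x) = P ψ x := fun ψ x =>
        congrArg (fun s : Sec (𝒱.E n) => s x) (hL1 ψ)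
      have hL2' : ∀ ψ x X, 𝒱.d n (L ψ) x X = 0 := hL2
      refine ⟨{ toFun := L, map_add' := fun ψ φ => ?_, map_smul' := fun c ψ => ?_ },
        fun ψ => 𝒱.isOneJet_zero_right (hL2' ψ), hL1, hL2'⟩
      · refine 𝒱.eq_of_pr_of_d (fun x => ?_) fun x X => ?_
        · rw [Sec.add_apply, map_add, hL1', hL1', hL1', map_add, Sec.add_apply]
        · rw [RealOp.map_add, hL2', hL2', hL2', add_zero]
      · refine 𝒱.eq_of_pr_of_d (fun x => ?_) fun x X => ?_
        · rw [RingHom.id_apply, Sec.smul_apply, map_smul, hL1', hL1', map_smul, Sec.smul_apply]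
        · rw [RingHom.id_apply, RealOp.map_smul, hL2', hL2', smul_zero])
  refine ⟨P, ⟨fun ψ => by rw [hP0]; rfl, fun n => (hP n).1, fun n => (hP n).2⟩, fun P' hP' => ?_⟩
  funext n
  induction n with
  | zero =>
    ext1 ψ
    rw [hP0]
    exact hP'.1 ψ
  | succ n ih =>
    ext1 ψ
    refine 𝒱.eq_of_pr_of_d (fun x => ?_) fun x X => ?_
    · have h1 := congrArg (fun s : Sec (𝒱.E n) => s x) (hP'.2.1 n ψ)
      have h2 := congrArg (fun s : Sec (𝒱.E n) => s x) ((hP n).1 ψ)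
      rw [← ih] at h2
      exact h1.trans h2.symm
    · rw [hP'.2.2, (hP n).2]

end Prolongation

/-! ### `K`- and `K̄`-parts of operators. -/

section Parts

variable {M : Type u} [TopologicalSpace M] [ChartedSpace (EuclideanSpace ℝ (Fin 2)) M]
  [IsManifold (𝓡 2) ∞ M] {JM : ComplexStr (TM M)}
  {V : SmoothVB.{u, v} M} {W : SmoothVB.{u, w} M} {S : ComplexStr W} {L : RealOp V W}

namespace RealOp

theorem kPart_add_kbarPart (ψ : Sec V) (x : M) (X : (TM M).fiber x) :
    L.kPart JM S ψ x X + L.kbarPart JM S ψ x X = L ψ x X := by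
  rw [kPart, kbarPart]
  module

theorem kPart_JM (ψ : Sec V) (x : M) (X : (TM M).fiber x) :
    L.kPart JM S ψ x (JM x X) = S x (L.kPart JM S ψ x X) := by
  rw [kPart, kPart, JM.sq, _root_.map_neg, _root_.map_neg, _root_.map_smul, _root_.map_sub, S.sq]
  module

theorem kbarPart_JM (ψ : Sec V) (x : M) (X : (TM M).fiber x) :
    L.kbarPart JM S ψ x (JM x X) = -S x (L.kbarPart JM S ψ x X) := by
  rw [kbarPart, kbarPart, JM.sq, _root_.map_neg, _root_.map_neg, _root_.map_smul, _root_.map_add, S.sq]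
  module

theorem kPart_add (ψ φ : Sec V) (x : M) (X : (TM M).fiber x) :
    L.kPart JM S (ψ + φ) x X = L.kPart JM S ψ x X + L.kPart JM S φ x X := by
  rw [kPart, kPart, kPart, L.map_add, L.map_add, _root_.map_add]
  module

theorem kbarPart_add (ψ φ : Sec V) (x : M) (X : (TM M).fiber x) :
    L.kbarPart JM S (ψ + φ) x X = L.kbarPart JM S ψ x X + L.kbarPart JM S φ x X := by
  rw [kbarPart, kbarPart, kbarPart, L.map_add, L.map_add, _root_.map_add]
  module

theorem kbarPart_smul (c : ℝ) (ψ : Sec V) (x : M) (X : (TM M).fiber x) :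
    L.kbarPart JM S (c • ψ) x X = c • L.kbarPart JM S ψ x X := by
  rw [kbarPart, kbarPart, L.map_smul, L.map_smul, _root_.map_smul]
  module

theorem kPart_sub (ψ φ : Sec V) (x : M) (X : (TM M).fiber x) :
    L.kPart JM S (ψ - φ) x X = L.kPart JM S ψ x X - L.kPart JM S φ x X := by
  rw [kPart, kPart, kPart, L.map_sub, L.map_sub, _root_.map_sub]
  module

theorem kbarPart_sub (ψ φ : Sec V) (x : M) (X : (TM M).fiber x) :
    L.kbarPart JM S (ψ - φ) x X = L.kbarPart JM S ψ x X - L.kbarPart JM S φ x X := by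
  rw [kbarPart, kbarPart, kbarPart, L.map_sub, L.map_sub, _root_.map_sub]
  module

theorem kPart_neg (ψ : Sec V) (x : M) (X : (TM M).fiber x) :
    L.kPart JM S (-ψ) x X = -L.kPart JM S ψ x X := by
  rw [kPart, kPart, L.map_neg, L.map_neg, _root_.map_neg]
  module

theorem kPart_eq_of_kType {ψ : Sec V} {x : M} {X : (TM M).fiber x}
    (h : L ψ x (JM x X) = S x (L ψ x X)) : L.kPart JM S ψ x X = L ψ x X := by
  rw [kPart, h, S.sq]
  module

theorem kbarPart_eq_of_kType {ψ : Sec V} {x : M} {X : (TM M).fiber x}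
    (h : L ψ x (JM x X) = S x (L ψ x X)) : L.kbarPart JM S ψ x X = 0 := by
  rw [kbarPart, h, S.sq]
  module

section

variable [T2Space M] [SigmaCompactSpace M]

variable (JM S L) in
/-- The `K`-part as a smooth 1-form. -/
def kPartForm (ψ : Sec V) : OneForm W :=
  (1 / 2 : ℝ) • (L ψ - S.toBundleHom.comp ((L ψ).comp JM.toBundleHom))

variable (JM S L) in
/-- The `K̄`-part as a smooth 1-form. -/
def kbarPartForm (ψ : Sec V) : OneForm W :=
  (1 / 2 : ℝ) • (L ψ + S.toBundleHom.comp ((L ψ).comp JM.toBundleHom))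

theorem eq_of_apply_eq (hL : ∀ (f : C^∞⟮𝓡 2, M; ℝ⟯) ψ x X, L (ψ.fsmul f) x X = f x • L ψ x X)
    {ψ φ : Sec V} {x : M} (h : ψ x = φ x) (X : (TM M).fiber x) : L ψ x X = L φ x X := by
  obtain ⟨X, rfl⟩ := Sec.exists_apply_eq (TM M) x X
  have h1 : IsFunLinear fun ψ => (L ψ).app X :=
    ⟨fun ψ φ => by ext y; exact L.map_add ψ φ y (X y), fun f ψ => by ext y; exact hL f ψ y (X y)⟩
  exact h1.congr_apply h

end

end RealOp

end Parts

/-! ### The canonical complex structure. -/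

section ComplexStructures

variable {M : Type u} [TopologicalSpace M] [ChartedSpace (EuclideanSpace ℝ (Fin 2)) M]
  [IsManifold (𝓡 2) ∞ M] {JM : ComplexStr (TM M)}
  {V : SmoothVB.{u, v} M} {J : ComplexStr V} {D : HolStr JM J} {𝒱 : JetComplex D} {n : ℕ}

namespace JetComplex

section

variable {S : ComplexStr (𝒱.E n)}

theorem pr_kPart {S' : ComplexStr (𝒱.E (n + 1))}
    (h : ∀ x z, 𝒱.pr n x (S' x z) = S x (𝒱.pr n x z)) (ψ : Sec (𝒱.E (n + 2))) (x : M)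
    (X : (TM M).fiber x) : 𝒱.pr n x ((𝒱.d (n + 1)).kPart JM S' ψ x X) =
      (𝒱.d n).kPart JM S ((𝒱.pr (n + 1)).app ψ) x X := by
  rw [RealOp.kPart, RealOp.kPart, map_smul, map_sub, h, 𝒱.pr_d, 𝒱.pr_d]

theorem pr_kbarPart {S' : ComplexStr (𝒱.E (n + 1))}
    (h : ∀ x z, 𝒱.pr n x (S' x z) = S x (𝒱.pr n x z)) (ψ : Sec (𝒱.E (n + 2))) (x : M)
    (X : (TM M).fiber x) : 𝒱.pr n x ((𝒱.d (n + 1)).kbarPart JM S' ψ x X) =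
      (𝒱.d n).kbarPart JM S ((𝒱.pr (n + 1)).app ψ) x X := by
  rw [RealOp.kbarPart, RealOp.kbarPart, map_smul, map_add, h, 𝒱.pr_d, 𝒱.pr_d]

variable (hS : ∀ x (z : 𝒱.N n x), S x z = (𝒱.JN n x z : (𝒱.E n).fiber x))

include hS

theorem d_JM_eq {ψ : Sec (𝒱.E (n + 1))} (h : ∀ y, ψ y ∈ 𝒱.N (n + 1) y) (x : M)
    (X : (TM M).fiber x) : 𝒱.d n ψ x (JM x X) = S x (𝒱.d n ψ x X) :=
  (𝒱.d_JM h x X).trans (hS x ⟨_, 𝒱.d_mem h x X⟩).symm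

/-- On sections of `N_{n+1}` the operator `d` already has type `K`, so `d' = d` there and `d'`
detects sections of the kernel just as `d` does. -/
theorem eq_of_pr_of_kPart {ψ φ : Sec (𝒱.E (n + 1))}
    (h1 : ∀ x, 𝒱.pr n x (ψ x) = 𝒱.pr n x (φ x))
    (h2 : ∀ x X, (𝒱.d n).kPart JM S ψ x X = (𝒱.d n).kPart JM S φ x X) : ψ = φ := by
  ext x
  obtain ⟨X, hX⟩ := exists_tangent_ne_zero x
  have h3 : ∀ y, (ψ - φ) y ∈ 𝒱.N (n + 1) y := fun y => by
    change 𝒱.pr n y (ψ y - φ y) = 0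
    rw [map_sub, h1, sub_self]
  rw [← sub_eq_zero, ← Sec.sub_apply]
  refine 𝒱.eq_zero_of_d_eq_zero h3 hX ?_
  rw [← RealOp.kPart_eq_of_kType (d_JM_eq hS h3 x X), RealOp.kPart_sub, h2, sub_self]

variable [T2Space M] [SigmaCompactSpace M]

/-- In contrast to prescribing all of `d ψ`, no closedness is required: the error `η - d' ψ₀` of a
lift has type `K` automatically, and only its values must lie in `N_n`. -/
theorem exists_of_kPart {φ : Sec (𝒱.E n)} {η : OneForm (𝒱.E n)}
    (hη : ∀ x X, η x (JM x X) = S x (η x X))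
    (hN : ∀ ψ, (𝒱.pr n).app ψ = φ → ∀ x X, η x X - (𝒱.d n).kPart JM S ψ x X ∈ 𝒱.N n x) :
    ∃ ψ, (𝒱.pr n).app ψ = φ ∧ ∀ x X, (𝒱.d n).kPart JM S ψ x X = η x X := by
  set ψ₀ := (𝒱.lift n).app φ
  have hψ₀ : (𝒱.pr n).app ψ₀ = φ := 𝒱.pr_app_lift φ
  obtain ⟨χ, hχ, hdχ⟩ := 𝒱.exists_d_eq_of_kType (η - (𝒱.d n).kPartForm JM S ψ₀)
    (hN ψ₀ hψ₀) (fun x X => by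
      rw [← hS]
      change η x (JM x X) - (𝒱.d n).kPart JM S ψ₀ x (JM x X) =
        S x (η x X - (𝒱.d n).kPart JM S ψ₀ x X)
      rw [hη, RealOp.kPart_JM, map_sub])
  have hprχ : ∀ x, 𝒱.pr n x (χ x) = 0 := hχ
  refine ⟨ψ₀ + χ, ?_, fun x X => ?_⟩
  · ext x
    rw [BundleHom.app_apply, Sec.add_apply, map_add, hprχ, add_zero]
    exact 𝒱.pr_lift x (φ x)
  · rw [RealOp.kPart_add, RealOp.kPart_eq_of_kType (d_JM_eq hS hχ x X), hdχ]
    exact add_sub_cancel _ _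

/-- The extension of a complex structure commuting with `d'` by one step. -/
theorem exists_complexStr_succ
    (hb : ∀ ψ φ : Sec (𝒱.E (n + 1)), (∀ x, 𝒱.pr n x (φ x) = S x (𝒱.pr n x (ψ x))) →
      ∀ x X, S x ((𝒱.d n).kPart JM S ψ x X) - (𝒱.d n).kPart JM S φ x X ∈ 𝒱.N n x) :
    ∃ S' : ComplexStr (𝒱.E (n + 1)), (∀ x z, 𝒱.pr n x (S' x z) = S x (𝒱.pr n x z)) ∧
      (∀ x (z : 𝒱.N (n + 1) x), S' x z = (𝒱.JN (n + 1) x z : (𝒱.E (n + 1)).fiber x)) ∧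
      ∀ ψ x X, (𝒱.d n).kPart JM S (S'.app ψ) x X = S x ((𝒱.d n).kPart JM S ψ x X) := by
  -- The section called `ψ'` here is to be `S' ψ`; the two equations are forced by `π S' = S π` and
  -- `d' S' = S d'`, and they determine it.
  have hex : ∀ ψ : Sec (𝒱.E (n + 1)), ∃ ψ', (𝒱.pr n).app ψ' = S.app ((𝒱.pr n).app ψ) ∧
      ∀ x X, (𝒱.d n).kPart JM S ψ' x X = S x ((𝒱.d n).kPart JM S ψ x X) := fun ψ =>
    exists_of_kPart (η := S.toBundleHom.comp ((𝒱.d n).kPartForm JM S ψ)) hS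
      (fun x X => congrArg (S x) (RealOp.kPart_JM ψ x X))
      (fun φ hφ => hb ψ φ fun x => congrArg (fun s : Sec (𝒱.E n) => s x) hφ)
  choose L hL1 hL2 using hex
  have hL1' : ∀ ψ x, 𝒱.pr n x (L ψ x) = S x (𝒱.pr n x (ψ x)) := fun ψ x =>
    congrArg (fun s : Sec (𝒱.E n) => s x) (hL1 ψ)
  have hleib : ∀ (f : C^∞⟮𝓡 2, M; ℝ⟯) ψ x X, (𝒱.d n).kPart JM S (ψ.fsmul f) x X =
      f x • (𝒱.d n).kPart JM S ψ x X + (1 / 2 : ℝ) • (dfun f x X • 𝒱.pr n x (ψ x) -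
        dfun f x (JM x X) • S x (𝒱.pr n x (ψ x))) := fun f ψ x X => by
    rw [RealOp.kPart, RealOp.kPart, 𝒱.d_leibniz, 𝒱.d_leibniz, map_add, map_smul, map_smul]
    module
  have hlin : IsFunLinear L := by
    refine ⟨fun ψ φ => eq_of_pr_of_kPart hS (fun x => ?_) fun x X => ?_,
      fun f ψ => eq_of_pr_of_kPart hS (fun x => ?_) fun x X => ?_⟩
    · simp only [Sec.add_apply, map_add, hL1']
    · rw [hL2, RealOp.kPart_add, RealOp.kPart_add, hL2, hL2, map_add]
    · simp only [Sec.fsmul_apply, map_smul, hL1']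
    · rw [hL2, hleib, hleib, hL2, hL1', S.sq, map_add, map_smul, map_smul, map_sub, map_smul,
        map_smul, S.sq]
  obtain ⟨T, hT⟩ := hlin.exists_bundleHom
  have hTL : ∀ (ψ : Sec (𝒱.E (n + 1))) x, T x (ψ x) = L ψ x := fun ψ x => by
    rw [← hT, BundleHom.app_apply]
  have hsq : ∀ ψ, L (L ψ) = -ψ := fun ψ => by
    refine eq_of_pr_of_kPart hS (fun x => ?_) fun x X => ?_
    · rw [hL1', hL1', S.sq, Sec.neg_apply, map_neg]
    · rw [hL2, hL2, S.sq, RealOp.kPart_neg]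
  refine ⟨⟨T, fun x z => ?_⟩, fun x z => ?_, fun x z => ?_, fun ψ x X => ?_⟩
  · obtain ⟨ψ, rfl⟩ := Sec.exists_apply_eq _ x z
    change T x (T x (ψ x)) = _
    rw [hTL, hTL, hsq, Sec.neg_apply]
  · obtain ⟨ψ, rfl⟩ := Sec.exists_apply_eq _ x z
    change 𝒱.pr n x (T x (ψ x)) = _
    rw [hTL, hL1']
  · obtain ⟨z, hz⟩ := z
    obtain ⟨ψ, rfl, hψ⟩ := 𝒱.exists_section_N z hz
    set φ : Sec (𝒱.E (n + 1)) := ⟨_, 𝒱.JN_smooth (n + 1) ψ hψ⟩ with hφ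
    have hφN : ∀ y, φ y ∈ 𝒱.N (n + 1) y := fun y => Subtype.coe_prop _
    -- For `ψ` in `N_{n+1}` the section `J_{n+1} ψ` satisfies the defining equations of `L ψ`, by
    -- complex linearity of `δ`.
    have h1 : L ψ = φ := by
      refine eq_of_pr_of_kPart hS (fun y => ?_) fun y X => ?_
      · rw [hL1', show 𝒱.pr n y (ψ y) = 0 from hψ y, map_zero]
        exact (hφN y).symm
      · rw [hL2, RealOp.kPart_eq_of_kType (d_JM_eq hS hφN y X),
          RealOp.kPart_eq_of_kType (d_JM_eq hS hψ y X), 𝒱.d_eq_delta hφN, 𝒱.d_eq_delta hψ, hS,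
          ← 𝒱.delta_J]
        rfl
    change T x (ψ x) = _
    rw [hTL, h1]
    rfl
  · change (𝒱.d n).kPart JM S (T.app ψ) x X = _
    rw [hT, hL2]

end

end JetComplex

variable [T2Space M] [SigmaCompactSpace M]

theorem AdaptedCS.ext {A A' : AdaptedCS 𝒱} (h : ∀ n, A.S n = A'.S n) : A = A' := by
  obtain ⟨A, _⟩ := A
  obtain ⟨A', _⟩ := A'
  obtain rfl : A = A' := funext h
  rfl

variable (𝒱) in
-- The recursion carries, besides `S = J_n` on `N_n`, the solvability condition: `S d' ψ - d' φ` is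
-- `N_n`-valued whenever `π φ = S π ψ`. At the bottom it is void because `N_0 = V_0`; at the next
-- level it follows by projecting and using `d' S = S d'` one level down.
theorem AdaptedCS.existsUnique : ∃! A : AdaptedCS 𝒱, A.CommutesWithKPart := by
  obtain ⟨S, -, hS, hQ⟩ := exists_seq_of_step (α := fun n => ComplexStr (𝒱.E n))
    (P := fun n S => (∀ x (z : 𝒱.N n x), S x z = (𝒱.JN n x z : (𝒱.E n).fiber x)) ∧
      ∀ ψ φ : Sec (𝒱.E (n + 1)), (∀ x, 𝒱.pr n x (φ x) = S x (𝒱.pr n x (ψ x))) →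
      ∀ x X, S x ((𝒱.d n).kPart JM S ψ x X) - (𝒱.d n).kPart JM S φ x X ∈ 𝒱.N n x)
    (Q := fun n S S' => (∀ x z, 𝒱.pr n x (S' x z) = S x (𝒱.pr n x z)) ∧
      ∀ ψ x X, (𝒱.d n).kPart JM S (S'.app ψ) x X = S x ((𝒱.d n).kPart JM S ψ x X))
    (a₀ := J) ⟨fun x z => (𝒱.JN_zero x z).symm, fun _ _ _ _ _ => Submodule.mem_top⟩ (by
      rintro n S ⟨hS, hb⟩
      obtain ⟨S', h1, h2, h3⟩ := JetComplex.exists_complexStr_succ hS hb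
      refine ⟨S', ⟨h2, fun ψ φ hφ x X => ?_⟩, h1, h3⟩
      change 𝒱.pr n x (S' x ((𝒱.d (n + 1)).kPart JM S' ψ x X) -
        (𝒱.d (n + 1)).kPart JM S' φ x X) = 0
      rw [map_sub, h1, JetComplex.pr_kPart h1, JetComplex.pr_kPart h1, ← h3, sub_eq_zero]
      congr 1
      ext y
      exact (hφ y).symm)
  refine ⟨⟨S, fun n => (hQ n).1, fun n => (hS n).1⟩, fun n => (hQ n).2, fun A hA => ?_⟩
  refine AdaptedCS.ext fun n => ?_
  change A.S n = S n
  induction n with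
  | zero =>
    refine ComplexStr.ext fun x z => ?_
    exact (A.S_ker 0 x ⟨z, Submodule.mem_top⟩).trans ((hS 0).1 x ⟨z, Submodule.mem_top⟩).symm
  | succ n ih =>
    refine ComplexStr.ext fun x z => ?_
    obtain ⟨ψ, rfl⟩ := Sec.exists_apply_eq _ x z
    have h1 : (A.S (n + 1)).app ψ = (S (n + 1)).app ψ := by
      refine JetComplex.eq_of_pr_of_kPart (hS n).1 (fun y => ?_) fun y X => ?_
      · exact (A.pr_S n y (ψ y)).trans (by rw [ih]; exact ((hQ n).1 y (ψ y)).symm)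
      · rw [(hQ n).2, ← ih]
        exact hA n ψ y X
    exact congrArg (fun s : Sec (𝒱.E (n + 1)) => s x) h1

/-- If `T` is complex linear on `V_n`, it intertwines the operators `d'` on `V_{n+1}`. Then `T S ψ`
and `S T ψ` have the same `π` and the same `d'`, so they agree. -/
theorem IsJetMap.commutes_complexStr {V' : SmoothVB.{u, w} M} {J' : ComplexStr V'}
    {D' : HolStr JM J'} {𝒱' : JetComplex D'} {T : ∀ n, BundleHom (𝒱.E n) (𝒱'.E n)}
    (hT : IsJetMap T) {A : AdaptedCS 𝒱} {A' : AdaptedCS 𝒱'} (hA : A.CommutesWithKPart)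
    (hA' : A'.CommutesWithKPart) (h0 : ∀ x z, T 0 x (A.S 0 x z) = A'.S 0 x (T 0 x z)) (n : ℕ)
    (x : M) (z : (𝒱.E n).fiber x) : T n x (A.S n x z) = A'.S n x (T n x z) := by
  induction n generalizing x with
  | zero => exact h0 x z
  | succ n ih =>
    have hK : ∀ ψ y X, (𝒱'.d n).kPart JM (A'.S n) ((T (n + 1)).app ψ) y X =
        T n y ((𝒱.d n).kPart JM (A.S n) ψ y X) := fun ψ y X => by
      rw [RealOp.kPart, RealOp.kPart, ← hT.map_d, ← hT.map_d, map_smul, map_sub, ih]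
    obtain ⟨ψ, rfl⟩ := Sec.exists_apply_eq _ x z
    have h1 : (T (n + 1)).app ((A.S (n + 1)).app ψ) = (A'.S (n + 1)).app ((T (n + 1)).app ψ) := by
      refine JetComplex.eq_of_pr_of_kPart (A'.S_ker n) (fun y => ?_) fun y X => ?_
      · simp only [BundleHom.app_apply, A'.pr_S, ← hT.map_pr, A.pr_S, ih]
      · rw [hK, hA, hA', ih, hK]
    exact congrArg (fun s : Sec (𝒱'.E (n + 1)) => s x) h1

end ComplexStructures

/-! ### Linearity of the action on sections. -/

section Sections

variable {M : Type u} [TopologicalSpace M] [ChartedSpace (EuclideanSpace ℝ (Fin 2)) M]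
  {V : SmoothVB.{u, v} M} {W : SmoothVB.{u, w} M}

namespace BundleHom

variable (T : BundleHom V W)

theorem app_add (ψ φ : Sec V) : T.app (ψ + φ) = T.app ψ + T.app φ := by
  ext x
  exact map_add (T x) _ _

theorem app_smul (c : ℝ) (ψ : Sec V) : T.app (c • ψ) = c • T.app ψ := by
  ext x
  exact map_smul (T x) _ _

theorem app_fsmul (f : C^∞⟮𝓡 2, M; ℝ⟯) (ψ : Sec V) : T.app (ψ.fsmul f) = (T.app ψ).fsmul f := by
  ext x
  exact map_smul (T x) _ _

end BundleHom

end Sections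

/-! ### The flag `F_k` and the action of `d` and `d''` on it. -/

section Flags

variable {M : Type u} [TopologicalSpace M] [ChartedSpace (EuclideanSpace ℝ (Fin 2)) M]
  [IsManifold (𝓡 2) ∞ M] {JM : ComplexStr (TM M)}
  {V : SmoothVB.{u, v} M} {J : ComplexStr V} {D : HolStr JM J} {𝒱 : JetComplex D}

namespace JetComplex

theorem flag_eq_top {n k : ℕ} (h : n ≤ k) (x : M) : 𝒱.flag n k x = ⊤ := by
  induction n generalizing k with
  | zero => rfl
  | succ n ih =>
    obtain ⟨k, rfl⟩ : ∃ l, k = l + 1 := ⟨k - 1, by omega⟩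
    change (𝒱.flag n k x).comap _ = ⊤
    rw [ih (by omega), Submodule.comap_top]

theorem flag_mono (n : ℕ) (x : M) : Monotone fun k => 𝒱.flag n k x := by
  refine monotone_nat_of_le_succ fun k => ?_
  induction n generalizing k with
  | zero => exact le_rfl
  | succ n ih =>
    cases k with
    | zero => exact LinearMap.ker_le_comap _
    | succ k => exact Submodule.comap_mono (ih k)

theorem kbarPart_eq_zero_of_mem {A : AdaptedCS 𝒱} {n : ℕ} {ψ : Sec (𝒱.E (n + 1))}
    (h : ∀ y, ψ y ∈ 𝒱.N (n + 1) y) (x : M) (X : (TM M).fiber x) :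
    (𝒱.d n).kbarPart JM (A.S n) ψ x X = 0 :=
  RealOp.kbarPart_eq_of_kType (d_JM_eq (A.S_ker n) h x X)

/-- `d''` maps sections of `F_{k+1}` to forms with values in `F_k`. -/
theorem kbarPart_mem_flag (A : AdaptedCS 𝒱) {n k : ℕ} {ψ : Sec (𝒱.E (n + 1))}
    (h : ∀ y, ψ y ∈ 𝒱.flag (n + 1) (k + 1) y) (x : M) (X : (TM M).fiber x) :
    (𝒱.d n).kbarPart JM (A.S n) ψ x X ∈ 𝒱.flag n k x := by
  induction n generalizing k with
  | zero => exact Submodule.mem_top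
  | succ n ih =>
    cases k with
    | zero =>
      change 𝒱.pr n x _ = 0
      rw [pr_kbarPart (A.pr_S n)]
      exact kbarPart_eq_zero_of_mem (fun y => h y) x X
    | succ k =>
      change 𝒱.pr n x _ ∈ 𝒱.flag n k x
      rw [pr_kbarPart (A.pr_S n)]
      exact ih fun y => h y

variable [T2Space M] [SigmaCompactSpace M]

theorem exists_section_flag {n k : ℕ} {x : M} {z : (𝒱.E n).fiber x} (hz : z ∈ 𝒱.flag n k x) :
    ∃ ψ : Sec (𝒱.E n), ψ x = z ∧ ∀ y, ψ y ∈ 𝒱.flag n k y := by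
  induction n generalizing k with
  | zero =>
    obtain ⟨ψ, rfl⟩ := Sec.exists_apply_eq _ x z
    exact ⟨ψ, rfl, fun y => Submodule.mem_top⟩
  | succ n ih =>
    cases k with
    | zero => exact 𝒱.exists_section_N z hz
    | succ k =>
      obtain ⟨χ, h1, h2⟩ := ih (show 𝒱.pr n x z ∈ 𝒱.flag n k x from hz)
      obtain ⟨ψ, rfl⟩ := Sec.exists_apply_eq _ x z
      refine ⟨(𝒱.lift n).app χ + (ψ - (𝒱.lift n).app ((𝒱.pr n).app ψ)), ?_, fun y => ?_⟩
      · simp [h1]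
      · change 𝒱.pr n y _ ∈ 𝒱.flag n k y
        have h3 : 𝒱.pr n y (𝒱.lift n y (χ y) + (ψ y - 𝒱.lift n y (𝒱.pr n y (ψ y)))) = χ y := by
          rw [map_add, map_sub, pr_lift, pr_lift, sub_self, add_zero]
        exact (congrArg (· ∈ 𝒱.flag n k y) h3).mpr (h2 y)

/-- Values of `d` on sections of `F_{k+1}` represent all of `F_{k+1}` modulo `F_k`. -/
theorem exists_d_sub_mem_flag {n k : ℕ} {x : M} {X : (TM M).fiber x} (hX : X ≠ 0)
    {z : (𝒱.E n).fiber x} (hz : z ∈ 𝒱.flag n (k + 1) x) :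
    ∃ ψ : Sec (𝒱.E (n + 1)), (∀ y, ψ y ∈ 𝒱.flag (n + 1) (k + 1) y) ∧
      𝒱.d n ψ x X - z ∈ 𝒱.flag n k x := by
  induction n generalizing k with
  | zero => exact ⟨0, fun y => Submodule.zero_mem _, Submodule.mem_top⟩
  | succ n ih =>
    -- It is enough to treat `π z` one level down, modulo `π (F_k)`: a lift of `χ` lies in
    -- `F_{k+1}`, and the remaining error lies in `N = F_0 ⊆ F_k`. For `k = 0` the required `χ`
    -- comes from surjectivity of `δ` followed by evaluation at `X`.
    suffices h : ∃ χ : Sec (𝒱.E (n + 1)), (∀ y, χ y ∈ 𝒱.flag (n + 1) k y) ∧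
        𝒱.d n χ x X - 𝒱.pr n x z ∈ (𝒱.flag (n + 1) k x).map (𝒱.pr n x) by
      obtain ⟨χ, h1, h2⟩ := h
      refine ⟨(𝒱.lift (n + 1)).app χ, fun y => ?_, ?_⟩
      · change 𝒱.pr (n + 1) y _ ∈ 𝒱.flag (n + 1) k y
        rw [BundleHom.app_apply, pr_lift]
        exact h1 y
      · obtain ⟨z', hz', h3⟩ := h2
        have h4 : 𝒱.d (n + 1) ((𝒱.lift (n + 1)).app χ) x X - z - z' ∈ 𝒱.flag (n + 1) k x := by
          refine flag_mono (n + 1) x (Nat.zero_le k) ?_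
          change 𝒱.pr n x _ = 0
          rw [map_sub, map_sub, 𝒱.pr_d, 𝒱.pr_app_lift, h3, sub_self]
        simpa using Submodule.add_mem _ h4 hz'
    cases k with
    | zero =>
      obtain ⟨y, hy⟩ := 𝒱.exists_delta_apply_eq hX ⟨𝒱.pr n x z, hz⟩
      obtain ⟨χ, h1, h2⟩ := 𝒱.exists_section_N y.1 y.2
      refine ⟨χ, h2, 0, Submodule.zero_mem _, ?_⟩
      rw [map_zero, eq_comm, sub_eq_zero, 𝒱.d_eq_delta h2]
      have h3 : (⟨χ x, h2 x⟩ : 𝒱.N (n + 1) x) = y := Subtype.ext h1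
      rw [h3, hy]
    | succ k =>
      obtain ⟨χ, h1, h2⟩ := ih (show 𝒱.pr n x z ∈ 𝒱.flag n (k + 1) x from hz)
      exact ⟨χ, h1, 𝒱.lift n x _, by
        change 𝒱.pr n x (𝒱.lift n x _) ∈ 𝒱.flag n k x
        rwa [pr_lift], pr_lift _ _ _⟩

end JetComplex

end Flags

/-! ### The commutator `[d, S]` and its `K`- and `K̄`-parts. -/

section Commutator

variable {M : Type u} [TopologicalSpace M] [ChartedSpace (EuclideanSpace ℝ (Fin 2)) M]
  [IsManifold (𝓡 2) ∞ M] [T2Space M] [SigmaCompactSpace M] {JM : ComplexStr (TM M)}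
  {V : SmoothVB.{u, v} M} {J : ComplexStr V} {D : HolStr JM J} {𝒱 : JetComplex D}

namespace AdaptedCS

variable (A : AdaptedCS 𝒱) (n : ℕ)

/-- The commutator `[d, S]`, a 1-form with values in `Hom(V_{n+1}, V_n)`. -/
def comm : RealOp (𝒱.E (n + 1)) (𝒱.E n) where
  toFun ψ := 𝒱.d n ((A.S (n + 1)).app ψ) - (A.S n).toBundleHom.comp (𝒱.d n ψ)
  map_add ψ φ x X := by
    have h1 : (A.S (n + 1)).app (ψ + φ) = (A.S (n + 1)).app ψ + (A.S (n + 1)).app φ :=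
      BundleHom.app_add _ _ _
    change 𝒱.d n ((A.S (n + 1)).app (ψ + φ)) x X - A.S n x (𝒱.d n (ψ + φ) x X) =
      𝒱.d n ((A.S (n + 1)).app ψ) x X - A.S n x (𝒱.d n ψ x X) +
      (𝒱.d n ((A.S (n + 1)).app φ) x X - A.S n x (𝒱.d n φ x X))
    rw [h1, RealOp.map_add, RealOp.map_add, map_add]
    abel
  map_smul c ψ x X := by
    have h1 : (A.S (n + 1)).app (c • ψ) = c • (A.S (n + 1)).app ψ := BundleHom.app_smul _ _ _
    change 𝒱.d n ((A.S (n + 1)).app (c • ψ)) x X - A.S n x (𝒱.d n (c • ψ) x X) =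
      c • (𝒱.d n ((A.S (n + 1)).app ψ) x X - A.S n x (𝒱.d n ψ x X))
    rw [h1, RealOp.map_smul, RealOp.map_smul, map_smul, smul_sub]

variable {n}

theorem comm_apply (ψ : Sec (𝒱.E (n + 1))) (x : M) (X : (TM M).fiber x) :
    A.comm n ψ x X = 𝒱.d n ((A.S (n + 1)).app ψ) x X - A.S n x (𝒱.d n ψ x X) := rfl

theorem comm_S (ψ : Sec (𝒱.E (n + 1))) (x : M) (X : (TM M).fiber x) :
    A.comm n ((A.S (n + 1)).app ψ) x X = -A.S n x (A.comm n ψ x X) := by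
  rw [comm_apply, comm_apply, ComplexStr.app_app, RealOp.map_neg, map_sub, ComplexStr.sq]
  abel

/-- The derivative terms in the Leibniz rule cancel because `π S = S π`, so `[d, S]` is a bundle
map. -/
theorem comm_congr {ψ φ : Sec (𝒱.E (n + 1))} {x : M} (h : ψ x = φ x) (X : (TM M).fiber x) :
    A.comm n ψ x X = A.comm n φ x X := by
  refine RealOp.eq_of_apply_eq (fun f ψ x X => ?_) h X
  have h1 : (A.S (n + 1)).app (ψ.fsmul f) = ((A.S (n + 1)).app ψ).fsmul f :=
    BundleHom.app_fsmul _ _ _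
  rw [comm_apply, comm_apply, h1, 𝒱.d_leibniz, 𝒱.d_leibniz, BundleHom.app_apply,
    show 𝒱.pr n x ((A.S (n + 1)).toBundleHom x (ψ x)) = A.S n x (𝒱.pr n x (ψ x)) from
      A.pr_S n x _, map_add, map_smul, map_smul]
  module

theorem kPart_comm (ψ : Sec (𝒱.E (n + 1))) (x : M) (X : (TM M).fiber x) :
    (A.comm n).kPart JM (A.S n) ψ x X =
      (𝒱.d n).kPart JM (A.S n) ((A.S (n + 1)).app ψ) x X -
        A.S n x ((𝒱.d n).kPart JM (A.S n) ψ x X) := by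
  rw [RealOp.kPart, RealOp.kPart, RealOp.kPart, comm_apply, comm_apply, map_smul, map_sub, map_sub]
  module

theorem kbarPart_comm (ψ : Sec (𝒱.E (n + 1))) (x : M) (X : (TM M).fiber x) :
    (A.comm n).kbarPart JM (A.S n) ψ x X =
      (𝒱.d n).kbarPart JM (A.S n) ((A.S (n + 1)).app ψ) x X -
        A.S n x ((𝒱.d n).kbarPart JM (A.S n) ψ x X) := by
  rw [RealOp.kbarPart, RealOp.kbarPart, RealOp.kbarPart, comm_apply, comm_apply, map_smul, map_sub,
    map_add]
  module

theorem kbarPart_comm_congr {ψ φ : Sec (𝒱.E (n + 1))} {x : M} (h : ψ x = φ x)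
    (X : (TM M).fiber x) :
    (A.comm n).kbarPart JM (A.S n) ψ x X = (A.comm n).kbarPart JM (A.S n) φ x X := by
  rw [RealOp.kbarPart, RealOp.kbarPart, A.comm_congr h, A.comm_congr h]

/-- On `N_{n+1}` the commutator vanishes by complex linearity of `δ`. -/
theorem comm_eq_zero_of_mem {ψ : Sec (𝒱.E (n + 1))} {x : M} (h : ψ x ∈ 𝒱.N (n + 1) x)
    (X : (TM M).fiber x) : A.comm n ψ x X = 0 := by
  obtain ⟨φ, h1, h2⟩ := 𝒱.exists_section_N _ h
  have h3 : ∀ y, (A.S (n + 1)).app φ y ∈ 𝒱.N (n + 1) y := fun y => by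
    change A.S (n + 1) y (φ y) ∈ _
    rw [A.S_ker (n + 1) y ⟨φ y, h2 y⟩]
    exact Subtype.coe_prop _
  rw [A.comm_congr h1.symm, comm_apply, 𝒱.d_eq_delta h3, 𝒱.d_eq_delta h2, A.S_ker,
    ← 𝒱.delta_J, sub_eq_zero]
  have h4 : (⟨(A.S (n + 1)).app φ x, h3 x⟩ : 𝒱.N (n + 1) x) = 𝒱.JN (n + 1) x ⟨φ x, h2 x⟩ :=
    Subtype.ext (A.S_ker (n + 1) x ⟨φ x, h2 x⟩)
  rw [h4]

theorem pr_comm (ψ : Sec (𝒱.E (n + 2))) (x : M) (X : (TM M).fiber x) :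
    𝒱.pr n x (A.comm (n + 1) ψ x X) = A.comm n ((𝒱.pr (n + 1)).app ψ) x X := by
  have h1 : (𝒱.pr (n + 1)).app ((A.S (n + 2)).app ψ) =
      (A.S (n + 1)).app ((𝒱.pr (n + 1)).app ψ) := by
    ext y; exact A.pr_S (n + 1) y _
  rw [comm_apply, comm_apply, map_sub, A.pr_S, 𝒱.pr_d, 𝒱.pr_d, h1]

/-- Combining `d d = 0` for `S ψ` and for `ψ` cancels all second derivatives and leaves `[d, S]_{J
X} (d_X ψ) - [d, S]_X (d_{J X} ψ)`. With `a = d'_X ψ` and `b = d''_X ψ` one has `d_X ψ = a + b` and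
`d_{J X} ψ = S a - S b`. As `[d, S]` anticommutes with `S`, the terms in `a` combine to the `K`-part
and those in `b` to the `K̄`-part. -/
theorem extDeriv_comm (ψ : Sec (𝒱.E (n + 2))) (X : Sec (TM M)) (x : M) :
    (𝒱.d n).extDeriv (𝒱.pr n) (A.comm (n + 1) ψ) X (JM.app X) x =
      (2 : ℝ) • A.S n x ((A.comm n).kPart JM (A.S n)
        (((𝒱.d (n + 1)).kPartForm JM (A.S (n + 1)) ψ).app X) x (X x)) -
      (2 : ℝ) • A.S n x ((A.comm n).kbarPart JM (A.S n)
        (((𝒱.d (n + 1)).kbarPartForm JM (A.S (n + 1)) ψ).app X) x (X x)) := by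
  set Y := JM.app X with hY
  set a := ((𝒱.d (n + 1)).kPartForm JM (A.S (n + 1)) ψ).app X
  set b := ((𝒱.d (n + 1)).kbarPartForm JM (A.S (n + 1)) ψ).app X
  have hX : (𝒱.d (n + 1) ψ).app X = a + b := by
    ext y
    exact (RealOp.kPart_add_kbarPart ψ y (X y)).symm
  have hYd : (𝒱.d (n + 1) ψ).app Y = (A.S (n + 1)).app a - (A.S (n + 1)).app b := by
    ext y
    change 𝒱.d (n + 1) ψ y (JM y (X y)) =
      A.S (n + 1) y ((𝒱.d (n + 1)).kPart JM (A.S (n + 1)) ψ y (X y)) -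
        A.S (n + 1) y ((𝒱.d (n + 1)).kbarPart JM (A.S (n + 1)) ψ y (X y))
    rw [← RealOp.kPart_JM, sub_eq_add_neg, ← RealOp.kbarPart_JM, RealOp.kPart_add_kbarPart]
  have h1 := 𝒱.d_d n ((A.S (n + 2)).app ψ) X Y x
  have h2 := congrArg (A.S n x) (𝒱.d_d n ψ X Y x)
  have h3 : ∀ Z : Sec (TM M), (A.comm (n + 1) ψ).app Z =
    (𝒱.d (n + 1) ((A.S (n + 2)).app ψ)).app Z - (A.S (n + 1)).app ((𝒱.d (n + 1) ψ).app Z) :=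
    fun Z => rfl
  have h4 : ∀ (φ : Sec (𝒱.E (n + 1))) Z, 𝒱.d n ((A.S (n + 1)).app φ) x Z =
    A.comm n φ x Z + A.S n x (𝒱.d n φ x Z) := fun φ Z => by rw [comm_apply, sub_add_cancel]
  have h5 : (𝒱.d n).extDeriv (𝒱.pr n) (A.comm (n + 1) ψ) X Y x =
      A.comm n ((𝒱.d (n + 1) ψ).app X) x (Y x) - A.comm n ((𝒱.d (n + 1) ψ).app Y) x (X x) := by
    rw [map_sub, map_sub, map_zero, ← A.pr_S] at h2
    rw [RealOp.extDeriv, h3, h3, RealOp.map_sub, RealOp.map_sub, h4, h4,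
      A.comm_apply ψ, map_sub]
    linear_combination (norm := module) h1 - h2
  have h6 : Y x = JM x (X x) := rfl
  rw [h5, hX, hYd, RealOp.map_add, RealOp.map_sub, comm_S, comm_S, h6, RealOp.kPart,
    RealOp.kbarPart, map_smul, map_smul, map_add, map_sub, ComplexStr.sq, ComplexStr.sq]
  module

theorem kbarCommutatorVanishesOnFlag_iff : A.KbarCommutatorVanishesOnFlag ↔
    ∀ n (ψ : Sec (𝒱.E (n + 1))) x X, ψ x ∈ 𝒱.flag (n + 1) n x →
      (A.comm n).kbarPart JM (A.S n) ψ x X = 0 := by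
  simp only [kbarPart_comm]
  rfl

theorem commutesWithKPart_iff : A.CommutesWithKPart ↔
    ∀ n (ψ : Sec (𝒱.E (n + 1))) x X, (A.comm n).kPart JM (A.S n) ψ x X = 0 := by
  simp only [kPart_comm, sub_eq_zero]
  rfl

/-- Under the hypothesis `[d, S] = [d'', S]`, which has type `K̄`. For a section `φ` of `F_{n+1} ⊆
V_{n+2}` the form `[d, S] φ` is `N`-valued, by induction applied to `π φ`. In `extDeriv_comm` the
first term is zero by hypothesis and the second by induction, since `d'' φ` lies in `F_n`. Hence
`[d, S] φ` is closed and so also of type `K`, which kills its `K̄`-part. -/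
theorem kbarCommutatorVanishesOnFlag (h : A.CommutesWithKPart) :
    A.KbarCommutatorVanishesOnFlag := by
  rw [commutesWithKPart_iff] at h
  rw [kbarCommutatorVanishesOnFlag_iff]
  intro n
  induction n with
  | zero =>
    intro ψ x X hψ
    rw [RealOp.kbarPart, A.comm_eq_zero_of_mem hψ, A.comm_eq_zero_of_mem hψ, map_zero, add_zero,
      smul_zero]
  | succ n ih =>
    intro ψ x X hψ
    obtain ⟨φ, h1, h2⟩ := JetComplex.exists_section_flag hψ
    rw [A.kbarPart_comm_congr h1.symm]
    have h0 : ∀ m (ψ : Sec (𝒱.E (m + 1))) y Z,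
        A.comm m ψ y Z = (A.comm m).kbarPart JM (A.S m) ψ y Z := fun m ψ y Z => by
      conv_lhs => rw [← RealOp.kPart_add_kbarPart (JM := JM) (S := A.S m), h, zero_add]
    have hN : ∀ y Z, A.comm (n + 1) φ y Z ∈ 𝒱.N (n + 1) y := fun y Z => by
      change 𝒱.pr n y _ = 0
      rw [pr_comm, h0]
      exact ih _ _ _ (h2 y)
    have hK := 𝒱.kType_of_extDeriv_eq_zero _ hN (fun Z y => by
      rw [extDeriv_comm, h, ih, map_zero, smul_zero, sub_self]
      exact JetComplex.kbarPart_mem_flag A h2 y (Z y)) x X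
    rw [← A.S_ker] at hK
    rw [RealOp.kbarPart_eq_of_kType hK]

/-- One shows by induction on `k` that `[d', S]` vanishes on `F_k ⊆ V_{n+1}` for all `n`; the case
`k = n + 1` is everything. A vector of `F_{k+1}` is, modulo `F_k`, a value `d_X φ` with `φ` a
section of `F_{k+1} ⊆ V_{n+2}`. The form `[d, S] φ` is `N`-valued and of type `K`, therefore closed,
and since `d'' φ` lies in `F_k` the formula `extDeriv_comm` reduces to `[d', S]_X (d'_X φ) = 0`.
Replacing `d_X φ` by `d'_X φ` changes it only within `F_k`. -/
theorem commutesWithKPart (h : A.KbarCommutatorVanishesOnFlag) : A.CommutesWithKPart := by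
  rw [kbarCommutatorVanishesOnFlag_iff] at h
  rw [commutesWithKPart_iff]
  have key : ∀ k n (ψ : Sec (𝒱.E (n + 1))) x X, ψ x ∈ 𝒱.flag (n + 1) k x →
      (A.comm n).kPart JM (A.S n) ψ x X = 0 := by
    intro k
    induction k with
    | zero =>
      intro n ψ x X hψ
      rw [RealOp.kPart, A.comm_eq_zero_of_mem hψ, A.comm_eq_zero_of_mem hψ, map_zero, sub_zero,
        smul_zero]
    | succ k ih =>
      intro n ψ x X hψ
      -- For `k > n` the flag `F_k` is already all of `V_{n+1}`; otherwise `F_k ⊆ F_n`, where the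
      -- hypothesis on `[d'', S]` applies.
      rcases Nat.lt_or_ge n k with hk | hk
      · refine ih n ψ x X ?_
        rw [JetComplex.flag_eq_top hk]
        exact Submodule.mem_top
      by_cases hX : X = 0
      · rw [RealOp.kPart, hX]
        simp
      obtain ⟨φ, h1, h2⟩ := JetComplex.exists_d_sub_mem_flag hX hψ
      obtain ⟨X, rfl⟩ := Sec.exists_apply_eq (TM M) x X
      have h3 : ∀ m (ψ : Sec (𝒱.E (m + 1))) y Z, ψ y ∈ 𝒱.flag (m + 1) k y → k ≤ m →
          (A.comm m).kbarPart JM (A.S m) ψ y Z = 0 := fun m ψ y Z h4 h5 =>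
        h m ψ y Z (JetComplex.flag_mono (m + 1) y h5 h4)
      have hN : ∀ y Z, A.comm (n + 1) φ y Z ∈ 𝒱.N (n + 1) y := fun y Z => by
        change 𝒱.pr n y _ = 0
        rw [pr_comm, ← RealOp.kPart_add_kbarPart (JM := JM) (S := A.S n), h3 n _ _ _ (h1 y) hk,
          ih n _ _ _ (h1 y), add_zero]
      have hk0 : ∀ y Z, A.comm (n + 1) φ y Z = (A.comm (n + 1)).kPart JM (A.S (n + 1)) φ y Z :=
        fun y Z => by
          conv_lhs => rw [← RealOp.kPart_add_kbarPart (JM := JM) (S := A.S (n + 1)),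
            h (n + 1) φ y Z (JetComplex.flag_mono (n + 2) y (Nat.succ_le_succ hk) (h1 y)), add_zero]
      have h6 := 𝒱.extDeriv_eq_zero_of_kType _ hN (fun y Z => by
        rw [← A.S_ker]
        change _ = A.S (n + 1) y (A.comm (n + 1) φ y Z)
        rw [hk0, hk0, RealOp.kPart_JM]) X x
      have h7 := JetComplex.kbarPart_mem_flag A h1 x (X x)
      rw [extDeriv_comm, h3 n _ _ _ h7 hk, map_zero, smul_zero, sub_zero] at h6
      have h8 := congrArg (A.S n x) ((smul_eq_zero.mp h6).resolve_left two_ne_zero)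
      rw [A.S n |>.sq, map_zero, neg_eq_zero] at h8
      have h9 := ih n (ψ - ((𝒱.d (n + 1)).kPartForm JM (A.S (n + 1)) φ).app X) x (X x) (by
        have h10 := RealOp.kPart_add_kbarPart (L := 𝒱.d (n + 1)) (JM := JM) (S := A.S (n + 1)) φ x
          (X x)
        rw [← h10] at h2
        have h11 := Submodule.sub_mem _ h7 h2
        convert h11 using 1
        change ψ x - (𝒱.d (n + 1)).kPart JM (A.S (n + 1)) φ x (X x) = _
        abel)
      rwa [RealOp.kPart_sub, h8, sub_zero] at h9
  intro n ψ x X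
  refine key (n + 1) n ψ x X ?_
  rw [JetComplex.flag_eq_top le_rfl]
  exact Submodule.mem_top

theorem commutesWithKPart_iff_kbar : A.CommutesWithKPart ↔ A.KbarCommutatorVanishesOnFlag :=
  ⟨A.kbarCommutatorVanishesOnFlag, A.commutesWithKPart⟩

end AdaptedCS

end Commutator

/-! ### The holomorphic structures induced by `d''`. -/

section InducedHolomorphic

variable {M : Type u} [TopologicalSpace M] [ChartedSpace (EuclideanSpace ℝ (Fin 2)) M]
  [IsManifold (𝓡 2) ∞ M] [T2Space M] [SigmaCompactSpace M] {JM : ComplexStr (TM M)}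
  {V : SmoothVB.{u, v} M} {J : ComplexStr V} {D : HolStr JM J} {𝒱 : JetComplex D}

theorem HolStr.ext {S : ComplexStr V} {D₁ D₂ : HolStr JM S} (h : ∀ ψ x X, D₁ ψ x X = D₂ ψ x X) :
    D₁ = D₂ := by
  obtain ⟨⟨D₁, _, _⟩, _, _⟩ := D₁
  obtain ⟨⟨D₂, _, _⟩, _, _⟩ := D₂
  obtain rfl : D₁ = D₂ := funext fun ψ => BundleHom.ext (h ψ)
  rfl

namespace AdaptedCS

variable (A : AdaptedCS 𝒱)

/-- The holomorphic structures induced by `d''`. -/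
def holStr (n : ℕ) : HolStr JM (A.S n) where
  toFun φ := (𝒱.d n).kbarPartForm JM (A.S n) ((𝒱.lift n).app φ)
  map_add ψ φ x X := by
    rw [BundleHom.app_add]
    exact RealOp.kbarPart_add _ _ _ _
  map_smul c ψ x X := by
    rw [BundleHom.app_smul]
    exact RealOp.kbarPart_smul _ _ _ _
  type_kbar ψ x X := RealOp.kbarPart_JM _ _ _
  leibniz f ψ x X := by
    rw [BundleHom.app_fsmul]
    change (𝒱.d n).kbarPart JM (A.S n) _ x X = f x • (𝒱.d n).kbarPart JM (A.S n) _ x X + _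
    rw [RealOp.kbarPart, RealOp.kbarPart, 𝒱.d_leibniz, 𝒱.d_leibniz, BundleHom.app_apply, 𝒱.pr_lift,
      map_add, map_smul, map_smul]
    module

/-- `d''` vanishes on sections of `ker π`, where `d` has type `K`. Hence it descends along `π`, and
the choice of lift in `holStr` is immaterial. -/
theorem kbarPart_congr {n : ℕ} {ψ φ : Sec (𝒱.E (n + 1))}
    (h : (𝒱.pr n).app ψ = (𝒱.pr n).app φ) (x : M) (X : (TM M).fiber x) :
    (𝒱.d n).kbarPart JM (A.S n) ψ x X = (𝒱.d n).kbarPart JM (A.S n) φ x X := by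
  rw [← sub_eq_zero, ← RealOp.kbarPart_sub]
  refine JetComplex.kbarPart_eq_zero_of_mem (fun y => ?_) x X
  have h1 := congrArg (fun s : Sec (𝒱.E n) => s y) h
  change 𝒱.pr n y (ψ y - φ y) = 0
  rw [map_sub]
  exact sub_eq_zero.mpr h1

theorem induces_holStr : A.Induces A.holStr := fun _ _ x X =>
  A.kbarPart_congr (𝒱.pr_app_lift _) x X

variable {A} {Dn : ∀ n, HolStr JM (A.S n)}

theorem Induces.apply_eq (h : A.Induces Dn) {n : ℕ} (φ : Sec (𝒱.E n)) (x : M)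
    (X : (TM M).fiber x) :
    Dn n φ x X = (𝒱.d n).kbarPart JM (A.S n) ((𝒱.lift n).app φ) x X := by
  rw [← h, 𝒱.pr_app_lift]

variable (A) in
theorem existsUnique_induces : ∃! Dn : ∀ n, HolStr JM (A.S n), A.Induces Dn :=
  ⟨A.holStr, A.induces_holStr, fun _ h => funext fun _ => HolStr.ext fun ψ x X => h.apply_eq ψ x X⟩

theorem Induces.zero_apply (h : A.Induces Dn) (ψ : Sec V) (x : M) (X : (TM M).fiber x) :
    Dn 0 ψ x X = D ψ x X := by
  have h1 : A.S 0 = J := ComplexStr.ext fun x z =>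
    (A.S_ker 0 x ⟨z, Submodule.mem_top⟩).trans (𝒱.JN_zero x ⟨z, Submodule.mem_top⟩)
  have h2 := 𝒱.D_pr ((𝒱.lift 0).app ψ) x X
  rw [𝒱.pr_app_lift] at h2
  refine (h.apply_eq (n := 0) ψ x X).trans (Eq.trans ?_ h2.symm)
  rw [h1]

theorem Induces.isHolomorphicHom (h : A.Induces Dn) (n : ℕ) :
    IsHolomorphicHom (Dn (n + 1)) (Dn n) (𝒱.pr n) := by
  refine ⟨A.pr_S n, fun ψ x X => ?_⟩
  have h1 : (Dn (n + 1)) ψ x X = _ := h.apply_eq ψ x X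
  rw [h1, JetComplex.pr_kbarPart (A.pr_S n), 𝒱.pr_app_lift]
  exact (h n ψ x X).symm

/-- A lift of `ψ` multiplied by `S_{n+1}` is a lift of `S_n ψ`, so the failure of `D_n` to be
complex linear is `[d'', S]` evaluated on a lift. -/
theorem Induces.apply_S (h : A.Induces Dn) {n : ℕ} (ψ : Sec (𝒱.E n)) (x : M)
    (X : (TM M).fiber x) : Dn n ((A.S n).app ψ) x X = A.S n x (Dn n ψ x X) +
      (A.comm n).kbarPart JM (A.S n) ((𝒱.lift n).app ψ) x X := by
  have h1 : (A.S n).app ψ = (𝒱.pr n).app ((A.S (n + 1)).app ((𝒱.lift n).app ψ)) := by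
    ext y
    change A.S n y (ψ y) = 𝒱.pr n y (A.S (n + 1) y (𝒱.lift n y (ψ y)))
    rw [A.pr_S, 𝒱.pr_lift]
  have h2 : Dn n ψ x X = _ := h.apply_eq ψ x X
  have h3 : Dn n ((𝒱.pr n).app ((A.S (n + 1)).app ((𝒱.lift n).app ψ))) x X = _ := h n _ x X
  rw [h1, h2, h3, kbarPart_comm]
  abel

/-- Lifting raises both indices by one: over `F_n ⊆ V_{n+1}` lies `F_{n+1} ⊆ V_{n+2}`, where `[d'',
S]` vanishes, so `D_{n+1}` commutes with `S` there. -/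
theorem Induces.hopf_eq_zero (h : A.Induces Dn) (hA : A.KbarCommutatorVanishesOnFlag) {n : ℕ}
    {ψ : Sec (𝒱.E (n + 1))} {x : M} (X : (TM M).fiber x) (hψ : ψ x ∈ 𝒱.flag (n + 1) n x) :
    (Dn (n + 1)).hopf ψ x X = 0 := by
  rw [kbarCommutatorVanishesOnFlag_iff] at hA
  rw [HolStr.hopf]
  have h1 := h.apply_S ψ x X
  rw [hA (n + 1) _ x X (by
    change 𝒱.pr (n + 1) x _ ∈ 𝒱.flag (n + 1) n x
    rwa [BundleHom.app_apply, 𝒱.pr_lift]), add_zero] at h1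
  have h2 := congrArg (A.S (n + 1) x) h1
  rw [ComplexStr.sq] at h2
  exact (congrArg _ (congrArg _ h2)).trans (by rw [add_neg_cancel, smul_zero])

theorem Induces.restrict_flag (h : A.Induces Dn) (hA : A.KbarCommutatorVanishesOnFlag) {n k : ℕ}
    {ψ : Sec (𝒱.E n)} (hk : k < n) (hψ : ∀ x, ψ x ∈ 𝒱.flag n k x) (x : M)
    (X : (TM M).fiber x) : Dn n ψ x X ∈ 𝒱.flag n k x ∧ Dn n ψ x X = (Dn n).delbar ψ x X ∧
      Dn n ((A.S n).toBundleHom.app ψ) x X = A.S n x (Dn n ψ x X) := by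
  rw [kbarCommutatorVanishesOnFlag_iff] at hA
  have h0 : ∀ y, (𝒱.lift n).app ψ y ∈ 𝒱.flag (n + 1) (k + 1) y := fun y => by
    change 𝒱.pr n y _ ∈ 𝒱.flag n k y
    rw [BundleHom.app_apply, 𝒱.pr_lift]
    exact hψ y
  have h1 := h.apply_S ψ x X
  rw [hA n _ x X (JetComplex.flag_mono (n + 1) x hk (h0 x)), add_zero] at h1
  have h2 : Dn n ψ x X = _ := h.apply_eq ψ x X
  refine ⟨?_, ?_, h1⟩
  · rw [h2]
    exact JetComplex.kbarPart_mem_flag A h0 x X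
  · have h3 := congrArg (A.S n x) h1
    rw [ComplexStr.sq] at h3
    have h4 : (Dn n).delbar ψ x X = (1 / 2 : ℝ) • (Dn n ψ x X - -Dn n ψ x X) :=
      congrArg _ (congrArg _ h3)
    rw [h4]
    module

end AdaptedCS

section Quaternionic

variable {q : QuatStr V} (R : QuatJetStr 𝒱 q) {A : AdaptedCS 𝒱}

theorem QuatJetStr.isLinear_complexStr (hJ : QuatStr.IsLinear q q J.toBundleHom)
    (hA : A.CommutesWithKPart) (n : ℕ) :
    QuatStr.IsLinear (R.str n) (R.str n) (A.S n).toBundleHom := by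
  intro a x z
  refine ((R.isJetMap a).commutes_complexStr hA hA (fun x z => ?_) n x z).symm
  have h0 : ∀ x z, A.S 0 x z = J x z := fun x z =>
    (A.S_ker 0 x ⟨z, Submodule.mem_top⟩).trans (𝒱.JN_zero x ⟨z, Submodule.mem_top⟩)
  rw [h0, h0, R.str_zero]
  exact (hJ a x z).symm

theorem QuatJetStr.isQuatLinear_holStr
    (hS : ∀ n, QuatStr.IsLinear (R.str n) (R.str n) (A.S n).toBundleHom)
    {Dn : ∀ n, HolStr JM (A.S n)} (h : A.Induces Dn) (n : ℕ) :
    RealOp.IsQuatLinear (R.str n) (R.str n) (Dn n).toRealOp := by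
  intro a ψ x X
  have h1 : ((R.str n).rmul a).app ψ =
      (𝒱.pr n).app (((R.str (n + 1)).rmul a).app ((𝒱.lift n).app ψ)) := by
    ext y
    change _ = 𝒱.pr n y ((R.str (n + 1)).rmul a y (𝒱.lift n y (ψ y)))
    rw [R.pr_linear, 𝒱.pr_lift]
    rfl
  have h2 : Dn n ψ x X = _ := h.apply_eq ψ x X
  have h3 : Dn n ((𝒱.pr n).app (((R.str (n + 1)).rmul a).app ((𝒱.lift n).app ψ))) x X = _ :=
    h n _ x X
  have h4 : ∀ z, A.S n x ((R.str n).rmul a x z) = (R.str n).rmul a x (A.S n x z) := hS n a x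
  refine (congrArg (fun s => Dn n s x X) h1).trans (h3.trans ?_)
  refine Eq.trans ?_ (congrArg ((R.str n).rmul a x) h2.symm)
  rw [RealOp.kbarPart, RealOp.kbarPart, R.d_linear, R.d_linear, h4, map_smul, map_add]

end Quaternionic

end InducedHolomorphic

/-! ### Vector fields, Lie brackets and derivatives of functions. -/

section Calculus

variable {M : Type u} [TopologicalSpace M] [ChartedSpace (EuclideanSpace ℝ (Fin 2)) M]
  [IsManifold (𝓡 2) ∞ M]

theorem contMDiff_mfderiv_apply {F : Type*} [NormedAddCommGroup F] [NormedSpace ℝ F] {g : M → F}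
    (hg : ContMDiff (𝓡 2) 𝓘(ℝ, F) ∞ g) (X : Sec (TM M)) : ContMDiff (𝓡 2) 𝓘(ℝ, F) ∞
      (fun x => (mfderiv (𝓡 2) 𝓘(ℝ, F) g x (X x) : F)) := by
  have h1 := (hg.contMDiff_tangentMap (m := ∞) le_rfl).comp X.contMDiff
  exact (contMDiff_snd_tangentBundle_modelSpace F 𝓘(ℝ, F)).comp h1

variable (M) in
theorem isManifold_minSmoothness (n : ℕ) :
    IsManifold (𝓡 2) (minSmoothness ℝ n) M := by
  rw [minSmoothness_of_isRCLikeNormedField]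
  exact IsManifold.of_le (n := ∞) (by exact_mod_cast le_top)

/-- The derivative of a function in the direction of a vector field. -/
def Sec.deriv (X : Sec (TM M)) (f : C^∞⟮𝓡 2, M; ℝ⟯) : C^∞⟮𝓡 2, M; ℝ⟯ :=
  ⟨fun x => dfun f x (X x), contMDiff_mfderiv_apply f.contMDiff X⟩

@[simp] theorem Sec.deriv_apply (X : Sec (TM M)) (f : C^∞⟮𝓡 2, M; ℝ⟯) (x : M) :
    X.deriv f x = dfun f x (X x) := rfl

/-- The Lie bracket of vector fields. -/
def Sec.bracket (X Y : Sec (TM M)) : Sec (TM M) where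
  toFun := VectorField.mlieBracket (𝓡 2) (fun y => X y) (fun y => Y y)
  contMDiff_toFun := by
    have : IsManifold (𝓡 2) ((⊤ : ℕ∞) + 1) M := by
      change IsManifold (𝓡 2) ∞ M
      infer_instance
    have := isManifold_minSmoothness M 2
    exact ContDiff.mlieBracket_vectorField (m := ⊤) (n := ⊤) X.contMDiff Y.contMDiff
      (by simp)

theorem Sec.bracket_apply (X Y : Sec (TM M)) (x : M) : X.bracket Y x =
    VectorField.mlieBracket (𝓡 2) (fun y => X y) (fun y => Y y) x := rfl

theorem Sec.mdifferentiableAt (X : Sec (TM M)) (x : M) : MDifferentiableAt (𝓡 2)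
    ((𝓡 2).prod 𝓘(ℝ, EuclideanSpace ℝ (Fin 2))) (fun y => (X y : TangentBundle (𝓡 2) M)) x :=
  X.contMDiff.mdifferentiable (by simp) x

theorem Sec.bracket_swap (X Y : Sec (TM M)) : X.bracket Y = -Y.bracket X := by
  ext x
  exact VectorField.mlieBracket_swap_apply

theorem Sec.bracket_add (X Y Z : Sec (TM M)) : X.bracket (Y + Z) = X.bracket Y + X.bracket Z := by
  have := isManifold_minSmoothness M 2
  ext x
  exact VectorField.mlieBracket_add_right (Y.mdifferentiableAt x) (Z.mdifferentiableAt x)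

theorem Sec.bracket_fsmul (X Y : Sec (TM M)) (f : C^∞⟮𝓡 2, M; ℝ⟯) :
    X.bracket (Y.fsmul f) = Y.fsmul (X.deriv f) + (X.bracket Y).fsmul f := by
  have := isManifold_minSmoothness M 2
  ext x
  exact VectorField.mlieBracket_smul_right (f := f) (f.contMDiff.mdifferentiable (by simp) x)
    (Y.mdifferentiableAt x)

theorem Sec.bracket_bracket (X Y Z : Sec (TM M)) :
    X.bracket (Y.bracket Z) = (X.bracket Y).bracket Z + Y.bracket (X.bracket Z) := by
  have := isManifold_minSmoothness M 3
  ext x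
  have h : ∀ Z : Sec (TM M), ContMDiffAt (𝓡 2) ((𝓡 2).prod 𝓘(ℝ, EuclideanSpace ℝ (Fin 2)))
    (minSmoothness ℝ 2) (fun y => (Z y : TangentBundle (𝓡 2) M)) x := fun Z =>
    Z.contMDiff.contMDiffAt.of_le (by
      rw [minSmoothness_of_isRCLikeNormedField]
      exact WithTop.coe_le_coe.mpr le_top)
  exact VectorField.leibniz_identity_mlieBracket_apply (h X) (h Y) (h Z)

variable [T2Space M] [SigmaCompactSpace M]

/-- `[X, Y] f = X (Y f) - Y (X f)`. -/
theorem dfun_bracket (X Y : Sec (TM M)) (f : C^∞⟮𝓡 2, M; ℝ⟯) (x : M) :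
    dfun f x (X.bracket Y x) = dfun (Y.deriv f) x (X x) - dfun (X.deriv f) x (Y x) := by
  obtain ⟨W, hW⟩ := exists_tangent_ne_zero x
  obtain ⟨W, rfl⟩ := Sec.exists_apply_eq (TM M) x W
  -- The Jacobi identity for `X, Y, f W`, minus `f` times the one for `X, Y, W`, leaves `(X (Y f) -
  -- Y (X f) - [X, Y] f) W = 0`, and `W` is nonzero at the point.
  have h := congrArg (fun s : Sec (TM M) => s x) (Sec.bracket_bracket X Y (W.fsmul f))
  have h' := congrArg (fun s : Sec (TM M) => f x • s x) (Sec.bracket_bracket X Y W)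
  simp only [Sec.bracket_fsmul, Sec.bracket_add, Sec.add_apply, Sec.fsmul_apply,
    Sec.deriv_apply, smul_add] at h h'
  have h1 : (dfun (Y.deriv f) x (X x) - dfun (X.deriv f) x (Y x) - dfun f x (X.bracket Y x)) •
      W x = 0 := by
    linear_combination (norm := module) h - h'
  exact (sub_eq_zero.mp ((smul_eq_zero.mp h1).resolve_right hW)).symm

end Calculus

/-! ### Tensoriality of the exterior derivative. -/

section ExteriorDerivative

variable {M : Type u} [TopologicalSpace M] [ChartedSpace (EuclideanSpace ℝ (Fin 2)) M]
  [IsManifold (𝓡 2) ∞ M] {V : SmoothVB.{u, v} M} {W : SmoothVB.{u, w} M}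

namespace RealOp

variable {L : RealOp V W} {p : BundleHom V W}

theorem extDeriv_swap (ξ : OneForm V) (X Y : Sec (TM M)) (x : M) :
    L.extDeriv p ξ X Y x = -L.extDeriv p ξ Y X x := by
  have h := congrArg (fun s : Sec (TM M) => s x) (Sec.bracket_swap X Y)
  simp only [Sec.bracket_apply, Sec.neg_apply] at h
  rw [extDeriv, extDeriv, h, _root_.map_neg, _root_.map_neg]
  abel

theorem extDeriv_add_right (ξ : OneForm V) (X Y Z : Sec (TM M)) (x : M) :
    L.extDeriv p ξ X (Y + Z) x = L.extDeriv p ξ X Y x + L.extDeriv p ξ X Z x := by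
  have h := congrArg (fun s : Sec (TM M) => s x) (Sec.bracket_add X Y Z)
  rw [Sec.add_apply, Sec.bracket_apply, Sec.bracket_apply, Sec.bracket_apply] at h
  rw [extDeriv, extDeriv, extDeriv, h, BundleHom.app_add, L.map_add, Sec.add_apply,
    _root_.map_add, _root_.map_add, _root_.map_add]
  abel

variable (hL : ∀ (f : C^∞⟮𝓡 2, M; ℝ⟯) ψ x X, L (ψ.fsmul f) x X = f x • L ψ x X +
  dfun f x X • p x (ψ x))

include hL

/-- The term with the derivative of `f` along `X` produced by the Leibniz rule cancels against the
one in `[X, f Y]`. -/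
theorem extDeriv_fsmul_right (ξ : OneForm V) (X Y : Sec (TM M)) (f : C^∞⟮𝓡 2, M; ℝ⟯) (x : M) :
    L.extDeriv p ξ X (Y.fsmul f) x = f x • L.extDeriv p ξ X Y x := by
  have h := congrArg (fun s : Sec (TM M) => s x) (Sec.bracket_fsmul X Y f)
  rw [Sec.add_apply, Sec.fsmul_apply, Sec.fsmul_apply, Sec.bracket_apply, Sec.bracket_apply,
    Sec.deriv_apply] at h
  rw [extDeriv, extDeriv, h, BundleHom.app_fsmul, hL, Sec.fsmul_apply, BundleHom.app_apply]
  simp only [_root_.map_add, _root_.map_smul]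
  module

variable [T2Space M] [SigmaCompactSpace M]

/-- The exterior derivative is function linear in the two vector fields. -/
theorem exists_extDeriv_eq (ξ : OneForm V) :
    ∃ B : ∀ x, (TM M).fiber x →ₗ[ℝ] (TM M).fiber x →ₗ[ℝ] W.fiber x,
      (∀ X Y x, L.extDeriv p ξ X Y x = B x (X x) (Y x)) := by
  have h1 : ∀ X, ∃ T : OneForm W, ∀ Y x, T x (Y x) = L.extDeriv p ξ X Y x := fun X => by
    have h2 : IsFunLinear fun Y => (L (ξ.app Y)).app X - (L (ξ.app X)).app Y -
        p.app (ξ.app (X.bracket Y)) :=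
      ⟨fun Y Z => by ext x; exact extDeriv_add_right ξ X Y Z x,
        fun f Y => by ext x; exact extDeriv_fsmul_right hL ξ X Y f x⟩
    obtain ⟨T, hT⟩ := h2.exists_bundleHom
    exact ⟨T, fun Y x => congrArg (fun s : Sec W => s x) (hT Y)⟩
  choose T hT using h1
  have hadd : ∀ X X' x Z, T (X + X') x Z = T X x Z + T X' x Z := fun X X' x Z => by
    obtain ⟨Z, rfl⟩ := Sec.exists_apply_eq _ x Z
    rw [hT, hT, hT, extDeriv_swap, extDeriv_add_right, extDeriv_swap, extDeriv_swap ξ Z X']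
    abel
  have hsmul : ∀ (f : C^∞⟮𝓡 2, M; ℝ⟯) X x Z, T (X.fsmul f) x Z = f x • T X x Z :=
    fun f X x Z => by
    obtain ⟨Z, rfl⟩ := Sec.exists_apply_eq _ x Z
    rw [hT, hT, extDeriv_swap, extDeriv_fsmul_right hL, extDeriv_swap, smul_neg, neg_neg]
  let T' : RealOp (TM M) W := ⟨T, hadd, fun c X => hsmul ⟨fun _ => c, contMDiff_const⟩ X⟩
  have hcongr : ∀ {X X' : Sec (TM M)} {x}, X x = X' x → ∀ Z, T X x Z = T X' x Z :=
    fun h Z => T'.eq_of_apply_eq hsmul h Z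
  choose s hs using Sec.exists_apply_eq (TM M)
  refine ⟨fun x =>
    { toFun := fun z => T (s x z) x
      map_add' := fun z z' => ?_
      map_smul' := fun c z => ?_ }, fun X Y x => ?_⟩
  · ext Z
    rw [LinearMap.add_apply, ← hadd]
    exact hcongr (by rw [hs, Sec.add_apply, hs, hs]) Z
  · ext Z
    rw [RingHom.id_apply, LinearMap.smul_apply]
    refine Eq.trans ?_ (hsmul ⟨fun _ => c, contMDiff_const⟩ (s x z) x Z)
    refine hcongr ?_ Z
    change s x (c • z) x = c • s x z x
    rw [hs, hs]
  · rw [← hT]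
    exact hcongr (hs x (X x)).symm (Y x)

end RealOp

end ExteriorDerivative

/-! ### Smooth vector bundles from linear charts. -/

section Charts

variable {M : Type u} [TopologicalSpace M] [ChartedSpace (EuclideanSpace ℝ (Fin 2)) M]

/-- A vector bundle atlas: fibrewise linear charts with smooth transition functions, one around
each point. -/
structure BundleCharts (F : Type) [NormedAddCommGroup F] [NormedSpace ℝ F] [FiniteDimensional ℝ F]
    (E : M → Type v) [∀ x, AddCommGroup (E x)] [∀ x, Module ℝ (E x)] where
  dom : M → Set M
  isOpen_dom : ∀ a, IsOpen (dom a)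
  mem_dom : ∀ a, a ∈ dom a
  chart : ∀ (_ : M) x, E x →ₗ[ℝ] F
  symm : ∀ (_ : M) x, F →ₗ[ℝ] E x
  chart_symm : ∀ a x, x ∈ dom a → ∀ z, chart a x (symm a x z) = z
  symm_chart : ∀ a x, x ∈ dom a → ∀ z, symm a x (chart a x z) = z
  smooth : ∀ a b x, x ∈ dom a → x ∈ dom b → ∀ z,
    ContMDiffAt (𝓡 2) 𝓘(ℝ, F) ∞ (fun y => chart b y (symm a y z)) x

namespace BundleCharts

variable {F : Type} [NormedAddCommGroup F] [NormedSpace ℝ F] [FiniteDimensional ℝ F]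
  {E : M → Type v} [∀ x, AddCommGroup (E x)] [∀ x, Module ℝ (E x)] (c : BundleCharts F E)

/-- The charts as pretrivializations. -/
def pretriv (a : M) : Pretrivialization F (π F E) where
  toFun p := (p.1, c.chart a p.1 p.2)
  invFun q := ⟨q.1, c.symm a q.1 q.2⟩
  source := π F E ⁻¹' c.dom a
  target := c.dom a ×ˢ Set.univ
  map_source' p hp := ⟨hp, trivial⟩
  map_target' q hq := hq.1
  left_inv' p hp := by
    obtain ⟨x, z⟩ := p
    simp [c.symm_chart a x hp]
  right_inv' q hq := Prod.ext rfl (c.chart_symm a q.1 hq.1 q.2)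
  open_target := (c.isOpen_dom a).prod isOpen_univ
  baseSet := c.dom a
  open_baseSet := c.isOpen_dom a
  source_eq := rfl
  target_eq := rfl
  proj_toFun _ _ := rfl

theorem pretriv_symm (a x : M) (hx : x ∈ c.dom a) (z : F) :
    (c.pretriv a).symm x z = c.symm a x z := by
  have h1 : c.chart a x ((c.pretriv a).symm x z) = z :=
    congrArg Prod.snd ((c.pretriv a).apply_mk_symm (b := x) hx z)
  rw [← c.symm_chart a x hx ((c.pretriv a).symm x z), h1]

theorem exists_coordChange (a b : M) : ∃ f : M → F →L[ℝ] F,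
    ContMDiffOn (𝓡 2) 𝓘(ℝ, F →L[ℝ] F) ∞ f (c.dom a ∩ c.dom b) ∧
      ∀ x ∈ c.dom a ∩ c.dom b, ∀ z, f x z = (c.pretriv b ⟨x, (c.pretriv a).symm x z⟩).2 := by
  refine ⟨fun x => (c.chart b x ∘ₗ c.symm a x).toContinuousLinearMap, fun x hx => ?_,
    fun x hx z => ?_⟩
  · exact (contMDiffAt_clm_of_apply fun z => c.smooth a b x hx.1 hx.2 z).contMDiffWithinAt
  · rw [c.pretriv_symm a x hx.1]
    rfl

variable [∀ x, TopologicalSpace (E x)] (hE : ∀ x, IsInducing (c.chart x x))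

/-- The vector prebundle defined by the charts. -/
def prebundle : VectorPrebundle ℝ F E where
  pretrivializationAtlas := Set.range c.pretriv
  pretrivialization_linear' := by
    rintro _ ⟨a, rfl⟩
    exact ⟨fun x _ => ⟨fun z z' => map_add _ _ _, fun r z => map_smul _ _ _⟩⟩
  pretrivializationAt := c.pretriv
  mem_base_pretrivializationAt := c.mem_dom
  pretrivialization_mem_atlas a := ⟨a, rfl⟩
  exists_coordChange := by
    rintro _ ⟨a, rfl⟩ _ ⟨b, rfl⟩
    obtain ⟨f, h1, h2⟩ := c.exists_coordChange a b
    exact ⟨f, h1.continuousOn, h2⟩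
  totalSpaceMk_isInducing x := by
    have h1 : c.pretriv x ∘ TotalSpace.mk x = Prod.mk x ∘ c.chart x x := rfl
    rw [h1]
    exact (isInducing_prodMkRight x).comp (hE x)

end BundleCharts

variable {F : Type} [NormedAddCommGroup F] [NormedSpace ℝ F] [FiniteDimensional ℝ F]
  {E : M → Type v} [∀ x, AddCommGroup (E x)] [∀ x, Module ℝ (E x)]

/-- The smooth vector bundle defined by an atlas. -/
def SmoothVB.ofCharts (c : BundleCharts F E) : SmoothVB.{u, v} M :=
  -- The fibres carry no topology of their own; each receives the one induced by the chart centred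
  -- at its base point, as `prebundle` requires.
  letI : ∀ x, TopologicalSpace (E x) := fun x => .induced (c.chart x x) inferInstance
  letI a := c.prebundle fun _ => ⟨rfl⟩
  letI := a.totalSpaceTopology
  letI := a.toFiberBundle
  letI := a.toVectorBundle
  letI : a.IsContMDiff (𝓡 2) ∞ := ⟨by
    rintro _ ⟨a, rfl⟩ _ ⟨b, rfl⟩
    exact c.exists_coordChange a b⟩
  letI := a.contMDiffVectorBundle (n := ∞) (IB := 𝓡 2)
  { F := F
    fiber := E }

theorem SmoothVB.smoothAt_ofCharts (c : BundleCharts F E) {s : ∀ x, (SmoothVB.ofCharts c).fiber x}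
    {x : M} :
    (SmoothVB.ofCharts c).SmoothAt s x ↔
      ContMDiffAt (𝓡 2) 𝓘(ℝ, F) ∞ (fun y => c.chart x y (s y)) x :=
  contMDiffAt_section (F := (SmoothVB.ofCharts c).F) (E := (SmoothVB.ofCharts c).fiber) x

end Charts

/-! ### Local complex frames of the tangent bundle. -/

section TangentFrame

variable {M : Type u} [TopologicalSpace M] [ChartedSpace (EuclideanSpace ℝ (Fin 2)) M]
  [IsManifold (𝓡 2) ∞ M]

/-- The first vector field of the coordinate frame at `a`. -/
def coordField (a x : M) : (TM M).fiber x :=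
  (trivializationAt (TM M).F (TM M).fiber a).symm x (EuclideanSpace.single 0 1)

theorem smoothAt_coordField {a x : M} (hx : x ∈ (trivializationAt (TM M).F (TM M).fiber a).baseSet) :
    (TM M).SmoothAt (coordField a) x :=
  (TM M).smoothAt_symm a hx _

theorem coordField_ne_zero {a x : M}
    (hx : x ∈ (trivializationAt (TM M).F (TM M).fiber a).baseSet) : coordField a x ≠ 0 := by
  intro h
  have h1 := congrArg Prod.snd ((trivializationAt (TM M).F (TM M).fiber a).apply_mk_symm hx
    (EuclideanSpace.single 0 1))
  rw [coordField] at h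
  rw [h] at h1
  have h2 : (trivializationAt (TM M).F (TM M).fiber a ⟨x, 0⟩).2 = 0 :=
    congrArg Prod.snd ((trivializationAt (TM M).F (TM M).fiber a).zeroSection ℝ hx)
  rw [h2] at h1
  have h3 := congrArg (fun v : EuclideanSpace ℝ (Fin 2) => v 0) h1
  simp at h3

/-- The trivial bundle of rank two. -/
def trivialPlane (M : Type u) [TopologicalSpace M] [ChartedSpace (EuclideanSpace ℝ (Fin 2)) M] :
    SmoothVB.{u, 0} M where
  F := ℝ × ℝ
  fiber := Bundle.Trivial M (ℝ × ℝ)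

theorem SmoothAt.trivialPlane_coord {s : ∀ _ : M, ℝ × ℝ} {x : M}
    (h : (trivialPlane M).SmoothAt s x) : ContMDiffAt (𝓡 2) 𝓘(ℝ, ℝ) ∞ (fun y => (s y).1) x ∧
      ContMDiffAt (𝓡 2) 𝓘(ℝ, ℝ) ∞ (fun y => (s y).2) x := by
  have h1 := (contMDiffAt_section (F := ℝ × ℝ) (E := Bundle.Trivial M (ℝ × ℝ)) x).mp h
  exact ⟨(ContinuousLinearMap.fst ℝ ℝ ℝ).contMDiff.contMDiffAt.comp x h1,
    (ContinuousLinearMap.snd ℝ ℝ ℝ).contMDiff.contMDiffAt.comp x h1⟩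

variable [T2Space M] [SigmaCompactSpace M]

/-- Vector fields have smooth complex coordinates. -/
theorem exists_smooth_complex_coord (JM : ComplexStr (TM M)) {a x : M}
    (hx : x ∈ (trivializationAt (TM M).F (TM M).fiber a).baseSet) {Y : ∀ y, (TM M).fiber y}
    (hY : (TM M).SmoothAt Y x) : ∃ α β : M → ℝ, ContMDiffAt (𝓡 2) 𝓘(ℝ, ℝ) ∞ α x ∧
      ContMDiffAt (𝓡 2) 𝓘(ℝ, ℝ) ∞ β x ∧
      ∀ᶠ y in 𝓝 x, Y y = α y • coordField a y + β y • JM y (coordField a y) := by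
  have hev := (trivializationAt (TM M).F (TM M).fiber a).open_baseSet.eventually_mem hx
  obtain ⟨X, hX⟩ := Sec.exists_eq_near (V := TM M) (s := coordField a)
    (hev.mono fun y hy => smoothAt_coordField hy)
  have h1 : ∀ y, ∃ p : ℝ × ℝ, y ∈ (trivializationAt (TM M).F (TM M).fiber a).baseSet →
      Y y = p.1 • coordField a y + p.2 • JM y (coordField a y) := fun y => by
    by_cases hy : y ∈ (trivializationAt (TM M).F (TM M).fiber a).baseSet
    · obtain ⟨α, β, h⟩ := exists_complex_coord (finrank_tangent y) (JM.sq y)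
        (coordField_ne_zero hy) (Y y)
      exact ⟨(α, β), fun _ => h⟩
    · exact ⟨0, fun h => absurd h hy⟩
  choose p hp using h1
  -- The coordinates are recovered from `Y` by inverting the smooth map `(α, β) ↦ α X + β J X`,
  -- which is injective at `x`; this gives their smoothness.
  let A : BundleHom (trivialPlane M) (TM M) := BundleHom.ofSec
    (fun y => LinearMap.coprod (LinearMap.toSpanSingleton ℝ _ (X y))
      (LinearMap.toSpanSingleton ℝ _ (JM y (X y)))) fun ψ y => by
      have h2 := SmoothAt.trivialPlane_coord (ψ.contMDiff y)
      exact (h2.1.smul_section (X.contMDiff y)).add_section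
        (h2.2.smul_section ((JM.app X).contMDiff y))
  have hA : ∀ y (q : ℝ × ℝ), A y q = q.1 • X y + q.2 • JM y (X y) := fun y q => rfl
  have hAp : ∀ᶠ y in 𝓝 x, A y (p y) = Y y := by
    filter_upwards [hev, hX] with y hy hXy
    rw [hA, hXy, ← hp y hy]
  have h3 : (TM M).SmoothAt (fun y => A y (p y)) x :=
    ContMDiffAt.congr_of_eventuallyEq hY (hAp.mono fun y hy => congrArg (TotalSpace.mk y) hy)
  have h4 : (trivialPlane M).SmoothAt p x := by
    refine SmoothVB.smoothAt_of_injective A A (fun q hq _ => ?_) h3 h3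
    have hq' : (q : ℝ × ℝ).1 • X x + (q : ℝ × ℝ).2 • JM x (X x) = 0 := hq
    have h5 := LinearIndependent.pair_iff.mp (linearIndependent_complex_pair (JM.sq x)
      (hX.self_of_nhds ▸ coordField_ne_zero hx : X x ≠ 0)) _ _ hq'
    exact Prod.ext h5.1 h5.2
  have h5 := SmoothAt.trivialPlane_coord h4
  exact ⟨fun y => (p y).1, fun y => (p y).2, h5.1, h5.2, hev.mono hp⟩

end TangentFrame

/-! ### Bilinear and alternating maps on a complex line. -/

section OfValue

variable {T W : Type*} [AddCommGroup T] [Module ℝ T] [AddCommGroup W] [Module ℝ W]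
  {j : T →ₗ[ℝ] T} {J : W →ₗ[ℝ] W}

variable (j J) in
/-- The evaluation of `K`-forms at a vector. -/
def KForms.eval (X : T) : KForms j J →ₗ[ℝ] W where
  toFun η := η.1 X
  map_add' _ _ := rfl
  map_smul' _ _ := rfl

theorem KForms.bijective_eval (hT : Module.finrank ℝ T = 2) (hj : ∀ X, j (j X) = -X)
    (hJ : ∀ w, J (J w) = -w) {X : T} (hX : X ≠ 0) : Function.Bijective (KForms.eval j J X) := by
  refine ⟨(injective_iff_map_eq_zero _).mpr fun η h => ?_, fun w => ?_⟩
  · exact Subtype.ext (KForms.eq_zero_of_apply_eq_zero hT hj η.2 hX h)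
  · obtain ⟨η, hη, h⟩ := KForms.exists_apply_eq hT hj hJ hX w
    exact ⟨⟨η, hη⟩, h⟩

open Classical in
variable (j J) in
/-- The `K`-form with a given value at `X`. -/
def KForms.ofValue (X : T) : W →ₗ[ℝ] KForms j J :=
  -- The value `0` only makes the definition total. Charts use it at a coordinate vector field on
  -- its domain, where evaluation is bijective.
  if h : Function.Bijective (KForms.eval j J X) then (LinearEquiv.ofBijective _ h).symm else 0

theorem KForms.eval_ofValue {X : T} (h : Function.Bijective (KForms.eval j J X)) (w : W) :
    (KForms.ofValue j J X w).1 X = w := by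
  rw [ofValue, dif_pos h]
  exact (LinearEquiv.ofBijective _ h).apply_symm_apply w

theorem KForms.ofValue_eval {X : T} (h : Function.Bijective (KForms.eval j J X))
    (η : KForms j J) : KForms.ofValue j J X (η.1 X) = η :=
  h.1 (KForms.eval_ofValue h _)

/-- A bilinear map on a complex line, complex linear in both arguments, is symmetric. -/
theorem bilin_symm_of_complex (hT : Module.finrank ℝ T = 2) (hj : ∀ X, j (j X) = -X)
    (B : T → T →ₗ[ℝ] W) (hadd : ∀ X Y Z, B (X + Y) Z = B X Z + B Y Z)
    (hsmul : ∀ (c : ℝ) X Z, B (c • X) Z = c • B X Z) (h1 : ∀ X Z, B (j X) Z = J (B X Z))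
    (h2 : ∀ X Z, B X (j Z) = J (B X Z)) (X Y : T) : B X Y = B Y X := by
  by_cases hX : X = 0
  · have h3 := hsmul 0 0 Y
    rw [zero_smul, zero_smul] at h3
    rw [hX, h3, map_zero]
  obtain ⟨a, b, rfl⟩ := exists_complex_coord hT hj hX Y
  rw [map_add, map_smul, map_smul, hadd, hsmul, hsmul, h1, h2]

/-- An alternating 2-form on a complex line satisfies `r(X, jY) + r(jX, Y) = 0`. -/
theorem alternating_complex (hT : Module.finrank ℝ T = 2) (hj : ∀ X, j (j X) = -X)
    (r : T →ₗ[ℝ] T →ₗ[ℝ] W) (hr : ∀ X Y, r X Y = -r Y X) (X Y : T) :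
    r X (j Y) + r (j X) Y = 0 := by
  by_cases hX : X = 0
  · simp [hX]
  have h0 : ∀ Z, r Z Z = 0 := fun Z => by
    have h1 : (2 : ℝ) • r Z Z = 0 := by
      linear_combination (norm := module) hr Z Z
    exact (smul_eq_zero.mp h1).resolve_left two_ne_zero
  obtain ⟨a, b, rfl⟩ := exists_complex_coord hT hj hX Y
  simp only [map_add, map_smul, hj, map_neg, h0, hr (j X) X]
  module

end OfValue

/-! ### The bundle `K L`. -/

section KBundle

variable {M : Type u} [TopologicalSpace M] [ChartedSpace (EuclideanSpace ℝ (Fin 2)) M]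
  [IsManifold (𝓡 2) ∞ M]

theorem SmoothVB.SmoothAt.map {V : SmoothVB.{u, v} M} {W : SmoothVB.{u, w} M}
    {s : ∀ x, V.fiber x} {x : M} (h : V.SmoothAt s x) (T : BundleHom V W) :
    W.SmoothAt (fun y => T y (s y)) x :=
  (T.smooth ⟨x, s x⟩).comp x h

variable [T2Space M] [SigmaCompactSpace M]
  (JM : ComplexStr (TM M)) {L : SmoothVB.{u, v} M} (JL : ComplexStr L)

theorem bijective_eval_coordField {a x : M}
    (hx : x ∈ (trivializationAt (TM M).F (TM M).fiber a).baseSet) :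
    Function.Bijective (KForms.eval (JM x) (JL x) (coordField a x)) :=
  KForms.bijective_eval (finrank_tangent x) (JM.sq x) (JL.sq x) (coordField_ne_zero hx)

/-- The atlas of the bundle `K L`. -/
def kCharts : BundleCharts L.F fun x => KForms (JM x) (JL x) where
  dom a := (trivializationAt (TM M).F (TM M).fiber a).baseSet ∩
    (trivializationAt L.F L.fiber a).baseSet
  isOpen_dom a := (Trivialization.open_baseSet _).inter (Trivialization.open_baseSet _)
  mem_dom a := ⟨FiberBundle.mem_baseSet_trivializationAt' a,
    FiberBundle.mem_baseSet_trivializationAt' a⟩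
  chart a x := (trivializationAt L.F L.fiber a).linearMapAt ℝ x ∘ₗ
    KForms.eval (JM x) (JL x) (coordField a x)
  symm a x := KForms.ofValue (JM x) (JL x) (coordField a x) ∘ₗ
    (trivializationAt L.F L.fiber a).symmₗ ℝ x
  chart_symm a x hx z := by
    have h1 := bijective_eval_coordField JM JL hx.1
    change (trivializationAt L.F L.fiber a).linearMapAt ℝ x ((KForms.ofValue (JM x) (JL x)
      (coordField a x) _).1 (coordField a x)) = z
    rw [KForms.eval_ofValue h1, Trivialization.linearMapAt_symmₗ _ hx.2]
  symm_chart a x hx z := by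
    have h1 := bijective_eval_coordField JM JL hx.1
    simp only [LinearMap.comp_apply]
    rw [Trivialization.symmₗ_linearMapAt _ hx.2]
    exact KForms.ofValue_eval h1 z
  smooth a b x hxa hxb z := by
    -- If the second coordinate field is `α X + β J X` in terms of the first, a `K`-form with value
    -- `w` at `X` takes the value `α w + β J w` there; the transition functions are thus smooth.
    obtain ⟨α, β, hα, hβ, hαβ⟩ := exists_smooth_complex_coord JM hxa.1 (smoothAt_coordField hxb.1)
    have h1 := L.smoothAt_symm a hxa.2 z
    have h2 := (hα.smul_section h1).add_section (hβ.smul_section (h1.map JL.toBundleHom))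
    have h3 := ((trivializationAt L.F L.fiber b).contMDiffAt_section_iff hxb.2).mp h2
    refine h3.congr_of_eventuallyEq ?_
    filter_upwards [hαβ, (trivializationAt (TM M).F (TM M).fiber a).open_baseSet.eventually_mem hxa.1,
      (trivializationAt L.F L.fiber a).open_baseSet.eventually_mem hxa.2,
      (trivializationAt L.F L.fiber b).open_baseSet.eventually_mem hxb.2] with y hy h4 h5 h6
    have h7 := KForms.eval_ofValue (bijective_eval_coordField JM JL h4)
      ((trivializationAt L.F L.fiber a).symm y z)
    change (trivializationAt L.F L.fiber b).linearMapAt ℝ y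
      ((KForms.ofValue (JM y) (JL y) (coordField a y)
        ((trivializationAt L.F L.fiber a).symmₗ ℝ y z)).1 (coordField b y)) = _
    rw [Trivialization.symmₗ_apply _ h5, hy, map_add, map_smul, map_smul,
      (KForms.ofValue (JM y) (JL y) (coordField a y) _).2, h7,
      Trivialization.linearMapAt_apply, if_pos h6]
    rfl

/-- The bundle `K L` of complex linear 1-forms with values in `L`. -/
def kBundle : SmoothVB.{u, v} M := SmoothVB.ofCharts (kCharts JM JL)

variable {JM JL}

/-- The evaluation of a point of `K L`. -/
def kEval (x : M) : (kBundle JM JL).fiber x →ₗ[ℝ] (TM M).fiber x →ₗ[ℝ] L.fiber x :=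
  (KForms (JM x) (JL x)).subtype

theorem kEval_injective (x : M) :
    Function.Injective (kEval (JM := JM) (JL := JL) x) :=
  Subtype.val_injective

theorem kEval_JM {x : M} (η : (kBundle JM JL).fiber x) (X : (TM M).fiber x) :
    kEval x η (JM x X) = JL x (kEval x η X) := η.2 X

/-- Construction of points of `K L`. -/
def kMk (x : M) (η : (TM M).fiber x →ₗ[ℝ] L.fiber x) (h : ∀ X, η (JM x X) = JL x (η X)) :
    (kBundle JM JL).fiber x := ⟨η, h⟩

theorem smoothAt_kBundle {s : ∀ x, (kBundle JM JL).fiber x} {x : M} :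
    (kBundle JM JL).SmoothAt s x ↔
      L.SmoothAt (fun y => kEval y (s y) (coordField x y)) x := by
  have hx : x ∈ (trivializationAt L.F L.fiber x).baseSet :=
    FiberBundle.mem_baseSet_trivializationAt' x
  refine (SmoothVB.smoothAt_ofCharts (kCharts JM JL)).trans (Iff.trans ?_
    ((trivializationAt L.F L.fiber x).contMDiffAt_section_iff hx).symm)
  refine Filter.EventuallyEq.contMDiffAt_iff ?_
  filter_upwards [(trivializationAt L.F L.fiber x).open_baseSet.eventually_mem hx] with y hy
  change (trivializationAt L.F L.fiber x).linearMapAt ℝ y _ = _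
  rw [Trivialization.linearMapAt_apply, if_pos hy]
  rfl

theorem smoothAt_kEval {s : ∀ x, (kBundle JM JL).fiber x} {x : M}
    (hs : (kBundle JM JL).SmoothAt s x) {Y : ∀ y, (TM M).fiber y} (hY : (TM M).SmoothAt Y x) :
    L.SmoothAt (fun y => kEval y (s y) (Y y)) x := by
  have hx : x ∈ (trivializationAt (TM M).F (TM M).fiber x).baseSet :=
    FiberBundle.mem_baseSet_trivializationAt' x
  obtain ⟨α, β, hα, hβ, hαβ⟩ := exists_smooth_complex_coord JM hx hY
  have h1 := smoothAt_kBundle.mp hs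
  have h2 := (hα.smul_section h1).add_section (hβ.smul_section (h1.map JL.toBundleHom))
  refine h2.congr_of_eventuallyEq ?_
  filter_upwards [hαβ] with y hy
  refine congrArg (TotalSpace.mk y) ?_
  rw [hy, map_add, map_smul, map_smul, kEval_JM]
  rfl

theorem smoothAt_kBundle_of_forall {s : ∀ x, (kBundle JM JL).fiber x} {x : M}
    (h : ∀ Y : Sec (TM M), L.SmoothAt (fun y => kEval y (s y) (Y y)) x) :
    (kBundle JM JL).SmoothAt s x := by
  have hx : x ∈ (trivializationAt (TM M).F (TM M).fiber x).baseSet :=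
    FiberBundle.mem_baseSet_trivializationAt' x
  obtain ⟨X, hX⟩ := Sec.exists_eq_near (V := TM M) (s := coordField x) (x := x) (by
    filter_upwards [(trivializationAt (TM M).F (TM M).fiber x).open_baseSet.eventually_mem hx]
      with y hy
    exact smoothAt_coordField hy)
  refine smoothAt_kBundle.mpr ((h X).congr_of_eventuallyEq ?_)
  filter_upwards [hX] with y hy
  rw [hy]

/-- The 1-form given by a section of `K L`. -/
def kForm (s : Sec (kBundle JM JL)) : OneForm L :=
  BundleHom.ofSec (fun x => kEval x (s x)) fun X x => smoothAt_kEval (s.contMDiff x) (X.contMDiff x)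

@[simp] theorem kForm_apply (s : Sec (kBundle JM JL)) (x : M) :
    kForm s x = kEval x (s x) := rfl

variable (JM JL) in
/-- The complex structure `η ↦ J ∘ η` of `K L`. -/
def kComplexStr : ComplexStr (kBundle JM JL) where
  toBundleHom := BundleHom.ofSec (fun x =>
    { toFun := fun η => kMk x (JL x ∘ₗ kEval x η) fun X => congrArg (JL x) (kEval_JM η X)
      map_add' := fun η η' => kEval_injective x (LinearMap.ext fun X =>
        map_add (JL x) (kEval x η X) (kEval x η' X))
      map_smul' := fun c η => kEval_injective x (LinearMap.ext fun X =>
        map_smul (JL x) c (kEval x η X)) })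
    fun ψ x => smoothAt_kBundle_of_forall fun Y =>
      SmoothVB.SmoothAt.map (smoothAt_kEval (ψ.contMDiff x) (Y.contMDiff x)) JL.toBundleHom
  sq x η := kEval_injective x (by
    ext X
    rw [map_neg]
    exact JL.sq x (kEval x η X))

theorem kEval_kComplexStr (x : M) (η : (kBundle JM JL).fiber x) (X : (TM M).fiber x) :
    kEval x (kComplexStr JM JL x η) X = JL x (kEval x η X) := rfl

end KBundle

/-! ### Direct sums of vector bundles. -/

section DirectSum

variable {M : Type u} [TopologicalSpace M] [ChartedSpace (EuclideanSpace ℝ (Fin 2)) M]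
  [IsManifold (𝓡 2) ∞ M] (V : SmoothVB.{u, v} M) (W : SmoothVB.{u, v} M)

/-- The direct sum of two vector bundles. -/
def SmoothVB.prod : SmoothVB.{u, v} M where
  F := V.F × W.F
  fiber := V.fiber ×ᵇ W.fiber

theorem SmoothVB.rank_prod : (V.prod W).rank = V.rank + W.rank :=
  Module.finrank_prod

variable {V W}

theorem SmoothVB.smoothAt_prod {s : ∀ x, V.fiber x × W.fiber x} {x : M} :
    (V.prod W).SmoothAt s x ↔ V.SmoothAt (fun y => (s y).1) x ∧ W.SmoothAt (fun y => (s y).2) x := by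
  refine (contMDiffAt_section (F := V.F × W.F) (E := V.fiber ×ᵇ W.fiber) x).trans ?_
  refine Iff.trans ⟨fun h => ?_, fun h => ?_⟩
    (and_congr (contMDiffAt_section x).symm (contMDiffAt_section x).symm)
  · exact ⟨(ContinuousLinearMap.fst ℝ V.F W.F).contMDiff.contMDiffAt.comp x h,
      (ContinuousLinearMap.snd ℝ V.F W.F).contMDiff.contMDiffAt.comp x h⟩
  · exact h.1.prodMk_space h.2

variable [T2Space M] [SigmaCompactSpace M]

namespace SmoothVB

/-- The first projection. -/
def fst : BundleHom (V.prod W) V :=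
  BundleHom.ofSec (fun x => LinearMap.fst ℝ (V.fiber x) (W.fiber x)) fun ψ x =>
    (smoothAt_prod.mp (ψ.contMDiff x)).1

/-- The second projection. -/
def snd : BundleHom (V.prod W) W :=
  BundleHom.ofSec (fun x => LinearMap.snd ℝ (V.fiber x) (W.fiber x)) fun ψ x =>
    (smoothAt_prod.mp (ψ.contMDiff x)).2

/-- The pairing of two bundle homomorphisms. -/
def pair {Z : SmoothVB.{u, w} M} (A : BundleHom Z V) (B : BundleHom Z W) :
    BundleHom Z (V.prod W) :=
  BundleHom.ofSec (fun x => (A x).prod (B x)) fun ψ x =>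
    smoothAt_prod.mpr ⟨(A.app ψ).contMDiff x, (B.app ψ).contMDiff x⟩

theorem prod_ext {x : M} {z z' : (V.prod W).fiber x} (h1 : fst x z = fst x z')
    (h2 : snd x z = snd x z') : z = z' := Prod.ext h1 h2

theorem fst_surjective (x : M) : Function.Surjective (fst (V := V) (W := W) x) :=
  fun z => ⟨(z, 0), rfl⟩

end SmoothVB

end DirectSum

/-! ### Existence of connections. -/

section Connections

variable {M : Type u} [TopologicalSpace M] [ChartedSpace (EuclideanSpace ℝ (Fin 2)) M]
  [IsManifold (𝓡 2) ∞ M]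

/-- A connection on a vector bundle. -/
def RealOp.IsConnection {V : SmoothVB.{u, v} M} (L : RealOp V V) : Prop :=
  ∀ (f : C^∞⟮𝓡 2, M; ℝ⟯) ψ x X, L (ψ.fsmul f) x X = f x • L ψ x X + dfun f x X • ψ x

variable [T2Space M] [SigmaCompactSpace M]

/-- The connection is `∑ e_i⁻¹ d(ρ_i e_i ψ)` for trivializations `e_i` and a subordinate partition
of unity. With `ρ_i` inside the derivative, the differentiated functions are globally smooth, and
the Leibniz terms add up to `∑ ρ_i df ψ = df ψ`. -/
theorem SmoothVB.exists_isConnection (V : SmoothVB.{u, v} M) :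
    ∃ L : RealOp V V, L.IsConnection := by
  set e := fun i : M => trivializationAt V.F V.fiber i
  obtain ⟨ρ, hρ⟩ := SmoothPartitionOfUnity.exists_isSubordinate (𝓡 2) isClosed_univ
    (fun i => (e i).baseSet) (fun i => (e i).open_baseSet)
    (fun x _ => Set.mem_iUnion.mpr ⟨x, FiberBundle.mem_baseSet_trivializationAt' x⟩)
  let g : M → Sec V → M → V.F := fun i ψ x => ρ i x • (e i).linearMapAt ℝ x (ψ x)
  have hg0 : ∀ i ψ x, x ∉ tsupport (ρ i) → g i ψ =ᶠ[𝓝 x] 0 := fun i ψ x hx => by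
    filter_upwards [(isClosed_tsupport (ρ i)).isOpen_compl.eventually_mem hx] with y hy
    change ρ i y • _ = 0
    rw [image_eq_zero_of_notMem_tsupport hy, zero_smul]
  have hgs : ∀ i ψ, ContMDiff (𝓡 2) 𝓘(ℝ, V.F) ∞ (g i ψ) := fun i ψ x => by
    by_cases hx : x ∈ tsupport (ρ i)
    · have hx' : x ∈ (e i).baseSet := hρ i hx
      refine ((ρ i).contMDiff.contMDiffAt).smul ?_
      refine (((e i).contMDiffAt_section_iff hx').mp (ψ.contMDiff x)).congr_of_eventuallyEq ?_
      filter_upwards [(e i).open_baseSet.eventually_mem hx'] with y hy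
      rw [Trivialization.linearMapAt_apply, if_pos hy]
    · exact contMDiffAt_const.congr_of_eventuallyEq (hg0 i ψ x hx)
  have hgd : ∀ i ψ x, MDifferentiableAt (𝓡 2) 𝓘(ℝ, V.F) (g i ψ) x := fun i ψ x =>
    (hgs i ψ).mdifferentiable (by simp) x
  let T : M → Sec V → ∀ x, (TM M).fiber x →ₗ[ℝ] V.fiber x := fun i ψ x =>
    (e i).symmₗ ℝ x ∘ₗ (mvfderiv (𝓡 2) (g i ψ) x : TangentSpace (𝓡 2) x →ₗ[ℝ] V.F)
  have hT0 : ∀ i ψ x, x ∉ tsupport (ρ i) → T i ψ x = 0 := fun i ψ x hx => by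
    have h1 : mvfderiv (𝓡 2) (g i ψ) x = 0 := by
      have h2 : mfderiv (𝓡 2) 𝓘(ℝ, V.F) (g i ψ) x = mfderiv (𝓡 2) 𝓘(ℝ, V.F) (0 : M → V.F) x :=
        (hg0 i ψ x hx).mfderiv_eq
      have h3 : mvfderiv (𝓡 2) (0 : M → V.F) x = 0 := mvfderiv_zero
      exact h2.trans h3
    ext X
    change (e i).symmₗ ℝ x (mvfderiv (𝓡 2) (g i ψ) x X) = 0
    rw [h1]
    exact map_zero _
  have hfin : ∀ ψ x, (Function.support fun i => T i ψ x).Finite := fun ψ x =>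
    (ρ.locallyFinite.closure.point_finite x).subset fun i hi => by
      by_contra hx
      exact hi (hT0 i ψ x hx)
  have happ : ∀ ψ x X, (∑ᶠ i, T i ψ x) X = ∑ᶠ i, T i ψ x X := fun ψ x X =>
    map_finsum (LinearMap.applyₗ (R := ℝ) X) (hfin ψ x)
  have hfin' : ∀ ψ x X, (Function.support fun i => T i ψ x X).Finite := fun ψ x X =>
    (hfin ψ x).subset fun i hi h =>
      hi (congrArg (fun l : (TM M).fiber x →ₗ[ℝ] V.fiber x => l X) h)
  have hsm : ∀ ψ (X : Sec (TM M)) x, V.SmoothAt (fun y => (∑ᶠ i, T i ψ y) (X y)) x :=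
    fun ψ X x => by
    simp only [happ]
    refine ContMDiff.contMDiffAt ?_
    refine ContMDiff.finsum_section_of_locallyFinite (t := fun i x => T i ψ x (X x)) ?_
      fun i x => ?_
    · refine ρ.locallyFinite.closure.subset fun i x hx => ?_
      by_contra hx'
      exact hx (by rw [hT0 i ψ x hx', LinearMap.zero_apply])
    · by_cases hx : x ∈ tsupport (ρ i)
      · have hx' : x ∈ (e i).baseSet := hρ i hx
        refine ((e i).contMDiffAt_section_iff hx').mpr ?_
        refine (contMDiff_mfderiv_apply (hgs i ψ) X x).congr_of_eventuallyEq ?_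
        filter_upwards [(e i).open_baseSet.eventually_mem hx'] with y hy
        change (e i ⟨y, (e i).symmₗ ℝ y _⟩).2 = _
        rw [Trivialization.symmₗ_apply _ hy, (e i).apply_mk_symm hy]
        rfl
      · have h0 : V.SmoothAt (fun _ => 0) x := (0 : Sec V).contMDiff x
        refine h0.congr_of_eventuallyEq ?_
        filter_upwards [(isClosed_tsupport (ρ i)).isOpen_compl.eventually_mem hx] with y hy
        rw [hT0 i ψ y hy]
        rfl
  have hadd : ∀ ψ φ x X, (∑ᶠ i, T i (ψ + φ) x) X = (∑ᶠ i, T i ψ x) X + (∑ᶠ i, T i φ x) X :=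
    fun ψ φ x X => by
    rw [happ, happ, happ, ← finsum_add_distrib (hfin' ψ x X) (hfin' φ x X)]
    refine finsum_congr fun i => ?_
    have h1 : g i (ψ + φ) = g i ψ + g i φ := by
      funext y
      change ρ i y • (e i).linearMapAt ℝ y (ψ y + φ y) = _
      rw [map_add, smul_add]
      rfl
    change (e i).symmₗ ℝ x (mvfderiv (𝓡 2) (g i (ψ + φ)) x X) = _
    rw [h1, mvfderiv_add (hgd i ψ x) (hgd i φ x)]
    exact map_add ((e i).symmₗ ℝ x) _ _
  have hleib : ∀ (f : C^∞⟮𝓡 2, M; ℝ⟯) ψ x X, (∑ᶠ i, T i (ψ.fsmul f) x) X =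
      f x • (∑ᶠ i, T i ψ x) X + dfun f x X • ψ x := fun f ψ x X => by
    have h1 : ∀ i, T i (ψ.fsmul f) x X = f x • T i ψ x X + ρ i x • dfun f x X • ψ x := fun i => by
      have h2 : g i (ψ.fsmul f) = fun y => f y • g i ψ y := by
        funext y
        change ρ i y • (e i).linearMapAt ℝ y (f y • ψ y) = _
        rw [map_smul, smul_comm]
      have h3 : mvfderiv (𝓡 2) (g i (ψ.fsmul f)) x X =
          f x • mvfderiv (𝓡 2) (g i ψ) x X + dfun f x X • g i ψ x := by
        rw [h2]
        have := mvfderiv_smul (I := 𝓡 2) (f.contMDiff.mdifferentiable (by simp) x) (hgd i ψ x)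
        exact congrArg (fun l : TangentSpace (𝓡 2) x →L[ℝ] V.F => l X) this
      change (e i).symmₗ ℝ x (mvfderiv (𝓡 2) (g i (ψ.fsmul f)) x X) = _
      rw [h3, map_add, map_smul, map_smul]
      congr 1
      change dfun f x X • (e i).symmₗ ℝ x (ρ i x • (e i).linearMapAt ℝ x (ψ x)) = _
      rw [map_smul, smul_comm]
      by_cases hx : x ∈ tsupport (ρ i)
      · rw [Trivialization.symmₗ_linearMapAt _ (hρ i hx)]
      · rw [image_eq_zero_of_notMem_tsupport hx, zero_smul, zero_smul]
    have h4 : (Function.support fun i => ρ i x • dfun f x X • ψ x).Finite :=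
      (ρ.locallyFinite.point_finite x).subset fun i hi => left_ne_zero_of_smul hi
    have h5 : (Function.support fun i => f x • T i ψ x X).Finite :=
      (hfin' ψ x X).subset fun i hi => right_ne_zero_of_smul hi
    rw [happ, happ, finsum_congr h1, finsum_add_distrib h5 h4, ← smul_finsum' _ (hfin' ψ x X),
      ← finsum_smul, ρ.sum_eq_one (Set.mem_univ x), one_smul]
  refine ⟨⟨fun ψ => BundleHom.ofSec (fun x => ∑ᶠ i, T i ψ x) (hsm ψ), hadd, fun c ψ x X => ?_⟩,
    hleib⟩
  have h := hleib ⟨fun _ => c, contMDiff_const⟩ ψ x X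
  have h0 : dfun (⟨fun _ => c, contMDiff_const⟩ : C^∞⟮𝓡 2, M; ℝ⟯) x X = 0 :=
    congrArg (fun l : TangentSpace (𝓡 2) x →L[ℝ] ℝ => l X) mfderiv_const
  rw [h0, zero_smul, add_zero] at h
  exact h

end Connections

/-! ### Curvature, and connections with prescribed `K̄`-part. -/

section Curvature

variable {M : Type u} [TopologicalSpace M] [ChartedSpace (EuclideanSpace ℝ (Fin 2)) M]
  [IsManifold (𝓡 2) ∞ M] [T2Space M] [SigmaCompactSpace M]
  {V : SmoothVB.{u, v} M} {W : SmoothVB.{u, w} M}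

namespace RealOp

variable {L : RealOp V W} {p : BundleHom V W}

theorem extDeriv_add (ξ η : OneForm V) (X Y : Sec (TM M)) (x : M) :
    L.extDeriv p (ξ + η) X Y x = L.extDeriv p ξ X Y x + L.extDeriv p η X Y x := by
  have h : ∀ Z : Sec (TM M), (ξ + η).app Z = ξ.app Z + η.app Z := fun _ => rfl
  rw [extDeriv, extDeriv, extDeriv, h, h, L.map_add, L.map_add, BundleHom.add_apply,
    _root_.map_add]
  abel

/-- The exterior derivative of a form along two vector fields as a section. -/
def extDerivSec (L : RealOp V W) (p : BundleHom V W) (ξ : OneForm V) (X Y : Sec (TM M)) : Sec W :=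
  (L (ξ.app Y)).app X - (L (ξ.app X)).app Y - p.app (ξ.app (X.bracket Y))

variable (hL : ∀ (f : C^∞⟮𝓡 2, M; ℝ⟯) ψ x X, L (ψ.fsmul f) x X = f x • L ψ x X +
  dfun f x X • p x (ψ x))

include hL in
/-- The curvature of a connection lifting a first order operator is function linear. -/
theorem extDeriv_connection_fsmul {C : RealOp V V} (hC : C.IsConnection)
    (hCL : ∀ ψ x X, p x (C ψ x X) = L ψ x X) (f : C^∞⟮𝓡 2, M; ℝ⟯) (φ : Sec V)
    (X Y : Sec (TM M)) (x : M) :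
    L.extDeriv p (C (φ.fsmul f)) X Y x = f x • L.extDeriv p (C φ) X Y x := by
  have h1 : ∀ Z : Sec (TM M), (C (φ.fsmul f)).app Z =
      ((C φ).app Z).fsmul f + φ.fsmul (Z.deriv f) := fun Z => by
    ext y
    exact hC f φ y (Z y)
  -- The second derivatives of `f` occur only in `X (Y f) - Y (X f) - [X, Y] f`, which is zero; the
  -- first derivatives cancel because `p C = L`.
  have h2 := dfun_bracket X Y f x
  rw [Sec.bracket_apply] at h2
  rw [extDeriv, extDeriv, h1, h1, L.map_add, L.map_add, hL, hL, hL, hL, hC, BundleHom.app_apply,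
    BundleHom.app_apply, hCL, hCL, h2, _root_.map_add, _root_.map_smul, _root_.map_smul,
    Sec.deriv_apply, Sec.deriv_apply]
  module

theorem extDeriv_connection_add {C : RealOp V V} (φ φ' : Sec V) (X Y : Sec (TM M)) (x : M) :
    L.extDeriv p (C (φ + φ')) X Y x =
      L.extDeriv p (C φ) X Y x + L.extDeriv p (C φ') X Y x := by
  rw [← extDeriv_add]
  congr 1
  ext y Z
  exact C.map_add φ φ' y Z

end RealOp

/-- Every holomorphic structure is the `K̄`-part of a connection. -/
theorem HolStr.exists_isConnection {JM : ComplexStr (TM M)} {J : ComplexStr V}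
    (D : HolStr JM J) : ∃ C : RealOp V V, C.IsConnection ∧
      ∀ ψ x X, C.kbarPart JM J ψ x X = D ψ x X := by
  obtain ⟨C, hC⟩ := V.exists_isConnection
  -- The `K̄`-part of an arbitrary connection is exchanged for `D`, which obeys the same Leibniz
  -- rule.
  have hval : ∀ ψ x X, (C.kPartForm JM J ψ + D ψ) x X = C.kPart JM J ψ x X + D ψ x X :=
    fun _ _ _ => rfl
  refine ⟨⟨fun ψ => C.kPartForm JM J ψ + D ψ, fun ψ φ x X => ?_, fun c ψ x X => ?_⟩,
    fun f ψ x X => ?_, fun ψ x X => ?_⟩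
  · rw [hval, hval, hval, RealOp.kPart_add, D.map_add]
    abel
  · rw [hval, hval, D.map_smul, RealOp.kPart, RealOp.kPart, C.map_smul, C.map_smul, map_smul]
    module
  · change (C.kPartForm JM J _ + D _) x X = f x • (C.kPartForm JM J _ + D _) x X + _
    rw [hval, hval, D.leibniz, RealOp.kPart, RealOp.kPart, hC, hC, map_add, map_smul, map_smul]
    module
  · rw [RealOp.kbarPart]
    change (1 / 2 : ℝ) • ((C.kPartForm JM J _ + D _) x X +
      J x ((C.kPartForm JM J _ + D _) x (JM x X))) = _
    rw [hval, hval, RealOp.kPart_JM, D.type_kbar, map_add, map_neg, J.sq, J.sq]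
    module

end Curvature

/-! ### Inductive construction of the tower `V_{n+1} = V_n ⊕ K N_n`. -/

section Stages

variable {M : Type u} [TopologicalSpace M] [ChartedSpace (EuclideanSpace ℝ (Fin 2)) M]
  [IsManifold (𝓡 2) ∞ M] [T2Space M] [SigmaCompactSpace M]

/-- One step `π : E → W` of a jet tower: the kernel of `π` is identified with the complex bundle
`L`, and the operator `d` is lifted by a connection annihilated by `d`. -/
structure JetStage (JM : ComplexStr (TM M)) where
  W : SmoothVB.{u, v} M
  E : SmoothVB.{u, v} M
  L : SmoothVB.{u, v} M
  JL : ComplexStr L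
  p : BundleHom E W
  incl : BundleHom L E
  retr : BundleHom E L
  p_incl : ∀ x l, p x (incl x l) = 0
  incl_retr : ∀ x z, p x z = 0 → incl x (retr x z) = z
  d : RealOp E W
  d_leibniz : ∀ (f : C^∞⟮𝓡 2, M; ℝ⟯) ψ x X,
    d (ψ.fsmul f) x X = f x • d ψ x X + dfun f x X • p x (ψ x)
  conn : RealOp E E
  isConnection : conn.IsConnection
  p_conn : ∀ ψ x X, p x (conn ψ x X) = d ψ x X
  d_conn : ∀ ψ X Y x, d.extDeriv p (conn ψ) X Y x = 0
  d_kForm : ∀ (s : Sec (kBundle JM JL)) X Y x, d.extDeriv p (incl.comp (kForm s)) X Y x = 0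

namespace JetStage

variable {JM : ComplexStr (TM M)} (𝒮 : JetStage.{u, v} JM)

/-- The bundle `K L`. -/
abbrev K : SmoothVB.{u, v} M := kBundle JM 𝒮.JL

/-- The next bundle `E ⊕ K L`. -/
abbrev nextE : SmoothVB.{u, v} M := 𝒮.E.prod 𝒮.K

/-- The inclusion of `K L`. -/
def nextIncl : BundleHom 𝒮.K 𝒮.nextE := SmoothVB.pair 0 (BundleHom.id _)

/-- The operator `d (ψ, s) = ∇ ψ + s`. -/
def nextD : RealOp 𝒮.nextE 𝒮.E where
  toFun φ := 𝒮.conn (SmoothVB.fst.app φ) + 𝒮.incl.comp (kForm (SmoothVB.snd.app φ))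
  map_add ψ φ x X := by
    rw [BundleHom.add_apply, BundleHom.app_add, RealOp.map_add, BundleHom.app_add]
    change _ + 𝒮.incl x (kEval x (SmoothVB.snd.app ψ x + SmoothVB.snd.app φ x) X) =
      _ + 𝒮.incl x (kEval x _ X) + (_ + 𝒮.incl x (kEval x _ X))
    rw [map_add, LinearMap.add_apply, map_add]
    abel
  map_smul c ψ x X := by
    rw [BundleHom.add_apply, BundleHom.app_smul, RealOp.map_smul, BundleHom.app_smul]
    change _ + 𝒮.incl x (kEval x (c • SmoothVB.snd.app ψ x) X) =
      c • (_ + 𝒮.incl x (kEval x _ X))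
    rw [map_smul, LinearMap.smul_apply, map_smul, smul_add]

theorem nextD_apply (φ : Sec 𝒮.nextE) (x : M) (X : (TM M).fiber x) : 𝒮.nextD φ x X =
    𝒮.conn (SmoothVB.fst.app φ) x X + 𝒮.incl x (kEval x (SmoothVB.snd x (φ x)) X) := rfl

theorem nextD_leibniz (f : C^∞⟮𝓡 2, M; ℝ⟯) (φ : Sec 𝒮.nextE) (x : M) (X : (TM M).fiber x) :
    𝒮.nextD (φ.fsmul f) x X = f x • 𝒮.nextD φ x X + dfun f x X • SmoothVB.fst x (φ x) := by
  rw [nextD_apply, nextD_apply, BundleHom.app_fsmul, 𝒮.isConnection, Sec.fsmul_apply,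
    map_smul, map_smul, LinearMap.smul_apply, map_smul, BundleHom.app_apply]
  module

theorem p_nextD (φ : Sec 𝒮.nextE) (x : M) (X : (TM M).fiber x) :
    𝒮.p x (𝒮.nextD φ x X) = 𝒮.d (SmoothVB.fst.app φ) x X := by
  rw [nextD_apply, map_add, 𝒮.p_conn, 𝒮.p_incl, add_zero]

theorem d_nextD (φ : Sec 𝒮.nextE) (X Y : Sec (TM M)) (x : M) :
    𝒮.d.extDeriv 𝒮.p (𝒮.nextD φ) X Y x = 0 := by
  change 𝒮.d.extDeriv 𝒮.p (𝒮.conn _ + 𝒮.incl.comp (kForm _)) X Y x = 0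
  rw [RealOp.extDeriv_add, 𝒮.d_conn, 𝒮.d_kForm, add_zero]

theorem extDeriv_nextIncl (ξ : OneForm 𝒮.K) (X Y : Sec (TM M)) (x : M) :
    𝒮.nextD.extDeriv SmoothVB.fst (𝒮.nextIncl.comp ξ) X Y x =
      𝒮.incl x (kEval x (ξ x (Y x)) (X x) - kEval x (ξ x (X x)) (Y x)) := by
  have h : ∀ Z : Sec (TM M), SmoothVB.fst.app ((𝒮.nextIncl.comp ξ).app Z) = 0 := fun Z => rfl
  have h1 : ∀ z : (TM M).fiber x, SmoothVB.fst x ((𝒮.nextIncl.comp ξ) x z) = 0 := fun z => rfl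
  rw [RealOp.extDeriv, h1, nextD_apply, nextD_apply, h, h, RealOp.map_zero, RealOp.map_zero,
    map_sub, sub_zero, zero_add, zero_add]
  rfl

/-- The direct sum of `d` and a connection on `K L` is a connection `C₀` lifting `d`. Its curvature
`B = d C₀` is tensorial and alternating, and `p B = 0` because the preceding operators compose to
zero; so `B` comes from an `L`-valued 2-form `r`. Adding a `K L`-valued form `α` to `C₀` changes the
curvature by `α(Y)(X) - α(X)(Y)`, and `α` is chosen to make this `-r`. -/
theorem exists_nextConn : ∃ C : RealOp 𝒮.nextE 𝒮.nextE, C.IsConnection ∧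
    (∀ φ x X, SmoothVB.fst x (C φ x X) = 𝒮.nextD φ x X) ∧
    ∀ φ X Y x, 𝒮.nextD.extDeriv SmoothVB.fst (C φ) X Y x = 0 := by
  obtain ⟨CK, hCK⟩ := 𝒮.K.exists_isConnection
  let C₀ : RealOp 𝒮.nextE 𝒮.nextE :=
    { toFun := fun φ => SmoothVB.pair (𝒮.nextD φ) (CK (SmoothVB.snd.app φ))
      map_add := fun φ φ' x X => SmoothVB.prod_ext (𝒮.nextD.map_add φ φ' x X)
        ((congrArg (fun s => CK s x X) (BundleHom.app_add _ _ _)).trans (CK.map_add _ _ x X))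
      map_smul := fun c φ x X => SmoothVB.prod_ext (𝒮.nextD.map_smul c φ x X)
        ((congrArg (fun s => CK s x X) (BundleHom.app_smul _ _ _)).trans (CK.map_smul _ _ x X)) }
  have hC₀ : C₀.IsConnection := fun f φ x X => SmoothVB.prod_ext (𝒮.nextD_leibniz f φ x X)
    ((congrArg (fun s => CK s x X) (BundleHom.app_fsmul _ _ _)).trans (hCK f _ x X))
  have hfst : ∀ φ x X, SmoothVB.fst x (C₀ φ x X) = 𝒮.nextD φ x X := fun φ x X => rfl
  choose B hB using fun φ => RealOp.exists_extDeriv_eq 𝒮.nextD_leibniz (C₀ φ)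
  have hBadd : ∀ φ φ' x X Y, B (φ + φ') x X Y = B φ x X Y + B φ' x X Y := fun φ φ' x X Y => by
    obtain ⟨X, rfl⟩ := Sec.exists_apply_eq _ x X
    obtain ⟨Y, rfl⟩ := Sec.exists_apply_eq _ x Y
    rw [← hB, ← hB, ← hB, RealOp.extDeriv_connection_add]
  have hBsmul : ∀ (f : C^∞⟮𝓡 2, M; ℝ⟯) φ x X Y, B (φ.fsmul f) x X Y = f x • B φ x X Y :=
    fun f φ x X Y => by
    obtain ⟨X, rfl⟩ := Sec.exists_apply_eq _ x X
    obtain ⟨Y, rfl⟩ := Sec.exists_apply_eq _ x Y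
    rw [← hB, ← hB, RealOp.extDeriv_connection_fsmul 𝒮.nextD_leibniz hC₀ hfst]
  have hBswap : ∀ φ x X Y, B φ x X Y = -B φ x Y X := fun φ x X Y => by
    obtain ⟨X, rfl⟩ := Sec.exists_apply_eq _ x X
    obtain ⟨Y, rfl⟩ := Sec.exists_apply_eq _ x Y
    rw [← hB, ← hB, RealOp.extDeriv_swap]
  have hpB : ∀ φ x X Y, 𝒮.p x (B φ x X Y) = 0 := fun φ x X Y => by
    obtain ⟨X, rfl⟩ := Sec.exists_apply_eq _ x X
    obtain ⟨Y, rfl⟩ := Sec.exists_apply_eq _ x Y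
    rw [← hB, ← 𝒮.d_nextD φ X Y x, RealOp.extDeriv, RealOp.extDeriv, map_sub, map_sub, p_nextD,
      p_nextD, hfst]
    rfl
  let r : ∀ (_ : Sec 𝒮.nextE) x, (TM M).fiber x →ₗ[ℝ] (TM M).fiber x →ₗ[ℝ] 𝒮.L.fiber x :=
    fun φ x => (B φ x).compr₂ (𝒮.retr x)
  have hr : ∀ φ x X Y, r φ x X Y = 𝒮.retr x (B φ x X Y) := fun φ x X Y => rfl
  -- `β(X, ·)` is the `K`-part of `r(X, ·)`. Its antisymmetrization recovers `-r`, because the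
  -- `J`-terms add up to `½ J (r(X, J Y) + r(J X, Y))`, which vanishes on a complex line.
  let β : ∀ (_ : Sec 𝒮.nextE) x, (TM M).fiber x →ₗ[ℝ] (TM M).fiber x →ₗ[ℝ] 𝒮.L.fiber x :=
    fun φ x => (1 / 2 : ℝ) • (r φ x - ((r φ x).compl₁₂ LinearMap.id (JM x)).compr₂ (𝒮.JL x))
  have hβ : ∀ φ x X Z, β φ x X Z =
      (1 / 2 : ℝ) • (r φ x X Z - 𝒮.JL x (r φ x X (JM x Z))) := fun φ x X Z => rfl
  have hβJ : ∀ φ x X Z, β φ x X (JM x Z) = 𝒮.JL x (β φ x X Z) := fun φ x X Z => by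
    rw [hβ, hβ, JM.sq, map_neg, map_neg, map_smul, map_sub, 𝒮.JL.sq]
    module
  have hβs : ∀ φ (X Y : Sec (TM M)) x, 𝒮.L.SmoothAt (fun y => β φ y (X y) (Y y)) x :=
    fun φ X Y x => by
    refine (((1 / 2 : ℝ) • (𝒮.retr.app (𝒮.nextD.extDerivSec SmoothVB.fst (C₀ φ) X Y) -
      𝒮.JL.app (𝒮.retr.app (𝒮.nextD.extDerivSec SmoothVB.fst (C₀ φ) X
        (JM.app Y))))).contMDiff x).congr_of_eventuallyEq (.of_forall fun y => ?_)
    refine congrArg (TotalSpace.mk y) ?_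
    change β φ y (X y) (Y y) = (1 / 2 : ℝ) • (𝒮.retr y (𝒮.nextD.extDeriv SmoothVB.fst (C₀ φ) X Y y) -
      𝒮.JL y (𝒮.retr y (𝒮.nextD.extDeriv SmoothVB.fst (C₀ φ) X (JM.app Y) y)))
    rw [hB, hB]
    rfl
  let α : Sec 𝒮.nextE → OneForm 𝒮.K := fun φ => BundleHom.ofSec (fun x =>
    { toFun := fun X => kMk x (β φ x X) (hβJ φ x X)
      map_add' := fun X Y => kEval_injective x ((β φ x).map_add X Y)
      map_smul' := fun c X => kEval_injective x ((β φ x).map_smul c X) })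
    fun X x => smoothAt_kBundle_of_forall fun Y => hβs φ X Y x
  have hα : ∀ φ x X Z, kEval x (α φ x X) Z = β φ x X Z := fun φ x X Z => rfl
  have hαadd : ∀ φ φ' x X, α (φ + φ') x X = α φ x X + α φ' x X := fun φ φ' x X =>
    kEval_injective x <| LinearMap.ext fun Z => by
    rw [map_add, LinearMap.add_apply, hα, hα, hα, hβ, hβ, hβ, hr, hr, hr, hr, hr, hr, hBadd, hBadd,
      map_add, map_add, map_add]
    module
  have hαsmul : ∀ (f : C^∞⟮𝓡 2, M; ℝ⟯) φ x X, α (φ.fsmul f) x X = f x • α φ x X :=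
    fun f φ x X => kEval_injective x <| LinearMap.ext fun Z => by
    rw [map_smul, LinearMap.smul_apply, hα, hα, hβ, hβ, hr, hr, hr, hr, hBsmul, hBsmul,
      map_smul, map_smul, map_smul]
    module
  let C : RealOp 𝒮.nextE 𝒮.nextE :=
    { toFun := fun φ => C₀ φ + 𝒮.nextIncl.comp (α φ)
      map_add := fun φ φ' x X => by
        change C₀ _ x X + 𝒮.nextIncl x (α _ x X) = C₀ _ x X + 𝒮.nextIncl x (α _ x X) +
          (C₀ _ x X + 𝒮.nextIncl x (α _ x X))
        rw [C₀.map_add, hαadd, map_add]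
        abel
      map_smul := fun c φ x X => by
        have h := hαsmul ⟨fun _ => c, contMDiff_const⟩ φ x X
        change α (c • φ) x X = c • α φ x X at h
        change C₀ _ x X + 𝒮.nextIncl x (α _ x X) = c • (C₀ _ x X + 𝒮.nextIncl x (α _ x X))
        rw [C₀.map_smul, h, map_smul, smul_add] }
  refine ⟨C, fun f φ x X => ?_, fun φ x X => ?_, fun φ X Y x => ?_⟩
  · change C₀ _ x X + 𝒮.nextIncl x (α _ x X) = f x • (C₀ _ x X + 𝒮.nextIncl x (α _ x X)) + _
    rw [hC₀, hαsmul, map_smul]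
    module
  · change SmoothVB.fst x (C₀ φ x X + 𝒮.nextIncl x (α φ x X)) = _
    rw [map_add, hfst]
    exact add_zero _
  · change 𝒮.nextD.extDeriv SmoothVB.fst (C₀ φ + 𝒮.nextIncl.comp (α φ)) X Y x = 0
    have h1 : β φ x (Y x) (X x) - β φ x (X x) (Y x) = -r φ x (X x) (Y x) := by
      have hswap : ∀ X Y, r φ x X Y = -r φ x Y X := fun X Y => by
        rw [hr, hr, hBswap, map_neg]
      have h2 := congrArg (𝒮.JL x)
        (alternating_complex (finrank_tangent x) (JM.sq x) (r φ x) hswap (X x) (Y x))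
      rw [map_add, map_zero] at h2
      rw [hβ, hβ, hswap (Y x) (X x), hswap (Y x) (JM x (X x)), map_neg]
      linear_combination (norm := module) (1 / 2 : ℝ) • h2
    rw [RealOp.extDeriv_add, hB, extDeriv_nextIncl, hα, hα, h1, map_neg, hr,
      𝒮.incl_retr _ _ (hpB φ x _ _), add_neg_cancel]

/-- The next step of the tower. -/
def next : JetStage.{u, v} JM where
  W := 𝒮.E
  E := 𝒮.nextE
  L := 𝒮.K
  JL := kComplexStr JM 𝒮.JL
  p := SmoothVB.fst
  incl := 𝒮.nextIncl
  retr := SmoothVB.snd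
  p_incl x l := rfl
  incl_retr x z h := SmoothVB.prod_ext h.symm rfl
  d := 𝒮.nextD
  d_leibniz := 𝒮.nextD_leibniz
  conn := 𝒮.exists_nextConn.choose
  isConnection := 𝒮.exists_nextConn.choose_spec.1
  p_conn := 𝒮.exists_nextConn.choose_spec.2.1
  d_conn := 𝒮.exists_nextConn.choose_spec.2.2
  d_kForm s X Y x := by
    -- A point of `K (K L)` is complex linear in both arguments, hence symmetric on a complex line,
    -- whereas the exterior derivative antisymmetrizes it.
    rw [extDeriv_nextIncl, kForm_apply, bilin_symm_of_complex (J := 𝒮.JL x) (finrank_tangent x)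
      (JM.sq x) (fun X => kEval x (kEval x (s x) X)) (fun X Y Z => by rw [map_add, map_add]; rfl)
      (fun c X Z => by rw [map_smul, map_smul]; rfl)
      (fun X Z => by rw [kEval_JM, kEval_kComplexStr]) (fun X Z => kEval_JM _ _) (X x) (Y x),
      sub_self, map_zero]

end JetStage

variable {JM : ComplexStr (TM M)} {V : SmoothVB.{u, v} M} {J : ComplexStr V}

namespace HolStr

variable (D : HolStr JM J)

/-- The bottom of the tower. -/
def baseStage : JetStage.{u, v} JM where
  W := V
  E := V
  L := V
  JL := J
  p := 0
  incl := BundleHom.id V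
  retr := BundleHom.id V
  p_incl _ _ := rfl
  incl_retr _ _ _ := rfl
  d := ⟨fun _ => 0, fun _ _ _ _ => (add_zero _).symm, fun _ _ _ _ => (smul_zero _).symm⟩
  d_leibniz f ψ x X := by
    change 0 = f x • (0 : V.fiber x) + dfun f x X • (0 : V.fiber x)
    rw [smul_zero, smul_zero, add_zero]
  conn := D.exists_isConnection.choose
  isConnection := D.exists_isConnection.choose_spec.1
  p_conn _ _ _ := rfl
  d_conn _ _ _ x := by
    change (0 : V.fiber x) - 0 - 0 = 0
    rw [sub_zero, sub_zero]
  d_kForm _ _ _ x := by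
    change (0 : V.fiber x) - 0 - 0 = 0
    rw [sub_zero, sub_zero]

theorem baseStage_kbarPart (ψ : Sec V) (x : M) (X : (TM M).fiber x) :
    D.baseStage.conn.kbarPart JM J ψ x X = D ψ x X :=
  D.exists_isConnection.choose_spec.2 ψ x X

/-- The steps of the tower. -/
def stage : ℕ → JetStage.{u, v} JM
  | 0 => D.baseStage
  | n + 1 => (stage n).next

theorem rank_stage_L (n : ℕ) : (D.stage n).L.rank = V.rank := by
  induction n with
  | zero => rfl
  | succ n ih => exact ih

theorem rank_stage_E (n : ℕ) : (D.stage n).E.rank = (n + 1) * V.rank := by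
  induction n with
  | zero => exact (by ring : V.rank = (0 + 1) * V.rank)
  | succ n ih =>
    have h : (D.stage (n + 1)).E.rank = (D.stage n).E.rank + (D.stage n).L.rank :=
      SmoothVB.rank_prod _ _
    rw [h, ih, rank_stage_L]
    ring

end HolStr

end Stages

/-! ### Assembling the holomorphic jet complex. -/

section Existence

variable {M : Type u} [TopologicalSpace M] [ChartedSpace (EuclideanSpace ℝ (Fin 2)) M]
  [IsManifold (𝓡 2) ∞ M] [T2Space M] [SigmaCompactSpace M]
  {JM : ComplexStr (TM M)} {V : SmoothVB.{u, v} M} {J : ComplexStr V}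

namespace HolStr

variable (D : HolStr JM J)

/-- The projections of the tower of `D`. -/
def towerPr : ∀ n, BundleHom (jetSeq V (fun n => (D.stage (n + 1)).E) (n + 1))
    (jetSeq V (fun n => (D.stage (n + 1)).E) n)
  -- Stage `n + 1` supplies the projection `V_{n+1} → V_n`. The case distinction, here and below,
  -- only serves to unfold `jetSeq`, whose bottom entry is `V` itself.
  | 0 => (D.stage 1).p
  | n + 1 => (D.stage (n + 2)).p

/-- The jet tower of `D`. -/
def tower : JetTower V where
  tail n := (D.stage (n + 1)).E
  rank_eq n := by
    cases n with
    | zero => exact D.rank_stage_E 0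
    | succ n => exact D.rank_stage_E (n + 1)
  pr := D.towerPr
  pr_surjective n x := by
    cases n with
    | zero => exact SmoothVB.fst_surjective x
    | succ n => exact SmoothVB.fst_surjective x

/-- The operators of the tower of `D`. -/
def towerD : ∀ n, RealOp (D.tower.E (n + 1)) (D.tower.E n)
  | 0 => (D.stage 1).d
  | n + 1 => (D.stage (n + 2)).d

/-- The inclusions of the kernels. -/
def towerIncl : ∀ n, BundleHom (D.stage n).L (D.tower.E n)
  | 0 => (D.stage 0).incl
  | n + 1 => (D.stage (n + 1)).incl

/-- The retractions to the kernels. -/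
def towerRetr : ∀ n, BundleHom (D.tower.E n) (D.stage n).L
  | 0 => (D.stage 0).retr
  | n + 1 => (D.stage (n + 1)).retr

theorem towerRetr_incl (n : ℕ) (x : M) (l : (D.stage n).L.fiber x) :
    D.towerRetr n x (D.towerIncl n x l) = l := by
  cases n with
  | zero => rfl
  | succ n => rfl

theorem towerIncl_mem (n : ℕ) (x : M) (l : (D.stage n).L.fiber x) :
    D.towerIncl n x l ∈ D.tower.N n x := by
  cases n with
  | zero => exact Submodule.mem_top
  | succ n =>
    change D.towerPr n x _ = 0
    cases n with
    | zero => rfl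
    | succ n => rfl

theorem towerIncl_retr {n : ℕ} {x : M} {w : (D.tower.E n).fiber x} (hw : w ∈ D.tower.N n x) :
    D.towerIncl n x (D.towerRetr n x w) = w := by
  cases n with
  | zero => rfl
  | succ n =>
    cases n with
    | zero => exact (D.stage 1).incl_retr x w hw
    | succ n => exact (D.stage (n + 2)).incl_retr x w hw

theorem towerD_leibniz (n : ℕ) (f : C^∞⟮𝓡 2, M; ℝ⟯) (ψ : Sec (D.tower.E (n + 1))) (x : M)
    (X : (TM M).fiber x) : D.towerD n (ψ.fsmul f) x X =
      f x • D.towerD n ψ x X + dfun f x X • D.tower.pr n x (ψ x) := by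
  cases n with
  | zero => exact (D.stage 1).d_leibniz f ψ x X
  | succ n => exact (D.stage (n + 2)).d_leibniz f ψ x X

/-- The inclusion of the kernel `K L` of `π`. -/
def towerInclK (n : ℕ) : BundleHom (D.stage n).K (D.tower.E (n + 1)) := D.towerIncl (n + 1)

/-- The retraction to the kernel `K L` of `π`. -/
def towerRetrK (n : ℕ) : BundleHom (D.tower.E (n + 1)) (D.stage n).K := D.towerRetr (n + 1)

theorem towerRetrK_incl (n : ℕ) (x : M) (l : (D.stage n).K.fiber x) :
    D.towerRetrK n x (D.towerInclK n x l) = l := D.towerRetr_incl (n + 1) x l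

theorem towerInclK_retr {n : ℕ} {x : M} {w : (D.tower.E (n + 1)).fiber x}
    (hw : w ∈ D.tower.N (n + 1) x) : D.towerInclK n x (D.towerRetrK n x w) = w :=
  D.towerIncl_retr hw

theorem towerD_of_mem {n : ℕ} {ψ : Sec (D.tower.E (n + 1))}
    (h : ∀ y, ψ y ∈ D.tower.N (n + 1) y) (x : M) (X : (TM M).fiber x) :
    D.towerD n ψ x X = D.towerIncl n x (kEval x (D.towerRetrK n x (ψ x)) X) := by
  -- On sections with vanishing first component the connection term of `d` disappears and only the
  -- `K L`-valued component remains.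
  have key : ∀ (𝒮 : JetStage.{u, v} JM) (φ : Sec 𝒮.nextE), (∀ y, SmoothVB.fst y (φ y) = 0) →
      𝒮.nextD φ x X = 𝒮.incl x (kEval x (SmoothVB.snd x (φ x)) X) := fun 𝒮 φ hφ => by
    have h0 : SmoothVB.fst.app φ = 0 := by
      ext y
      exact hφ y
    rw [𝒮.nextD_apply, h0, RealOp.map_zero, zero_add]
  cases n with
  | zero => exact key (D.stage 0) ψ h
  | succ n => exact key (D.stage (n + 1)) ψ h

/-- The complex structures of the kernels. -/
def towerJN (n : ℕ) (x : M) : D.tower.N n x →ₗ[ℝ] D.tower.N n x :=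
  (D.towerIncl n x ∘ₗ (D.stage n).JL x ∘ₗ D.towerRetr n x ∘ₗ
    (D.tower.N n x).subtype).codRestrict _ fun _ => D.towerIncl_mem n x _

theorem towerJN_apply (n : ℕ) (x : M) (w : D.tower.N n x) :
    (D.towerJN n x w : (D.tower.E n).fiber x) =
      D.towerIncl n x ((D.stage n).JL x (D.towerRetr n x w)) := rfl

theorem towerRetrK_towerJN (n : ℕ) (x : M) (w : D.tower.N (n + 1) x) :
    D.towerRetrK n x (D.towerJN (n + 1) x w) =
      kComplexStr JM (D.stage n).JL x (D.towerRetrK n x w) :=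
  D.towerRetr_incl (n + 1) x _

/-- The isomorphisms of the kernels of successive projections. -/
def towerDelta (n : ℕ) (x : M) :
    D.tower.N (n + 1) x →ₗ[ℝ] (TM M).fiber x →ₗ[ℝ] D.tower.N n x where
  toFun w := ((D.towerIncl n x ∘ₗ kEval x (D.towerRetrK n x w)).codRestrict _
    fun _ => D.towerIncl_mem n x _)
  map_add' w w' := LinearMap.ext fun X => Subtype.ext <| by
    change D.towerIncl n x (kEval x (D.towerRetrK n x (w.1 + w'.1)) X) =
      D.towerIncl n x (kEval x _ X) + D.towerIncl n x (kEval x _ X)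
    rw [map_add, map_add, LinearMap.add_apply, map_add]
  map_smul' c w := LinearMap.ext fun X => Subtype.ext <| by
    change D.towerIncl n x (kEval x (D.towerRetrK n x (c • w.1)) X) =
      c • D.towerIncl n x (kEval x _ X)
    rw [map_smul, map_smul, LinearMap.smul_apply, map_smul]

theorem towerDelta_apply (n : ℕ) (x : M) (w : D.tower.N (n + 1) x) (X : (TM M).fiber x) :
    (D.towerDelta n x w X : (D.tower.E n).fiber x) =
      D.towerIncl n x (kEval x (D.towerRetrK n x w) X) := rfl

theorem towerIncl_injective (n : ℕ) (x : M) : Function.Injective (D.towerIncl n x) :=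
  Function.LeftInverse.injective (D.towerRetr_incl n x)

/-- The holomorphic jet complex of `D`. -/
def jetComplex : JetComplex D where
  toJetTower := D.tower
  d := D.towerD
  d_leibniz := D.towerD_leibniz
  pr_d n ψ x X := by
    cases n with
    | zero => exact (D.stage 1).p_nextD ψ x X
    | succ n => exact (D.stage (n + 2)).p_nextD ψ x X
  d_d n ψ X Y x := by
    cases n with
    | zero => exact (D.stage 1).d_nextD ψ X Y x
    | succ n => exact (D.stage (n + 2)).d_nextD ψ X Y x
  JN := D.towerJN
  JN_sq n x w := Subtype.ext <| by
    rw [towerJN_apply, towerJN_apply, towerRetr_incl, (D.stage n).JL.sq, map_neg,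
      D.towerIncl_retr w.2]
    rfl
  JN_smooth n ψ h :=
    ((D.towerIncl n).app ((D.stage n).JL.app ((D.towerRetr n).app ψ))).contMDiff
  JN_zero _ _ := rfl
  exists_delta n x := by
    refine ⟨D.towerDelta n x, (injective_iff_map_eq_zero _).mpr fun w hw => ?_,
      le_antisymm ?_ fun η hη => ?_, fun w X => Subtype.ext ?_, fun ψ h X =>
        D.towerD_of_mem h x X⟩
    · have h0 : D.towerRetrK n x w = 0 := kEval_injective x <| LinearMap.ext fun X =>
        D.towerIncl_injective n x <| by
          rw [← towerDelta_apply, hw, map_zero, LinearMap.zero_apply, LinearMap.zero_apply,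
            map_zero]
          rfl
      refine Subtype.ext ?_
      rw [← D.towerInclK_retr w.2, h0, map_zero]
      rfl
    · rintro _ ⟨w, rfl⟩ X
      refine Subtype.ext ?_
      rw [towerDelta_apply, towerJN_apply, towerDelta_apply, towerRetr_incl, kEval_JM]
    · have hJ : ∀ X, D.towerRetr n x (η (JM x X)) =
          (D.stage n).JL x (D.towerRetr n x (η X)) := fun X => by
        rw [hη, towerJN_apply, towerRetr_incl]
      refine ⟨⟨D.towerInclK n x (kMk x (D.towerRetr n x ∘ₗ (D.tower.N n x).subtype ∘ₗ η)
        hJ), D.towerIncl_mem (n + 1) x _⟩, LinearMap.ext fun X => Subtype.ext ?_⟩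
      rw [towerDelta_apply, towerRetrK_incl]
      exact D.towerIncl_retr (η X).2
    · rw [towerDelta_apply, towerRetrK_towerJN, towerJN_apply, towerDelta_apply, towerRetr_incl,
        kEval_kComplexStr]
  D_pr ψ x X := by
    let C : RealOp V V := D.baseStage.conn
    have hC : ∀ φ X, C.kbarPart JM J φ x X = D φ x X := fun φ X => D.baseStage_kbarPart φ x X
    -- The first operator is `∇ π ψ + κ` with `κ` of type `K`, so its `K̄`-part is that of `∇`,
    -- which is `D`.
    obtain ⟨κ, hκ, hd⟩ : ∃ κ : (TM M).fiber x →ₗ[ℝ] V.fiber x, (∀ Z, κ (JM x Z) = J x (κ Z)) ∧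
        ∀ Z, D.towerD 0 ψ x Z = C ((D.tower.pr 0).app ψ) x Z + κ Z :=
      ⟨kEval x (D.towerRetrK 0 x (ψ x)), kEval_JM _, D.baseStage.nextD_apply ψ x⟩
    refine (hC _ X).symm.trans ?_
    rw [RealOp.kbarPart, RealOp.kbarPart, hd, hd, hκ, map_add, J.sq]
    module

theorem nonempty_jetComplex : Nonempty (JetComplex D) := ⟨D.jetComplex⟩

end HolStr

end Existence

end

theorem mainTheorem10 {M : Type u} [TopologicalSpace M] [T2Space M] [SigmaCompactSpace M]
    [ChartedSpace (EuclideanSpace ℝ (Fin 2)) M] [IsManifold (𝓡 2) ∞ M]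
    (JM : ComplexStr (TM M)) :
    -- existence of holomorphic jet complexes
    (∀ (V : SmoothVB.{u, v} M) (J : ComplexStr V) (D : HolStr JM J), Nonempty (JetComplex D)) ∧
    -- unique extension of holomorphic bundle maps
    (∀ (V : SmoothVB.{u, v} M) (J : ComplexStr V) (D : HolStr JM J)
      (V' : SmoothVB.{u, w} M) (J' : ComplexStr V') (D' : HolStr JM J')
      (𝒱 : JetComplex D) (𝒱' : JetComplex D') (T₀ : BundleHom V V'),
      IsHolomorphicHom D D' T₀ → ∃! T : JetHom 𝒱 𝒱', T.map 0 = T₀) ∧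
    -- uniqueness up to unique isomorphism
    (∀ (V : SmoothVB.{u, v} M) (J : ComplexStr V) (D : HolStr JM J) (𝒱 𝒱' : JetComplex D),
      ∃ T : JetHom 𝒱 𝒱', T.map 0 = BundleHom.id V ∧ T.IsIso ∧
        ∀ T' : JetHom 𝒱 𝒱', T'.map 0 = BundleHom.id V → T' = T) ∧
    -- the canonical complex structure and the induced holomorphic structures
    (∀ (V : SmoothVB.{u, v} M) (J : ComplexStr V) (D : HolStr JM J) (𝒱 : JetComplex D),
      (∃! A : AdaptedCS 𝒱, A.CommutesWithKPart) ∧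
      (∀ A : AdaptedCS 𝒱, A.CommutesWithKPart ↔ A.KbarCommutatorVanishesOnFlag) ∧
      (∀ A : AdaptedCS 𝒱, ∃! Dn : ∀ n, HolStr JM (A.S n), A.Induces Dn) ∧
      (∀ (A : AdaptedCS 𝒱) (Dn : ∀ n, HolStr JM (A.S n)),
        A.CommutesWithKPart → A.Induces Dn →
        -- `D_0 = D` and the projections are holomorphic
        (∀ ψ x X, Dn 0 ψ x X = D ψ x X) ∧
        (∀ n, IsHolomorphicHom (Dn (n + 1)) (Dn n) (𝒱.pr n)) ∧
        -- the Hopf field of `D_n` vanishes on `F_{n-1}`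
        (∀ n (ψ : Sec (𝒱.E (n + 1))) x X, ψ x ∈ 𝒱.flag (n + 1) n x →
          (Dn (n + 1)).hopf ψ x X = 0) ∧
        -- on the subbundles `F_k ⊆ V_n`, `k < n`, `D_n` restricts to the complex linear `∂̄_n`
        (∀ n k (ψ : Sec (𝒱.E n)), k < n → (∀ x, ψ x ∈ 𝒱.flag n k x) →
          ∀ x X, Dn n ψ x X ∈ 𝒱.flag n k x ∧ Dn n ψ x X = (Dn n).delbar ψ x X ∧
            Dn n ((A.S n).toBundleHom.app ψ) x X = A.S n x (Dn n ψ x X)))) ∧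
    -- the quaternionic case
    (∀ (V : SmoothVB.{u, v} M) (q : QuatStr V) (J : ComplexStr V) (D : HolStr JM J),
      QuatStr.IsLinear q q J.toBundleHom → RealOp.IsQuatLinear q q D.toRealOp →
      -- every jet complex is quaternionic in exactly one way
      (∀ 𝒱 : JetComplex D, Nonempty (Unique (QuatJetStr 𝒱 q))) ∧
      -- the unique isomorphism between two jet complexes is quaternionic linear
      (∀ (𝒱 𝒱' : JetComplex D) (R : QuatJetStr 𝒱 q) (R' : QuatJetStr 𝒱' q) (T : JetHom 𝒱 𝒱'),
        T.map 0 = BundleHom.id V → ∀ n, QuatStr.IsLinear (R.str n) (R'.str n) (T.map n)) ∧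
      (∀ (𝒱 : JetComplex D) (R : QuatJetStr 𝒱 q),
        -- the canonical complex and holomorphic structures are quaternionic
        (∀ A : AdaptedCS 𝒱, A.CommutesWithKPart →
          (∀ n, QuatStr.IsLinear (R.str n) (R.str n) (A.S n).toBundleHom) ∧
          ∀ Dn : ∀ n, HolStr JM (A.S n), A.Induces Dn →
            ∀ n, RealOp.IsQuatLinear (R.str n) (R.str n) (Dn n).toRealOp) ∧
        -- the prolongation maps exist, are unique, injective and quaternionic linear
        (∃! P : ∀ n, D.H0 →ₗ[ℝ] Sec (𝒱.E n), IsProlongation 𝒱 P) ∧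
        ∀ P : ∀ n, D.H0 →ₗ[ℝ] Sec (𝒱.E n), IsProlongation 𝒱 P →
          ∀ n, Function.Injective (P n) ∧
            ∀ (a : ℍ[ℝ]) (ψ φ : D.H0), (φ : Sec V) = (q.rmul a).app (ψ : Sec V) →
              P n φ = ((R.str n).rmul a).app (P n ψ))) := by
  refine ⟨fun V J D => D.nonempty_jetComplex,
    fun V J D V' J' D' 𝒱 𝒱' T₀ hT₀ => JetHom.existsUnique 𝒱 𝒱' hT₀,
    fun V J D 𝒱 𝒱' => JetHom.exists_iso 𝒱 𝒱',
    fun V J D 𝒱 => ⟨AdaptedCS.existsUnique 𝒱, fun A => A.commutesWithKPart_iff_kbar,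
      fun A => A.existsUnique_induces, fun A Dn hA hDn => ?_⟩,
    fun V q J D hJ hD => ⟨fun 𝒱 => QuatJetStr.nonempty_unique 𝒱 hJ hD,
      fun 𝒱 𝒱' R R' T hT => R.isLinear_jetHom R' T hT,
      fun 𝒱 R => ⟨fun A hA => ?_, IsProlongation.existsUnique 𝒱, fun P hP n => ?_⟩⟩⟩
  · have hA' := A.kbarCommutatorVanishesOnFlag hA
    exact ⟨hDn.zero_apply, hDn.isHolomorphicHom, fun n ψ x X hψ => hDn.hopf_eq_zero hA' X hψ,
      fun n k ψ hk hψ => hDn.restrict_flag hA' hk hψ⟩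
  · have hS := fun n => R.isLinear_complexStr hJ hA n
    exact ⟨hS, fun Dn hDn => R.isQuatLinear_holStr hS hDn⟩
  · exact ⟨hP.injective n, fun a ψ φ h => hP.quatLinear R h n⟩
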